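/- **Setting.** Let $Q=\mathbb R/\mathbb Z$ with $\|x\|_{\rm per}=\min_{z\in\mathbb Z}|x-z|$, and let $1$ denote the Lebesgue measure on $Q$. For positive measures on $Q$ set $W_{\rm per}^2(\nu_0,\nu_1)=\min_\pi\int_{Q\times Q}\|x-y\|_{\rm per}^2\,d\pi$, the minimum being over measures $\pi$ on $Q\times Q$ with marginals $\nu_0,\nu_1$ ($=+\infty$ if the masses differ). For $T>0$ let $Q_T=(-T,T)\times Q$. Let $\mathcal A_T$ be the set of pairs $(\mu,m)$ of a finite positive measure $\mu$ and a finite signed measure $m\ll\mu$ on $Q_T$ such that $\partial_t\mu+\partial_x m=0$ in the sense of distributions in $Q_T$ and $\mu=dt\otimes\mu_t$, where for a.e. $t\in(-T,T)$ the measure $\mu_t=\sum_i\phi_i\delta_{X_i}$ is a finite or countable sum of Dirac masses ($\phi_i>0$, $X_i\in Q$). Let $\mathcal A_T^*=\{\mu:\exists m,\ (\mu,m)\in\mathcal A_T\}$. For $\lambda>0$ and $\mu\in\mathcal A_T^*$ let $$I(\mu)=\inf_{m:\,(\mu,m)\in\mathcal A_T}\left\{\int_{-T}^T\#\{x\in Q:\mu_t(\{x\})>0\}\,dt+\int_{Q_T}\Big|\frac{dm}{d\mu}\Big|^2d\mu\right\},$$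 $$\mathcal E^{\rm 1d}_{\lambda,T}(\mu)=I(\mu)+\lambda\left(W_{\rm per}^2(\mu_T,1)+W_{\rm per}^2(\mu_{-T},1)\right),$$ where the traces $\mu_{\pm T}$ are the weak (essential) limits of $\mu_t$ as $t\to\pm T$; they exist if $I(\mu)<\infty$, and $\mathcal E^{\rm 1d}_{\lambda,T}(\mu)=+\infty$ otherwise. We call $\mu$ symmetric if $\mu_{-t}=\mu_t$ for a.e. $t\in(-T,T)$. For $\tau>0$ let $\mathcal C_\tau$ be the set of $X:[-\tau,\tau]\times Q\to Q$ with $X(t,\cdot)$ Lebesgue measurable for every $t$, $X(-\tau,x)=X(\tau,x)=x$ for every $x$, and $t\mapsto X(t,x)$ absolutely continuous on $[-\tau,\tau]$ for a.e. $x$. Set $T_\lambda=T+\lambda^{-1}$, $\phi_X(y,t)=|\{x\in Q: X(t,x)=y\}|$ and, with the convention $0^{-1}=\infty$, $$\mathcal L_{\lambda,T}(X)=\int_{Q_T}\frac1{\phi_X(X(t,x),t)}\,dx\,dt+\int_{Q_{T_\lambda}}|\partial_tX|^2\,dx\,dt,\qquad X\in\mathcal C_{T_\lambda}.$$ **Theorem.**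 For every $T,\lambda>0$ both minima below are attained and finite, and $$\min_{\mu\in\mathcal A_T^*}\mathcal E^{\rm 1d}_{\lambda,T}(\mu)=\min_{X\in\mathcal C_{T_\lambda}}\mathcal L_{\lambda,T}(X).$$ Moreover, for every minimizer $X\in\mathcal C_{T_\lambda}$ of $\mathcal L_{\lambda,T}$, letting $\mu_t=X(t,\cdot)_\sharp1$ for $t\in[-T,T]$, the measure $\mu=dt\otimes\mu_t$ belongs to $\mathcal A_T^*$, has traces $\mu_{\pm T}$, and minimizes $\mathcal E^{\rm 1d}_{\lambda,T}$. Conversely, for every symmetric minimizer $\mu\in\mathcal A_T^*$ of $\mathcal E^{\rm 1d}_{\lambda,T}$ there is a minimizer $X\in\mathcal C_{T_\lambda}$ of $\mathcal L_{\lambda,T}$ that induces it: $\mu_t=X(t,\cdot)_\sharp1$ for a.e. $t\in(-T,T)$, and $\mu_{\pm T}=X(\pm T,\cdot)_\sharp1$. -/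

import Mathlib

open MeasureTheory Set Filter
open scoped ENNReal ContDiff Topology

noncomputable section

namespace BranchedTransport

/-- The one-dimensional torus `Q = ℝ / ℤ`. Its norm `‖x‖` is the distance of `x` to `0`
(the distance of a representative to the nearest integer), and `volume` is the Lebesgue measure,
of total mass one. -/
abbrev Q : Type := UnitAddCircle

/-! ### The periodic Wasserstein distance -/

/-- The squared periodic Wasserstein distance between two measures on the torus: the infimum of
`∫ ‖x - y‖² dπ` over the transport plans `π`. It is `∞` if there is no plan, i.e. if the
masses differ. -/
def wassersteinSq (μ₀ μ₁ : Measure Q) : ℝ≥0∞ :=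
  ⨅ (π : Measure (Q × Q)) (_ : π.map Prod.fst = μ₀ ∧ π.map Prod.snd = μ₁),
    ∫⁻ z, ‖z.1 - z.2‖ₑ ^ 2 ∂π

/-! ### Admissible measures on `Q_T = (-T, T) × Q` -/

/-- `μ = dt ⊗ ν t` on `(-T, T) × Q`. In particular `μ` vanishes outside `(-T, T) × Q`. -/
structure HasSlices (T : ℝ) (μ : Measure (ℝ × Q)) (ν : ℝ → Measure Q) : Prop where
  aemeasurable : AEMeasurable ν (volume.restrict (Ioo (-T) T))
  apply_eq : ∀ A : Set (ℝ × Q), MeasurableSet A →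
    μ A = ∫⁻ t in Ioo (-T) T, ν t (Prod.mk t ⁻¹' A)

open Classical in
/-- The slices `μ_t` of a measure `μ = dt ⊗ μ_t` (a choice of them; for finite `μ` they are
unique up to a null set of times). -/
def slice (T : ℝ) (μ : Measure (ℝ × Q)) : ℝ → Measure Q :=
  if h : ∃ ν, HasSlices T μ ν then h.choose else 0

/-- `σ = ∑ᵢ φᵢ δ_{Xᵢ}`, a finite or countable sum (weights are allowed to be zero in order to
include the finite sums). -/
def IsAtomic (σ : Measure Q) : Prop :=
  ∃ (φ : ℕ → ℝ≥0∞) (X : ℕ → Q), σ = Measure.sum fun i => φ i • Measure.dirac (X i)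

/-- A smooth function on `ℝ × Q` with compact support in `(-T, T) × Q`. -/
structure IsTestFunction (T : ℝ) (ζ : ℝ × Q → ℝ) : Prop where
  smooth : ContDiff ℝ ∞ fun p : ℝ × ℝ => ζ (p.1, (p.2 : Q))
  hasCompactSupport : HasCompactSupport ζ
  tsupport_subset : tsupport ζ ⊆ Ioo (-T) T ×ˢ univ

/-- The derivative `∂_t ζ`. -/
def dt (ζ : ℝ × Q → ℝ) (z : ℝ × Q) : ℝ := deriv (fun s : ℝ => ζ (s, z.2)) z.1

/-- The derivative `∂_x ζ`. -/
def dx (ζ : ℝ × Q → ℝ) (z : ℝ × Q) : ℝ := deriv (fun h : ℝ => ζ (z.1, z.2 + (h : Q))) 0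

/-- The pairs `(μ, m)` of a positive finite measure `μ` and a signed (finite) measure `m ≪ μ`
on `(-T, T) × Q` with `∂_t μ + ∂_x m = 0` in the sense of distributions, and
`μ = dt ⊗ μ_t` with `μ_t` atomic for almost every `t`. Since `m = (dm/dμ) μ`, the
integral of `∂_x ζ` against `m` is the integral of `(dm/dμ) ∂_x ζ` against `μ`. -/
structure IsAdmissiblePair (T : ℝ) (μ : Measure (ℝ × Q)) (m : SignedMeasure (ℝ × Q)) :
    Prop where
  isFiniteMeasure : IsFiniteMeasure μ
  absolutelyContinuous : m ≪ᵥ μ.toENNRealVectorMeasure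
  continuityEq : ∀ ζ : ℝ × Q → ℝ, IsTestFunction T ζ →
    ∫ z, (dt ζ z + m.rnDeriv μ z * dx ζ z) ∂μ = 0
  slices : ∃ ν, HasSlices T μ ν ∧ ∀ᵐ t ∂volume.restrict (Ioo (-T) T), IsAtomic (ν t)

/-- The set of admissible measures `μ`. -/
def admissible (T : ℝ) : Set (Measure (ℝ × Q)) := {μ | ∃ m, IsAdmissiblePair T μ m}

/-! ### The Eulerian energy -/

/-- The number of atoms of `σ`, i.e. `∑_x σ({x})⁰` with the convention `0⁰ = 0`. -/
def numAtoms (σ : Measure Q) : ℝ≥0∞ := ({x : Q | σ {x} ≠ 0}.encard : ℝ≥0∞)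

/-- `I(μ, m)`: perimeter plus kinetic energy. -/
def pairEnergy (T : ℝ) (μ : Measure (ℝ × Q)) (m : SignedMeasure (ℝ × Q)) : ℝ≥0∞ :=
  (∫⁻ t in Ioo (-T) T, numAtoms (slice T μ t)) + ∫⁻ z, ‖m.rnDeriv μ z‖ₑ ^ 2 ∂μ

/-- `I(μ)`: the infimum of `I(μ, m)` over all `m` such that `(μ, m)` is admissible. -/
def internalEnergy (T : ℝ) (μ : Measure (ℝ × Q)) : ℝ≥0∞ :=
  ⨅ (m : SignedMeasure (ℝ × Q)) (_ : IsAdmissiblePair T μ m), pairEnergy T μ m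

/-- `σ` is the weak limit of `μ_t` as `t` tends to an end point of `(-T, T)` along `l`. As `μ_t`
is defined up to a null set of times, the limit is an essential limit. -/
structure IsTrace (T : ℝ) (μ : Measure (ℝ × Q)) (l : Filter ℝ) (σ : Measure Q) : Prop where
  isFiniteMeasure : IsFiniteMeasure σ
  tendsto : ∀ ξ : C(Q, ℝ),
    Tendsto (fun t => ∫ x, ξ x ∂(slice T μ t)) (l ⊓ ae volume) (𝓝 (∫ x, ξ x ∂σ))

/-- `σ` is the trace `μ_T`. -/
abbrev IsTopTrace (T : ℝ) (μ : Measure (ℝ × Q)) (σ : Measure Q) : Prop :=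
  IsTrace T μ (𝓝[<] T) σ

/-- `σ` is the trace `μ_{-T}`. -/
abbrev IsBottomTrace (T : ℝ) (μ : Measure (ℝ × Q)) (σ : Measure Q) : Prop :=
  IsTrace T μ (𝓝[>] (-T)) σ

/-- The boundary term `W²(μ_T, 1) + W²(μ_{-T}, 1)`. A trace is unique if it exists, so the infima
are over at most one measure. The traces exist if `I(μ) < ∞`; a missing trace gives `∞`. -/
def boundaryEnergy (T : ℝ) (μ : Measure (ℝ × Q)) : ℝ≥0∞ :=
  (⨅ (σ : Measure Q) (_ : IsTopTrace T μ σ), wassersteinSq σ volume) +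
    ⨅ (σ : Measure Q) (_ : IsBottomTrace T μ σ), wassersteinSq σ volume

/-- The energy `E_{λ,T}(μ) = I(μ) + λ (W²(μ_T, 1) + W²(μ_{-T}, 1))`. -/
def energy (lam T : ℝ) (μ : Measure (ℝ × Q)) : ℝ≥0∞ :=
  internalEnergy T μ + ENNReal.ofReal lam * boundaryEnergy T μ

/-- `μ_{-t} = μ_t`. -/
def IsSymmetric (T : ℝ) (μ : Measure (ℝ × Q)) : Prop :=
  ∀ᵐ t ∂volume.restrict (Ioo (-T) T), slice T μ (-t) = slice T μ t

/-! ### The Lagrangian functional -/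

/-- The families of curves `X : [-τ, τ] × Q → Q`, parametrized by their common initial and final
point. The values of `X t` for `|t| > τ` play no role. -/
structure IsCurveFamily (τ : ℝ) (X : ℝ → Q → Q) : Prop where
  aemeasurable : ∀ t ∈ Icc (-τ) τ, AEMeasurable (X t) volume
  initial : ∀ x, X (-τ) x = x
  final : ∀ x, X τ x = x
  absolutelyContinuous :
    ∀ᵐ x : Q, AbsolutelyContinuousOnInterval (fun t => X t x) (-τ) τ

/-- The set `C_τ`. -/
def curveFamilies (τ : ℝ) : Set (ℝ → Q → Q) := {X | IsCurveFamily τ X}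

/-- The derivative at time `t` of a curve in the torus: the derivative at `s = t` of the
representative of `γ s - γ t` in `[-1/2, 1/2)`. If `γ` is continuous at `t` this is the derivative
of any lift of `γ` to `ℝ`. -/
def circleDeriv (γ : ℝ → Q) (t : ℝ) : ℝ :=
  deriv (fun s => (AddCircle.equivIco (1 : ℝ) (-1 / 2) (γ s - γ t) : ℝ)) t

/-- The multiplicity `φ_X(y, t) = |{x : X(t, x) = y}|`. -/
def multiplicity (X : ℝ → Q → Q) (y : Q) (t : ℝ) : ℝ≥0∞ := volume {x : Q | X t x = y}

/-- `T_λ = T + 1/λ`. -/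
def extendedTime (lam T : ℝ) : ℝ := T + lam⁻¹

/-- The Lagrangian functional: the perimeter is counted on `(-T, T)` only, the kinetic energy on
all of `(-T_λ, T_λ)`. In `ℝ≥0∞` one has `0⁻¹ = ∞`. -/
def lagrangian (lam T : ℝ) (X : ℝ → Q → Q) : ℝ≥0∞ :=
  (∫⁻ z : ℝ × Q in Ioo (-T) T ×ˢ univ, (multiplicity X (X z.1 z.2) z.1)⁻¹) +
    ∫⁻ z : ℝ × Q in Ioo (-extendedTime lam T) (extendedTime lam T) ×ˢ univ,
      ‖circleDeriv (fun t => X t z.2) z.1‖ₑ ^ 2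

/-- `μ_t = X(t, ·)_♯ 1` for `t ∈ [-T, T]`: for the slices with `|t| < T`, and for the traces. -/
structure IsInducedBy (T : ℝ) (μ : Measure (ℝ × Q)) (X : ℝ → Q → Q) : Prop where
  hasSlices : HasSlices T μ fun t => (volume : Measure Q).map (X t)
  topTrace : IsTopTrace T μ ((volume : Measure Q).map (X T))
  bottomTrace : IsBottomTrace T μ ((volume : Measure Q).map (X (-T)))

end BranchedTransport

end

open BranchedTransport

noncomputable section

namespace BranchedTransport

/-! Both minima are compared with `minimalValue`, the infimum of the Lagrangian functional.

From curves to measures (`IsCurveFamily.exists_admissible`). The law of a curve family at each time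
gives the slices of a measure. Its Eulerian velocity at a point of space-time is the mean of the
velocities of the particles that meet there, so the kinetic energy cannot increase. The perimeters
agree: integrating the inverse multiplicity over labels is integrating the inverse mass of a point
against the law (`atomSum`), and this counts atoms. Each of the two end legs has duration 1/lam and
joins `X (±T) x` to `x`; Cauchy-Schwarz bounds its kinetic energy below by lam times the cost of the
plan with these pairs, hence by the Wasserstein term. So the induced measure costs at most as much
as the curves.

From measures to curves (`exists_flow_of_energy_lt`). Cut the evolution at time 0, reverse the
negative half, and keep the cheaper half with its boundary cost. Following it by geodesics of a
transport plan to the uniform measure yields a solution of the continuity equation that is uniform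
from time T + 1/lam on. On the circle such a solution is carried by particles that never change
their order, so no general superposition principle is needed. Indeed, mollification in space and
time gives a smooth positive density with a smooth flux; the quantiles of its suitably normalized
distribution function move with velocity flux/density, and by Cauchy-Schwarz the mollified energy is
not larger. The flux fixes the normalization, and thereby also the winding of the particles around
the circle. When the mollification is removed, the velocities converge weakly in L² and the
quantiles converge almost everywhere, because monotone functions whose averages converge do converge
(`tendsto_of_tendsto_integral`, `IsFlow.exists_limit`). The limit flow has the original slices,
hence the same number of atoms. Since it ends at the identity, running it backwards and then
forwards produces an admissible curve family whose cost is at most twice that of the half.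

Existence. The two steps replace any minimizing sequence of curve families by monotone flows, which
are compact. The perimeter is lower semicontinuous, since `atomSum` is the cardinality of the
support and support points survive weak limits (`WeakTendsto.atomSum_le_liminf`); Fatou's lemma
concludes.

Converse. For a symmetric minimizer both halves have the same slices. The flows built from nearly
optimal plans all have these laws, so their limit has them too, and its reflection is a minimizing
curve family inducing the measure. -/

/-- The representative of a point of the torus in `[-1/2, 1/2)`. -/
def circleRep (q : Q) : ℝ := (AddCircle.equivIco (1 : ℝ) (-1 / 2) q : ℝ)

@[simp] lemma coe_circleRep (q : Q) : ((circleRep q : ℝ) : Q) = q := AddCircle.coe_equivIco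

lemma circleRep_mem (q : Q) : circleRep q ∈ Ico (-1 / 2 : ℝ) (1 / 2) := by
  have := (AddCircle.equivIco (1 : ℝ) (-1 / 2) q).2
  simp only [mem_Ico] at this ⊢
  exact ⟨this.1, by have := this.2; unfold circleRep; linarith⟩

lemma circleRep_coe {x : ℝ} (h : x ∈ Ico (-1 / 2 : ℝ) (1 / 2)) : circleRep (x : Q) = x := by
  have h' : x ∈ Ico (-1 / 2 : ℝ) (-1 / 2 + 1) := ⟨h.1, by linarith [h.2]⟩
  unfold circleRep
  rw [AddCircle.equivIco_coe_eq h']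

lemma circleRep_coe_of_abs_lt {x : ℝ} (h : |x| < 1 / 2) : circleRep (x : Q) = x := by
  rw [abs_lt] at h
  exact circleRep_coe ⟨by linarith [h.1], h.2⟩

@[simp] lemma circleRep_zero : circleRep 0 = 0 := by
  have := circleRep_coe_of_abs_lt (x := 0) (by norm_num)
  simpa using this

lemma norm_coe_eq_abs {x : ℝ} (h : |x| ≤ 1 / 2) : ‖(x : Q)‖ = |x| :=
  (AddCircle.norm_coe_eq_abs_iff (1 : ℝ) one_ne_zero).2 (by simpa using h)

lemma abs_circleRep_le (q : Q) : |circleRep q| ≤ 1 / 2 := by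
  rw [abs_le]
  have := circleRep_mem q
  exact ⟨by linarith [this.1], this.2.le⟩

lemma norm_eq_abs_circleRep (q : Q) : ‖q‖ = |circleRep q| := by
  conv_lhs => rw [← coe_circleRep q]
  exact norm_coe_eq_abs (abs_circleRep_le q)

lemma norm_coe_le_abs (x : ℝ) : ‖(x : Q)‖ ≤ |x| := by
  rcases le_or_gt |x| (1 / 2) with h | h
  · exact (norm_coe_eq_abs h).le
  · rw [norm_eq_abs_circleRep]
    exact (abs_circleRep_le _).trans h.le

lemma measurable_circleRep : Measurable circleRep :=
  measurable_subtype_coe.comp (AddCircle.measurableEquivIco (1 : ℝ) (-1 / 2)).measurable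

lemma continuous_coeQ : Continuous (fun x : ℝ => (x : Q)) := AddCircle.continuous_mk' 1

lemma measurable_coeQ : Measurable (fun x : ℝ => (x : Q)) := continuous_coeQ.measurable

/-! ### Velocities through the exponential map -/

/-- The inclusion of the torus in the complex plane as the unit circle. -/
def expQ (q : Q) : ℂ := (AddCircle.toCircle q : ℂ)

lemma continuous_expQ : Continuous expQ := by
  unfold expQ
  exact continuous_subtype_val.comp AddCircle.continuous_toCircle

lemma expQ_coe (x : ℝ) : expQ (x : Q) = Complex.exp (2 * Real.pi * x * Complex.I) := by
  unfold expQ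
  rw [AddCircle.toCircle_apply_mk, Circle.coe_exp]
  push_cast
  simp

lemma expQ_add (p q : Q) : expQ (p + q) = expQ p * expQ q := by
  simp [expQ, AddCircle.toCircle_add]

lemma expQ_ne_zero (q : Q) : expQ q ≠ 0 := by simp [expQ]

lemma norm_expQ (q : Q) : ‖expQ q‖ = 1 := Circle.norm_coe _

lemma expQ_sub (p q : Q) : expQ (p - q) = expQ p / expQ q := by
  rw [eq_div_iff (expQ_ne_zero q), ← expQ_add]; simp

lemma norm_expQ_sub_le (p q : Q) : ‖expQ p - expQ q‖ ≤ 2 * Real.pi * ‖p - q‖ := by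
  have h : expQ p - expQ q = expQ q * (expQ (p - q) - 1) := by
    rw [expQ_sub]; field_simp [expQ_ne_zero q]
  rw [h, norm_mul, norm_expQ, one_mul, norm_eq_abs_circleRep]
  conv_lhs => rw [← coe_circleRep (p - q), expQ_coe]
  have := Real.norm_exp_I_mul_ofReal_sub_one_le (x := 2 * Real.pi * circleRep (p - q))
  rw [show Complex.I * ((2 * Real.pi * circleRep (p - q) : ℝ) : ℂ)
    = 2 * Real.pi * circleRep (p - q) * Complex.I by push_cast; ring] at this
  refine this.trans ?_
  rw [Real.norm_eq_abs, abs_mul, abs_of_pos Real.two_pi_pos]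

lemma circleRep_eq_log {q : Q} (h : ‖q‖ < 1 / 2) :
    circleRep q = (Complex.log (expQ q)).im / (2 * Real.pi) := by
  rw [norm_eq_abs_circleRep, abs_lt] at h
  conv_rhs => rw [← coe_circleRep q, expQ_coe]
  rw [Complex.log_im, show (2 * Real.pi * circleRep q * Complex.I : ℂ)
    = ((2 * Real.pi * circleRep q : ℝ) : ℂ) * Complex.I by push_cast; ring,
    Complex.arg_exp_mul_I, toIocMod_eq_self _ |>.2]
  · field_simp
  · constructor <;> nlinarith [Real.pi_pos]

lemma hasDerivAt_expQ_comp {γ : ℝ → Q} {t c : ℝ}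
    (h : HasDerivAt (fun s => circleRep (γ s - γ t)) c t) :
    HasDerivAt (fun s => expQ (γ s)) (2 * Real.pi * c * Complex.I * expQ (γ t)) t := by
  have h1 : (fun s => expQ (γ s)) =
      fun s => Complex.exp (2 * Real.pi * circleRep (γ s - γ t) * Complex.I) * expQ (γ t) := by
    ext s
    rw [← expQ_coe, coe_circleRep, ← expQ_add]; simp
  rw [h1]
  have h2 := ((((h.ofReal_comp).const_mul (2 * Real.pi : ℂ)).mul_const Complex.I).cexp).mul_const
    (expQ (γ t))
  simpa using h2

lemma hasDerivAt_circleRep_of_expQ {γ : ℝ → Q} {t : ℝ} {c : ℂ} (hc : ContinuousAt γ t)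
    (h : HasDerivAt (fun s => expQ (γ s)) c t) :
    HasDerivAt (fun s => circleRep (γ s - γ t)) ((c / expQ (γ t)).im / (2 * Real.pi)) t := by
  have h1 : HasDerivAt (fun s => expQ (γ s - γ t)) (c / expQ (γ t)) t := by
    simp_rw [expQ_sub]; exact h.div_const _
  have h2 := h1.clog_real (by simp [expQ])
  have h3 : HasDerivAt (fun s => (Complex.log (expQ (γ s - γ t))).im / (2 * Real.pi))
      ((c / expQ (γ t)).im / (2 * Real.pi)) t := by
    have := (Complex.imCLM.hasFDerivAt.comp_hasDerivAt t h2).div_const (2 * Real.pi)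
    simpa [expQ] using this
  refine h3.congr_of_eventuallyEq ?_
  have h4 : Tendsto (fun s => ‖γ s - γ t‖) (𝓝 t) (𝓝 0) := by
    have : ContinuousAt (fun s => ‖γ s - γ t‖) t := (hc.sub continuousAt_const).norm
    simpa [ContinuousAt] using this
  filter_upwards [h4.eventually (gt_mem_nhds (by norm_num : (0 : ℝ) < 1 / 2))] with s hs
  exact circleRep_eq_log hs

lemma circleDeriv_eq (γ : ℝ → Q) (t : ℝ) :
    circleDeriv γ t = deriv (fun s => circleRep (γ s - γ t)) t := rfl

/-- The chart used in `circleDeriv` moves with the base point. Composing with the exponential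
replaces all charts by one complex curve, whose logarithmic derivative is the velocity; existence
almost everywhere and measurability of the velocity are read off from it. Differentiability is
equivalent on both sides, so the default value 0 of `deriv` also matches. -/
lemma circleDeriv_eq_expQ {γ : ℝ → Q} {t : ℝ} (hc : ContinuousAt γ t) :
    circleDeriv γ t = (deriv (fun s => expQ (γ s)) t / expQ (γ t)).im / (2 * Real.pi) := by
  rw [circleDeriv_eq]
  by_cases h : DifferentiableAt ℝ (fun s => expQ (γ s)) t
  · exact (hasDerivAt_circleRep_of_expQ hc h.hasDerivAt).deriv
  · rw [deriv_zero_of_not_differentiableAt h, deriv_zero_of_not_differentiableAt]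
    · simp
    · intro h'
      exact h (hasDerivAt_expQ_comp h'.hasDerivAt).differentiableAt

lemma hasDerivAt_circleDeriv {γ : ℝ → Q} {t : ℝ} (hc : ContinuousAt γ t)
    (h : DifferentiableAt ℝ (fun s => expQ (γ s)) t) :
    HasDerivAt (fun s => circleRep (γ s - γ t)) (circleDeriv γ t) t :=
  (hasDerivAt_circleRep_of_expQ hc h.hasDerivAt).differentiableAt.hasDerivAt

lemma circleDeriv_coe {Y : ℝ → ℝ} {γ : ℝ → Q} {t : ℝ} (hc : ContinuousAt Y t)
    (h : γ =ᶠ[𝓝 t] fun s => (Y s : Q)) : circleDeriv γ t = deriv Y t := by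
  rw [circleDeriv_eq]
  have h1 : (fun s => circleRep (γ s - γ t)) =ᶠ[𝓝 t] fun s => Y s - Y t := by
    have h4 : Tendsto (fun s => |Y s - Y t|) (𝓝 t) (𝓝 0) := by
      have : ContinuousAt (fun s => |Y s - Y t|) t := (hc.sub continuousAt_const).abs
      simpa [ContinuousAt] using this
    filter_upwards [h, h4.eventually (gt_mem_nhds (by norm_num : (0 : ℝ) < 1 / 2))] with s hs hs'
    rw [hs, h.self_of_nhds, ← AddCircle.coe_sub, circleRep_coe_of_abs_lt hs']
  rw [h1.deriv_eq, deriv_sub_const]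

/-! ### Absolutely continuous curves -/

/-- The way absolute continuity is passed on below: to Lipschitz functions of time and the curve,
and to curves that agree on the interval. -/
lemma AbsolutelyContinuousOnInterval.of_dist_le {α β : Type*} [PseudoMetricSpace α]
    [PseudoMetricSpace β] {f : ℝ → α} {g : ℝ → β} {a b C : ℝ}
    (hf : AbsolutelyContinuousOnInterval f a b)
    (h : ∀ s ∈ uIcc a b, ∀ t ∈ uIcc a b, dist (g s) (g t) ≤ C * (dist s t + dist (f s) (f t))) :
    AbsolutelyContinuousOnInterval g a b := by
  rw [absolutelyContinuousOnInterval_iff] at hf ⊢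
  intro ε hε
  obtain ⟨δ, hδ, H⟩ := hf (ε / (2 * (|C| + 1))) (by positivity)
  refine ⟨min δ (ε / (2 * (|C| + 1))), by positivity, fun E hE hl => ?_⟩
  have h1 := H E hE (hl.trans_le (min_le_left _ _))
  have h2 := hl.trans_le (min_le_right _ _)
  calc ∑ i ∈ Finset.range E.1, dist (g (E.2 i).1) (g (E.2 i).2)
      ≤ ∑ i ∈ Finset.range E.1, (|C| + 1) *
        (dist (E.2 i).1 (E.2 i).2 + dist (f (E.2 i).1) (f (E.2 i).2)) := by
        refine Finset.sum_le_sum fun i hi => ?_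
        have := hE.1 i hi
        refine (h _ this.1 _ this.2).trans ?_
        gcongr
        linarith [le_abs_self C]
    _ = (|C| + 1) * (∑ i ∈ Finset.range E.1, dist (E.2 i).1 (E.2 i).2 +
        ∑ i ∈ Finset.range E.1, dist (f (E.2 i).1) (f (E.2 i).2)) := by
        rw [← Finset.mul_sum, Finset.sum_add_distrib]
    _ < (|C| + 1) * (ε / (2 * (|C| + 1)) + ε / (2 * (|C| + 1))) := by gcongr
    _ = ε := by field_simp; ring

/-- Real and imaginary part are absolutely continuous real functions, and for these
differentiability almost everywhere is known. -/
lemma ae_differentiableAt_expQ {γ : ℝ → Q} {a b : ℝ} (h : AbsolutelyContinuousOnInterval γ a b) :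
    ∀ᵐ t : ℝ, t ∈ uIcc a b → DifferentiableAt ℝ (fun s => expQ (γ s)) t := by
  have h0 : ∀ s t, ‖expQ (γ s) - expQ (γ t)‖ ≤ 2 * Real.pi * (dist s t + dist (γ s) (γ t)) :=
    fun s t => (norm_expQ_sub_le _ _).trans (by
      rw [dist_eq_norm (γ s)]
      have := Real.pi_pos
      gcongr
      exact le_add_of_nonneg_left dist_nonneg)
  have hre : AbsolutelyContinuousOnInterval (fun s => (expQ (γ s)).re) a b := by
    refine AbsolutelyContinuousOnInterval.of_dist_le h (C := 2 * Real.pi) fun s _ t _ => ?_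
    refine le_trans ?_ (h0 s t)
    rw [Real.dist_eq, ← Complex.sub_re]
    exact Complex.abs_re_le_norm _
  have him : AbsolutelyContinuousOnInterval (fun s => (expQ (γ s)).im) a b := by
    refine AbsolutelyContinuousOnInterval.of_dist_le h (C := 2 * Real.pi) fun s _ t _ => ?_
    refine le_trans ?_ (h0 s t)
    rw [Real.dist_eq, ← Complex.sub_im]
    exact Complex.abs_im_le_norm _
  filter_upwards [hre.ae_differentiableAt, him.ae_differentiableAt] with t h1 h2 ht
  have h3 := ((h1 ht).hasDerivAt.ofReal_comp).add
    (((h2 ht).hasDerivAt.ofReal_comp).mul_const Complex.I)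
  refine (h3.differentiableAt).congr_of_eventuallyEq (Eventually.of_forall fun s => ?_)
  exact (Complex.re_add_im _).symm

lemma ae_hasDerivAt_circleRep {γ : ℝ → Q} {a b : ℝ} (hab : a ≤ b)
    (h : AbsolutelyContinuousOnInterval γ a b) :
    ∀ᵐ t ∂volume.restrict (Ioo a b),
      HasDerivAt (fun s => circleRep (γ s - γ t)) (circleDeriv γ t) t := by
  rw [ae_restrict_iff' measurableSet_Ioo]
  filter_upwards [ae_differentiableAt_expQ h] with t ht hm
  have hm' : t ∈ uIcc a b := by rw [uIcc_of_le hab]; exact Ioo_subset_Icc_self hm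
  refine hasDerivAt_circleDeriv ?_ (ht hm')
  have := h.continuousOn
  rw [uIcc_of_le hab] at this
  exact this.continuousAt (Icc_mem_nhds hm.1 hm.2)

/-! ### Measurability of curve families -/

lemma measurable_toContinuousMap {Ω : Type*} [MeasurableSpace Ω] {f : ℝ → Ω → ℂ}
    (hc : ∀ x, Continuous fun t => f t x) (hm : ∀ t, Measurable (f t)) :
    Measurable[_, borel C(ℝ, ℂ)] (fun x => (⟨fun t => f t x, hc x⟩ : C(ℝ, ℂ))) := by
  rw [borel_eq_generateFrom_of_subbasis (ContinuousMap.compactOpen_eq (X := ℝ) (Y := ℂ))]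
  refine measurable_generateFrom ?_
  rintro _ ⟨K, hK, U, hU, rfl⟩
  replace hU : IsOpen U := hU
  replace hK : IsCompact K := hK
  obtain ⟨D, hDK, hDc, hD⟩ := (TopologicalSpace.IsSeparable.of_separableSpace K).exists_countable_dense_subset
  rcases eq_empty_or_nonempty Uᶜ with hne | hne
  · rw [compl_empty_iff] at hne
    subst hne
    convert MeasurableSet.univ
    ext x
    simp [MapsTo]
  -- On a compact K the distance to the complement of U attains its minimum. Hence mapping K into U
  -- means a uniform positive lower bound for this distance, and by continuity the bound need only
  -- be checked on a countable dense subset.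
  have key : (fun x => (⟨fun t => f t x, hc x⟩ : C(ℝ, ℂ))) ⁻¹' {g : C(ℝ, ℂ) | MapsTo g K U}
      = ⋃ n : ℕ, ⋂ t ∈ D, {x | 1 / ((n : ℝ) + 1) ≤ Metric.infDist (f t x) Uᶜ} := by
    ext x
    have hcd : Continuous fun t => Metric.infDist (f t x) Uᶜ :=
      (Metric.continuous_infDist_pt _).comp (hc x)
    simp only [mem_preimage, mem_ofPred_eq, mem_iUnion, mem_iInter]
    constructor
    · intro h
      rcases K.eq_empty_or_nonempty with hK0 | hK0
      · exact ⟨0, fun t ht => by have := hDK ht; simp [hK0] at this⟩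
      obtain ⟨t0, ht0, hmin⟩ := hK.exists_isMinOn hK0 hcd.continuousOn
      have hpos : 0 < Metric.infDist (f t0 x) Uᶜ := by
        refine (hU.isClosed_compl.notMem_iff_infDist_pos hne).1 ?_
        exact fun h' => h' (h ht0)
      obtain ⟨n, hn⟩ := exists_nat_one_div_lt hpos
      exact ⟨n, fun t ht => hn.le.trans (hmin (hDK ht))⟩
    · rintro ⟨n, hn⟩ t ht
      have hcl : IsClosed {t | 1 / ((n : ℝ) + 1) ≤ Metric.infDist (f t x) Uᶜ} :=
        isClosed_le continuous_const hcd
      have h1 : t ∈ {t | 1 / ((n : ℝ) + 1) ≤ Metric.infDist (f t x) Uᶜ} :=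
        (closure_minimal hn hcl) (hD ht)
      have hpos : 0 < Metric.infDist (f t x) Uᶜ := lt_of_lt_of_le (by positivity) h1
      have := (hU.isClosed_compl.notMem_iff_infDist_pos hne).2 hpos
      simpa using this
  rw [key]
  refine MeasurableSet.iUnion fun n => MeasurableSet.biInter hDc fun t _ => ?_
  exact measurableSet_le measurable_const ((Metric.continuous_infDist_pt _).measurable.comp (hm t))

/-- Joint measurability of a derivative with a parameter requires joint continuity in the parameter,
which a merely measurable label does not provide. Taking the curve itself, a point of C(ℝ, ℂ), as
the parameter makes the evaluation jointly continuous, and the label enters through a measurable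
map. -/
lemma measurable_deriv_of_continuous {Ω : Type*} [MeasurableSpace Ω] {f : ℝ → Ω → ℂ}
    (hc : ∀ x, Continuous fun t => f t x) (hm : ∀ t, Measurable (f t)) :
    Measurable fun z : ℝ × Ω => deriv (fun t => f t z.2) z.1 := by
  let _ : MeasurableSpace C(ℝ, ℂ) := borel _
  have : BorelSpace C(ℝ, ℂ) := ⟨rfl⟩
  have h1 : Measurable (fun p : C(ℝ, ℂ) × ℝ => deriv (fun t => p.1 t) p.2) :=
    measurable_deriv_with_param (f := fun (g : C(ℝ, ℂ)) t => g t) ContinuousEval.continuous_eval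
  exact h1.comp (((measurable_toContinuousMap hc hm).comp measurable_snd).prodMk measurable_fst)

lemma measurable_circleDeriv {X : ℝ → Q → Q} (hc : ∀ x, Continuous fun t => X t x)
    (hm : ∀ t, Measurable (X t)) :
    Measurable fun z : ℝ × Q => circleDeriv (fun t => X t z.2) z.1 := by
  have h1 : ∀ z : ℝ × Q, circleDeriv (fun t => X t z.2) z.1 =
      (deriv (fun s => expQ (X s z.2)) z.1 / expQ (X z.1 z.2)).im / (2 * Real.pi) :=
    fun z => circleDeriv_eq_expQ (hc z.2).continuousAt
  simp_rw [h1]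
  have h2 : Measurable fun z : ℝ × Q => deriv (fun s => expQ (X s z.2)) z.1 :=
    measurable_deriv_of_continuous (f := fun s x => expQ (X s x))
      (fun x => continuous_expQ.comp (hc x)) fun t => continuous_expQ.measurable.comp (hm t)
  have h3 : Measurable fun z : ℝ × Q => expQ (X z.1 z.2) :=
    continuous_expQ.measurable.comp (measurable_uncurry_of_continuous_of_measurable hc hm)
  exact (Complex.measurable_im.comp (h2.div h3)).div_const _

/-- Every curve family agrees for almost every label with one which is continuous in time and
measurable in the label. -/
lemma IsCurveFamily.exists_regular {τ : ℝ} (hτ : 0 ≤ τ) {X : ℝ → Q → Q} (hX : IsCurveFamily τ X) :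
    ∃ X' : ℝ → Q → Q, (∀ x, Continuous fun t => X' t x) ∧ (∀ t, Measurable (X' t)) ∧
      ∀ᵐ x : Q, (∀ t ∈ Icc (-τ) τ, X' t x = X t x) ∧
        AbsolutelyContinuousOnInterval (fun t => X' t x) (-τ) τ := by
  have hle : -τ ≤ τ := by linarith
  let c : ℝ → ℝ := fun t => (projIcc (-τ) τ hle t : ℝ)
  have hcm : ∀ t, c t ∈ Icc (-τ) τ := fun t => (projIcc (-τ) τ hle t).2
  have hcc : Continuous c := continuous_subtype_val.comp continuous_projIcc
  have hcq : ∀ t ∈ Icc (-τ) τ, c t = t := fun t ht => by simp [c, projIcc_of_mem hle ht]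
  -- Countably many times suffice: off one null set the curve is absolutely continuous and agrees
  -- with measurable representatives at all (clamped) rational times. Setting the curves to 0 on a
  -- measurable null set and using continuity in time yields measurability at every time.
  have hae : ∀ᵐ x : Q, AbsolutelyContinuousOnInterval (fun t => X t x) (-τ) τ ∧
      ∀ q : ℚ, X (c q) x = (hX.aemeasurable (c q) (hcm q)).mk _ x :=
    hX.absolutelyContinuous.and (ae_all_iff.2 fun q => (hX.aemeasurable (c q) (hcm q)).ae_eq_mk)
  obtain ⟨N, hN, hNm, hN0⟩ := exists_measurable_superset_of_null hae
  obtain ⟨G, rfl⟩ : ∃ G, N = Gᶜ := ⟨Nᶜ, (compl_compl N).symm⟩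
  have hGm : MeasurableSet G := hNm.of_compl
  have hGsub := fun x hx => not_not.1 fun h => (hN (a := x) h) hx
  have hG0 : ∀ᵐ x : Q, x ∈ G := hN0
  classical
  let X' : ℝ → Q → Q := fun t x => if x ∈ G then X (c t) x else 0
  have hcont : ∀ x, Continuous fun t => X' t x := by
    intro x
    by_cases hx : x ∈ G
    · simp only [X', hx, if_true]
      have := (hGsub x hx).1.continuousOn
      rw [uIcc_of_le hle] at this
      exact this.comp_continuous hcc hcm
    · simp only [X', hx, if_false]; exact continuous_const
  have hmq : ∀ q : ℚ, Measurable (X' q) := by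
    intro q
    have : X' q = fun x => if x ∈ G then (hX.aemeasurable (c q) (hcm q)).mk _ x else 0 := by
      ext x
      by_cases hx : x ∈ G
      · simp only [X', hx, if_true]; exact (hGsub x hx).2 q
      · simp only [X', hx, if_false]
    rw [this]
    exact Measurable.ite hGm (hX.aemeasurable (c q) (hcm q)).measurable_mk measurable_const
  refine ⟨X', hcont, fun t => ?_, ?_⟩
  · obtain ⟨u, -, hu⟩ := Real.exists_seq_rat_strictAnti_tendsto t
    refine measurable_of_tendsto_metrizable (fun n => hmq (u n)) (tendsto_pi_nhds.2 fun x => ?_)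
    exact ((hcont x).tendsto t).comp hu.2
  · filter_upwards [hG0] with x hx
    have h1 : ∀ t ∈ Icc (-τ) τ, X' t x = X t x := fun t ht => by simp [X', hx, hcq t ht]
    refine ⟨h1, ?_⟩
    refine AbsolutelyContinuousOnInterval.of_dist_le (hGsub x hx).1 (C := 1) fun s hs t ht => ?_
    rw [uIcc_of_le hle] at hs ht
    rw [h1 s hs, h1 t ht, one_mul]
    exact le_add_of_nonneg_left dist_nonneg

/-! ### Counting atoms -/

/-- `∑_x σ({x})⁰` for atomic measures, and `∞` if `σ` has a diffuse part. -/
def atomSum (σ : Measure Q) : ℝ≥0∞ := ∫⁻ x, (σ {x})⁻¹ ∂σ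

lemma measurable_measure_singleton (σ : Measure Q) [SFinite σ] : Measurable fun x : Q => σ {x} := by
  have h : MeasurableSet {p : Q × Q | p.2 = p.1} :=
    measurableSet_eq_fun measurable_snd measurable_fst
  exact measurable_measure_prodMk_left h

lemma atomSum_map {α : Type*} [MeasurableSpace α] {P : Measure α} [IsFiniteMeasure P] {f : α → Q}
    (hf : AEMeasurable f P) : atomSum (P.map f) = ∫⁻ x, (P {x' | f x' = f x})⁻¹ ∂P := by
  unfold atomSum
  rw [lintegral_map' (f := fun x => (P.map f {x})⁻¹)
    (measurable_measure_singleton _).inv.aemeasurable hf]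
  refine lintegral_congr fun x => ?_
  rw [Measure.map_apply_of_aemeasurable hf (measurableSet_singleton _)]
  rfl

lemma volume_restrict_strip (A : Set ℝ) : (volume : Measure (ℝ × Q)).restrict (A ×ˢ univ) =
    (volume.restrict A).prod volume := by
  rw [Measure.volume_eq_prod, ← Measure.prod_restrict, Measure.restrict_univ]

lemma ae_strip_of_ae_snd {A : Set ℝ} {p : Q → Prop} (h : ∀ᵐ x, p x) :
    ∀ᵐ z : ℝ × Q ∂(volume.restrict A).prod volume, p z.2 :=
  Measure.quasiMeasurePreserving_snd.ae h

lemma ae_strip_of_mem {A : Set ℝ} (hA : MeasurableSet A) :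
    ∀ᵐ z : ℝ × Q ∂(volume.restrict A).prod volume, z.1 ∈ A :=
  Measure.quasiMeasurePreserving_fst.ae (ae_restrict_mem hA)

lemma measurable_multiplicity_comp {X : ℝ → Q → Q} (h : Measurable (Function.uncurry X)) :
    Measurable fun z : ℝ × Q => multiplicity X (X z.1 z.2) z.1 := by
  have h1 : Measurable fun p : (ℝ × Q) × Q => X p.1.1 p.2 :=
    h.comp ((measurable_fst.comp measurable_fst).prodMk measurable_snd)
  have h2 : Measurable fun p : (ℝ × Q) × Q => X p.1.1 p.1.2 :=
    h.comp measurable_fst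
  exact measurable_measure_prodMk_left (measurableSet_eq_fun h1 h2)

/-- The kinetic energy of a family of curves. -/
def kinetic (τ : ℝ) (X : ℝ → Q → Q) : ℝ≥0∞ :=
  ∫⁻ x : Q, ∫⁻ t in Ioo (-τ) τ, ‖circleDeriv (fun s => X s x) t‖ₑ ^ 2

lemma circleDeriv_congr {γ γ' : ℝ → Q} {t : ℝ} (h : γ =ᶠ[𝓝 t] γ') :
    circleDeriv γ t = circleDeriv γ' t := by
  rw [circleDeriv_eq, circleDeriv_eq, h.self_of_nhds]
  refine Filter.EventuallyEq.deriv_eq ?_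
  filter_upwards [h] with s hs
  rw [hs]

lemma circleDeriv_congr_Ioo {γ γ' : ℝ → Q} {a b t : ℝ} (h : ∀ s ∈ Icc a b, γ s = γ' s)
    (ht : t ∈ Ioo a b) : circleDeriv γ t = circleDeriv γ' t :=
  circleDeriv_congr (by
    filter_upwards [Ioo_mem_nhds ht.1 ht.2] with s hs using h s (Ioo_subset_Icc_self hs))

/-- The curve family need not be jointly measurable. The integrals are moved to the regular
modification, which changes neither the multiplicities nor the velocities almost everywhere, and
Tonelli's theorem is applied there. The multiplicity at `X t x` is the mass that the law gives to
this point. -/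
lemma IsCurveFamily.lagrangian_eq {lam T : ℝ} (hT : 0 < T) (hlam : 0 < lam) {X : ℝ → Q → Q}
    (hX : IsCurveFamily (extendedTime lam T) X) :
    lagrangian lam T X = (∫⁻ t in Ioo (-T) T, atomSum (volume.map (X t))) +
      kinetic (extendedTime lam T) X := by
  have hl : 0 < lam⁻¹ := inv_pos.2 hlam
  have hτ : T ≤ extendedTime lam T := by unfold extendedTime; linarith
  have hτ0 : 0 ≤ extendedTime lam T := by linarith
  obtain ⟨X', hc, hm, hae⟩ := hX.exists_regular hτ0
  have hu := measurable_uncurry_of_continuous_of_measurable hc hm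
  have hmult : ∀ t ∈ Icc (-extendedTime lam T) (extendedTime lam T), ∀ y,
      multiplicity X y t = multiplicity X' y t := by
    intro t ht y
    refine measure_congr ?_
    filter_upwards [hae] with x hx
    exact propext (by
      show X t x = y ↔ X' t x = y
      rw [hx.1 t ht])
  unfold lagrangian
  rw [volume_restrict_strip, volume_restrict_strip]
  congr 1
  · rw [lintegral_congr_ae (g := fun z => (multiplicity X' (X' z.1 z.2) z.1)⁻¹),
      lintegral_prod (fun z : ℝ × Q => (multiplicity X' (X' z.1 z.2) z.1)⁻¹)
        (measurable_multiplicity_comp hu).inv.aemeasurable]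
    · refine setLIntegral_congr_fun measurableSet_Ioo fun t ht => ?_
      have ht' : t ∈ Icc (-extendedTime lam T) (extendedTime lam T) :=
        ⟨by linarith [ht.1], by linarith [ht.2]⟩
      dsimp only
      rw [atomSum_map (hX.aemeasurable t ht')]
      refine lintegral_congr_ae ?_
      filter_upwards [hae] with x hx
      rw [hx.1 t ht', ← hmult t ht']
      rfl
    · filter_upwards [ae_strip_of_ae_snd hae, ae_strip_of_mem measurableSet_Ioo] with z hz hz'
      have ht' : z.1 ∈ Icc (-extendedTime lam T) (extendedTime lam T) :=
        ⟨by linarith [hz'.1], by linarith [hz'.2]⟩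
      rw [hmult _ ht', hz.1 _ ht']
  · unfold kinetic
    rw [lintegral_congr_ae (g := fun z => ‖circleDeriv (fun t => X' t z.2) z.1‖ₑ ^ 2),
      lintegral_prod_symm _ ((measurable_circleDeriv hc hm).enorm.pow_const 2).aemeasurable]
    · refine lintegral_congr_ae ?_
      filter_upwards [hae] with x hx
      refine setLIntegral_congr_fun measurableSet_Ioo fun t ht => ?_
      rw [circleDeriv_congr_Ioo hx.1 ht]
    · filter_upwards [ae_strip_of_ae_snd hae, ae_strip_of_mem measurableSet_Ioo] with z hz hz'
      rw [circleDeriv_congr_Ioo hz.1 hz']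

lemma countable_atoms (σ : Measure Q) [IsFiniteMeasure σ] : {x : Q | σ {x} ≠ 0}.Countable := by
  have := Measure.countable_meas_pos_of_disjoint_iUnion (μ := σ) (As := fun x : Q => {x})
    (fun x => measurableSet_singleton x) (fun x y hxy => by simpa [Function.onFun] using hxy)
  simpa [pos_iff_ne_zero] using this

/-- Each atom contributes its mass times the inverse of its mass, that is 1. -/
lemma atomSum_eq_numAtoms {σ : Measure Q} [IsFiniteMeasure σ]
    (h : σ {x : Q | σ {x} ≠ 0}ᶜ = 0) : atomSum σ = numAtoms σ := by
  have hA := countable_atoms σ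
  unfold atomSum numAtoms
  set A := {x : Q | σ {x} ≠ 0} with hAdef
  rw [← setLIntegral_univ, ← union_compl_self A,
    lintegral_union hA.measurableSet.compl disjoint_compl_right,
    setLIntegral_measure_zero _ _ h, add_zero, lintegral_countable _ hA, ← ENNReal.tsum_set_one]
  refine tsum_congr fun x => ?_
  exact ENNReal.inv_mul_cancel x.2 (measure_ne_top σ _)

/-- At a point that is not an atom the integrand is ∞, so finiteness leaves no room for a diffuse
part. -/
lemma atoms_compl_null_of_atomSum_ne_top {σ : Measure Q} [IsFiniteMeasure σ]
    (h : atomSum σ ≠ ⊤) : σ {x : Q | σ {x} ≠ 0}ᶜ = 0 := by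
  have h1 := ae_lt_top (μ := σ) (measurable_measure_singleton σ).inv h
  rw [ae_iff] at h1
  refine measure_mono_null ?_ h1
  intro x hx
  simpa using hx

lemma IsAtomic.atoms_compl_null {σ : Measure Q} [IsFiniteMeasure σ] (h : IsAtomic σ) :
    σ {x : Q | σ {x} ≠ 0}ᶜ = 0 := by
  have hm := (countable_atoms σ).measurableSet.compl
  obtain ⟨φ, X, hσ⟩ := h
  have h1 : ∀ i, φ i ≤ σ {X i} := by
    intro i
    conv_rhs => rw [hσ]
    rw [Measure.sum_apply _ (measurableSet_singleton _)]
    refine le_trans ?_ (ENNReal.le_tsum i)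
    simp
  have h2 : Measure.sum (fun i => φ i • Measure.dirac (X i)) {x : Q | σ {x} ≠ 0}ᶜ = 0 := by
    rw [Measure.sum_apply _ hm, ENNReal.tsum_eq_zero]
    intro i
    rw [Measure.smul_apply, Measure.dirac_apply' _ hm]
    by_cases hi : X i ∈ {x : Q | σ {x} ≠ 0}ᶜ
    · have h3 : σ {X i} = 0 := by simpa using hi
      have : φ i = 0 := le_antisymm (h3 ▸ h1 i) zero_le
      simp [this]
    · simp [hi]
  rwa [← hσ] at h2

lemma isAtomic_of_atoms_compl_null {σ : Measure Q} [IsFiniteMeasure σ]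
    (h : σ {x : Q | σ {x} ≠ 0}ᶜ = 0) : IsAtomic σ := by
  have hA := countable_atoms σ
  set A := {x : Q | σ {x} ≠ 0} with hAdef
  have : Countable A := hA.to_subtype
  obtain ⟨e, he⟩ := exists_injective_nat A
  refine ⟨Function.extend e (fun a => σ {(a : Q)}) 0, Function.extend e (fun a => (a : Q)) 0, ?_⟩
  ext s hs
  rw [Measure.sum_apply _ hs]
  have h1 : ∀ n, (Function.extend e (fun a : A => σ {(a : Q)}) 0 n •
      Measure.dirac (Function.extend e (fun a : A => (a : Q)) 0 n) : Measure Q) s =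
      Function.extend e (fun a : A => σ {(a : Q)} * s.indicator 1 (a : Q)) 0 n := by
    intro n
    rw [Measure.smul_apply, Measure.dirac_apply' _ hs, smul_eq_mul]
    by_cases hn : ∃ a, e a = n
    · obtain ⟨a, rfl⟩ := hn
      simp only [he.extend_apply]
    · simp [Function.extend_apply' _ _ _ hn]
  simp_rw [h1]
  rw [tsum_extend_zero he]
  have h2 : σ s = ∫⁻ x in A, s.indicator 1 x ∂σ := by
    rw [← lintegral_indicator_one hs, ← setLIntegral_univ, ← union_compl_self A,
      lintegral_union hA.measurableSet.compl disjoint_compl_right,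
      setLIntegral_measure_zero _ _ h, add_zero]
  rw [h2, lintegral_countable _ hA]
  exact tsum_congr fun x => mul_comm _ _

/-- A finite support consists of atoms, because its points are isolated in it. If the support is
infinite and the sum were finite, the measure would live on finitely many atoms; these form a closed
set, which would contain the support. The support, unlike the set of atoms, is suited to weak
limits. -/
lemma atomSum_eq_encard_support (σ : Measure Q) [IsFiniteMeasure σ] :
    atomSum σ = ((σ.support.encard : ℕ∞) : ℝ≥0∞) := by
  have hsub : {x : Q | σ {x} ≠ 0} ⊆ σ.support := by
    intro x hx
    rw [Measure.mem_support_iff_forall]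
    intro U hU
    exact (pos_iff_ne_zero.2 hx).trans_le (measure_mono (singleton_subset_iff.2 (mem_of_mem_nhds hU)))
  by_cases hfin : σ.support.Finite
  · have hsup : σ.support ⊆ {x : Q | σ {x} ≠ 0} := by
      intro x hx h0
      have hU : (σ.support \ {x})ᶜ ∈ 𝓝 x :=
        (hfin.subset sdiff_subset).isClosed.isOpen_compl.mem_nhds (by simp)
      have := (Measure.mem_support_iff_forall x).1 hx _ hU
      refine this.ne' (measure_mono_null (t := {x} ∪ σ.supportᶜ) ?_
        (measure_union_null h0 Measure.measure_compl_support))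
      intro y hy
      by_cases hxy : y = x
      · left; exact hxy
      · right; intro hy'; exact hy ⟨hy', hxy⟩
    have heq := hsub.antisymm hsup
    rw [atomSum_eq_numAtoms (by rw [heq]; exact Measure.measure_compl_support), numAtoms, heq]
  · have h1 : σ.support.encard = ⊤ := encard_eq_top_iff.2 hfin
    rw [h1, ENat.toENNReal_top]
    by_contra htop
    have h2 := atoms_compl_null_of_atomSum_ne_top htop
    have h3 := atomSum_eq_numAtoms h2
    have h4 : {x : Q | σ {x} ≠ 0}.Finite := by
      by_contra h5
      exact htop (by rw [h3, numAtoms, encard_eq_top_iff.2 h5, ENat.toENNReal_top])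
    exact hfin (h4.subset (Measure.support_subset_of_isClosed h4.isClosed (mem_ae_iff.2 h2)))

/-! ### Weak convergence and lower semicontinuity -/

/-- Weak convergence of finite measures on the torus. -/
def WeakTendsto {ι : Type*} (l : Filter ι) (σ' : ι → Measure Q) (σ : Measure Q) : Prop :=
  ∀ ξ : C(Q, ℝ), Tendsto (fun j => ∫ x, ξ x ∂(σ' j)) l (𝓝 (∫ x, ξ x ∂σ))

/-- Test with a Urysohn function that vanishes off U and equals 1 at a point of the support of the
limit inside U. -/
lemma WeakTendsto.eventually_pos {ι : Type*} {l : Filter ι} {σ' : ι → Measure Q} {σ : Measure Q}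
    [IsFiniteMeasure σ] (h : WeakTendsto l σ' σ) {U : Set Q} (hU : IsOpen U) (hpos : 0 < σ U) :
    ∀ᶠ j in l, 0 < σ' j U := by
  obtain ⟨x, hxU, hxs⟩ := Measure.nonempty_inter_support_of_pos hpos
  obtain ⟨f, hf0, hf1, hf01⟩ := exists_continuous_zero_one_of_isClosed hU.isClosed_compl
    (isClosed_singleton (x := x)) (by simpa using hxU)
  have hfpos : 0 < ∫ y, f y ∂σ := by
    refine (integral_pos_iff_support_of_nonneg (fun y => (hf01 y).1) ?_).2 ?_
    · exact f.continuous.integrable_of_hasCompactSupport (HasCompactSupport.of_compactSpace _)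
    · refine (Measure.mem_support_iff_forall x).1 hxs _ ?_
      have h1 : f x = 1 := hf1 rfl
      exact f.continuous.continuousAt.preimage_mem_nhds (by
        rw [h1]; exact isOpen_ne.mem_nhds one_ne_zero)
  filter_upwards [(h f).eventually (lt_mem_nhds hfpos)] with j hj
  by_contra h0
  have h0' : σ' j U = 0 := by simpa using h0
  refine hj.ne' (integral_eq_zero_of_ae ?_)
  rw [Filter.EventuallyEq, ae_iff]
  refine measure_mono_null (fun y hy => ?_) h0'
  by_contra hyU
  exact hy (hf0 hyU)

/-- Separate n support points of the limit by disjoint open sets. Each set eventually has positive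
mass, hence contains a support point of the approximating measure, and these points are distinct. -/
lemma WeakTendsto.atomSum_le_liminf {σ' : ℕ → Measure Q} {σ : Measure Q}
    [IsFiniteMeasure σ] [∀ j, IsFiniteMeasure (σ' j)] (h : WeakTendsto atTop σ' σ) :
    atomSum σ ≤ liminf (fun j => atomSum (σ' j)) atTop := by
  simp_rw [atomSum_eq_encard_support]
  have key : ∀ n : ℕ, (n : ℕ∞) ≤ σ.support.encard →
      (n : ℝ≥0∞) ≤ liminf (fun j => (((σ' j).support.encard : ℕ∞) : ℝ≥0∞)) atTop := by
    intro n hn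
    obtain ⟨F, hF, hFn⟩ := exists_subset_encard_eq hn
    have hFfin : F.Finite := finite_of_encard_eq_coe hFn
    obtain ⟨U, hU, hdisj⟩ := hFfin.t2_separation
    have hev : ∀ᶠ j in atTop, ∀ x ∈ F, 0 < σ' j (U x) := by
      rw [eventually_all_finite hFfin]
      intro x hx
      exact h.eventually_pos (hU x).2
        ((Measure.mem_support_iff_forall x).1 (hF hx) _ ((hU x).2.mem_nhds (hU x).1))
    refine le_liminf_of_le (by isBoundedDefault) ?_
    filter_upwards [hev] with j hj
    have hch : ∀ x : Q, ∃ y, x ∈ F → y ∈ U x ∩ (σ' j).support := by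
      intro x
      by_cases hx : x ∈ F
      · obtain ⟨y, hy⟩ := Measure.nonempty_inter_support_of_pos (hj x hx)
        exact ⟨y, fun _ => hy⟩
      · exact ⟨0, fun h => absurd h hx⟩
    choose g hg using hch
    have hinj : InjOn g F := by
      intro x hx y hy hxy
      by_contra hne
      have := hdisj hx hy hne
      exact (disjoint_left.1 this) (hg x hx).1 (hxy ▸ (hg y hy).1)
    have h1 : F.encard ≤ (σ' j).support.encard := by
      rw [← hinj.encard_image]
      exact encard_le_encard (image_subset_iff.2 fun x hx => (hg x hx).2)
    rw [hFn] at h1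
    exact_mod_cast (ENat.toENNReal_le.2 h1)
  cases hc : σ.support.encard using ENat.recTopCoe with
  | top =>
    rw [ENat.toENNReal_top]
    refine ENNReal.eq_top_of_forall_nnreal_le (fun r => ?_) |>.ge
    obtain ⟨n, hn⟩ := exists_nat_ge r
    refine le_trans ?_ (key n (by rw [hc]; exact le_top))
    exact_mod_cast hn
  | coe n =>
    have := key n hc.ge
    simpa using this

/-! ### Slices -/

lemma measure_eq_of_circleRep_Iic {σ σ' : Measure Q} [IsFiniteMeasure σ]
    (huniv : σ univ = σ' univ)
    (h : ∀ q : ℚ, σ (circleRep ⁻¹' Iic (q : ℝ)) = σ' (circleRep ⁻¹' Iic (q : ℝ))) : σ = σ' := by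
  have h1 : σ.map circleRep = σ'.map circleRep := by
    have : IsFiniteMeasure (σ.map circleRep) := inferInstance
    refine ext_of_generate_finite _ Real.borel_eq_generateFrom_Iic_rat Real.isPiSystem_Iic_rat ?_ ?_
    · intro s hs
      simp only [mem_iUnion, mem_singleton_iff] at hs
      obtain ⟨q, rfl⟩ := hs
      rw [Measure.map_apply measurable_circleRep measurableSet_Iic,
        Measure.map_apply measurable_circleRep measurableSet_Iic]
      exact h q
    · rw [Measure.map_apply measurable_circleRep MeasurableSet.univ,
        Measure.map_apply measurable_circleRep MeasurableSet.univ]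
      exact huniv
  have h2 : ∀ σ : Measure Q, (σ.map circleRep).map (fun x : ℝ => (x : Q)) = σ := by
    intro σ
    rw [Measure.map_map measurable_coeQ measurable_circleRep]
    convert Measure.map_id
    ext x
    simp
  rw [← h2 σ, h1, h2]

lemma HasSlices.aemeasurable_apply {T : ℝ} {μ : Measure (ℝ × Q)} {ν : ℝ → Measure Q}
    (h : HasSlices T μ ν) {A : Set Q} (hA : MeasurableSet A) :
    AEMeasurable (fun t => ν t A) (volume.restrict (Ioo (-T) T)) :=
  (Measure.measurable_coe hA).comp_aemeasurable h.aemeasurable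

lemma HasSlices.setLIntegral_eq {T : ℝ} {μ : Measure (ℝ × Q)} {ν : ℝ → Measure Q}
    (h : HasSlices T μ ν) {A : Set Q} (hA : MeasurableSet A) {B : Set ℝ} (hB : MeasurableSet B) :
    ∫⁻ t in B, ν t A ∂volume.restrict (Ioo (-T) T) = μ (B ×ˢ A) := by
  rw [h.apply_eq _ (hB.prod hA), ← lintegral_indicator hB]
  refine lintegral_congr fun t => ?_
  by_cases ht : t ∈ B
  · simp [ht]
  · simp [ht]

/-- Two families of slices agree almost everywhere on each fixed set. Countably many sets, the arcs
cut off at rational coordinates, determine a finite measure, so one null set of times serves for all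
of them. -/
lemma HasSlices.ae_eq {T : ℝ} {μ : Measure (ℝ × Q)} [IsFiniteMeasure μ] {ν ν' : ℝ → Measure Q}
    (h : HasSlices T μ ν) (h' : HasSlices T μ ν') :
    ∀ᵐ t ∂volume.restrict (Ioo (-T) T), ν t = ν' t := by
  have key : ∀ A : Set Q, MeasurableSet A →
      ∀ᵐ t ∂volume.restrict (Ioo (-T) T), ν t A = ν' t A := by
    intro A hA
    refine ae_eq_of_forall_setLIntegral_eq_of_sigmaFinite₀ (h.aemeasurable_apply hA)
      (h'.aemeasurable_apply hA) fun B hB _ => ?_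
    rw [h.setLIntegral_eq hA hB, h'.setLIntegral_eq hA hB]
  have hfin : ∀ᵐ t ∂volume.restrict (Ioo (-T) T), ν t univ < ⊤ := by
    refine ae_lt_top' (h.aemeasurable_apply MeasurableSet.univ) ?_
    have := h.setLIntegral_eq MeasurableSet.univ MeasurableSet.univ
    rw [Measure.restrict_univ] at this
    rw [this]
    exact measure_ne_top _ _
  have h1 := ae_all_iff.2 fun q : ℚ =>
    key (circleRep ⁻¹' Iic (q : ℝ)) (measurable_circleRep measurableSet_Iic)
  filter_upwards [key univ MeasurableSet.univ, h1, hfin] with t h1 h2 h3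
  have : IsFiniteMeasure (ν t) := ⟨h3⟩
  exact measure_eq_of_circleRep_Iic h1 h2

lemma HasSlices.slice {T : ℝ} {μ : Measure (ℝ × Q)} {ν : ℝ → Measure Q}
    (h : HasSlices T μ ν) : HasSlices T μ (slice T μ) := by
  have hex : ∃ ν, HasSlices T μ ν := ⟨ν, h⟩
  unfold BranchedTransport.slice
  rw [dif_pos hex]
  exact hex.choose_spec

lemma HasSlices.congr {T : ℝ} {μ : Measure (ℝ × Q)} {ν ν' : ℝ → Measure Q}
    (h : HasSlices T μ ν) (h' : ∀ᵐ t ∂volume.restrict (Ioo (-T) T), ν t = ν' t) :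
    HasSlices T μ ν' where
  aemeasurable := h.aemeasurable.congr h'
  apply_eq A hA := by
    rw [h.apply_eq A hA]
    refine lintegral_congr_ae ?_
    filter_upwards [h'] with t ht
    rw [ht]

lemma HasSlices.measure_eq {T : ℝ} {μ μ' : Measure (ℝ × Q)} {ν ν' : ℝ → Measure Q}
    (h : HasSlices T μ ν) (h1 : HasSlices T μ' ν')
    (h' : ∀ᵐ t ∂volume.restrict (Ioo (-T) T), ν t = ν' t) : μ = μ' := by
  ext A hA
  rw [(h.congr h').apply_eq A hA, h1.apply_eq A hA]

lemma HasSlices.ae_eq_slice {T : ℝ} {μ : Measure (ℝ × Q)} [IsFiniteMeasure μ] {ν : ℝ → Measure Q}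
    (h : HasSlices T μ ν) : ∀ᵐ t ∂volume.restrict (Ioo (-T) T), BranchedTransport.slice T μ t = ν t :=
  h.slice.ae_eq h

/-! ### Test functions -/

namespace IsTestFunction

variable {T : ℝ} {ζ : ℝ × Q → ℝ}

/-- The lift of a function on `ℝ × Q` to `ℝ × ℝ`. -/
def lift (ζ : ℝ × Q → ℝ) (p : ℝ × ℝ) : ℝ := ζ (p.1, (p.2 : Q))

lemma hasFDerivAt_lift (h : IsTestFunction T ζ) (p : ℝ × ℝ) :
    HasFDerivAt (lift ζ) (fderiv ℝ (lift ζ) p) p :=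
  (h.smooth.differentiable (by simp)).differentiableAt.hasFDerivAt

lemma dt_eq (h : IsTestFunction T ζ) (t x : ℝ) :
    dt ζ (t, (x : Q)) = fderiv ℝ (lift ζ) (t, x) (1, 0) := by
  have h1 := h.hasFDerivAt_lift (t, x)
  have h2 : HasDerivAt (fun s : ℝ => (s, x)) ((1 : ℝ), (0 : ℝ)) t :=
    (hasDerivAt_id t).prodMk (hasDerivAt_const t x)
  exact (h1.comp_hasDerivAt t h2).deriv

lemma dx_eq (h : IsTestFunction T ζ) (t x : ℝ) :
    dx ζ (t, (x : Q)) = fderiv ℝ (lift ζ) (t, x) (0, 1) := by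
  have h2 : HasDerivAt (fun s : ℝ => (t, x + s)) ((0 : ℝ), (1 : ℝ)) 0 :=
    (hasDerivAt_const (0 : ℝ) t).prodMk ((hasDerivAt_id (0 : ℝ)).const_add x)
  have h1 : HasFDerivAt (lift ζ) (fderiv ℝ (lift ζ) (t, x)) ((fun s : ℝ => (t, x + s)) 0) := by
    simpa using h.hasFDerivAt_lift (t, x)
  have h3 := (h1.comp_hasDerivAt (0 : ℝ) h2).deriv
  unfold dx
  rw [← h3]
  rfl

lemma fderiv_apply (h : IsTestFunction T ζ) (t x a b : ℝ) :
    fderiv ℝ (lift ζ) (t, x) (a, b) = a * dt ζ (t, (x : Q)) + b * dx ζ (t, (x : Q)) := by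
  rw [h.dt_eq, h.dx_eq]
  have : ((a, b) : ℝ × ℝ) = a • ((1 : ℝ), (0 : ℝ)) + b • ((0 : ℝ), (1 : ℝ)) := by simp
  rw [this, map_add, map_smul, map_smul, smul_eq_mul, smul_eq_mul]

lemma isOpenQuotientMap_coe :
    IsOpenQuotientMap (Prod.map id (fun x : ℝ => (x : Q)) : ℝ × ℝ → ℝ × Q) :=
  IsOpenQuotientMap.id.prodMap QuotientAddGroup.isOpenQuotientMap_mk

lemma continuous_dt (h : IsTestFunction T ζ) : Continuous (dt ζ) := by
  refine isOpenQuotientMap_coe.isQuotientMap.continuous_iff.2 ?_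
  have : dt ζ ∘ (Prod.map id (fun x : ℝ => (x : Q))) =
      fun p : ℝ × ℝ => fderiv ℝ (lift ζ) p (1, 0) := by
    ext p; exact h.dt_eq p.1 p.2
  rw [this]
  exact (h.smooth.continuous_fderiv (by simp)).clm_apply continuous_const

lemma continuous_dx (h : IsTestFunction T ζ) : Continuous (dx ζ) := by
  refine isOpenQuotientMap_coe.isQuotientMap.continuous_iff.2 ?_
  have : dx ζ ∘ (Prod.map id (fun x : ℝ => (x : Q))) =
      fun p : ℝ × ℝ => fderiv ℝ (lift ζ) p (0, 1) := by
    ext p; exact h.dx_eq p.1 p.2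
  rw [this]
  exact (h.smooth.continuous_fderiv (by simp)).clm_apply continuous_const

lemma fderiv_eq_zero (t x : ℝ) (hz : (t, (x : Q)) ∉ tsupport ζ) :
    fderiv ℝ (lift ζ) (t, x) = 0 := by
  have h1 : ∀ᶠ p in 𝓝 (t, x), lift ζ p = 0 := by
    have hc : ContinuousAt (Prod.map id (fun x : ℝ => (x : Q)) : ℝ × ℝ → ℝ × Q) (t, x) :=
      isOpenQuotientMap_coe.continuous.continuousAt
    have := hc.eventually (notMem_tsupport_iff_eventuallyEq.1 hz)
    exact this
  have h2 : lift ζ =ᶠ[𝓝 (t, x)] fun _ => (0 : ℝ) := h1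
  rw [h2.fderiv_eq]; simp

lemma hasCompactSupport_dt (h : IsTestFunction T ζ) : HasCompactSupport (dt ζ) := by
  refine h.hasCompactSupport.mono' fun z hz => ?_
  by_contra hz'
  obtain ⟨t, q⟩ := z
  obtain ⟨x, rfl⟩ := QuotientAddGroup.mk_surjective q
  refine hz ?_
  have := h.dt_eq t x
  rw [fderiv_eq_zero t x hz'] at this
  exact this

lemma hasCompactSupport_dx (h : IsTestFunction T ζ) : HasCompactSupport (dx ζ) := by
  refine h.hasCompactSupport.mono' fun z hz => ?_
  by_contra hz'
  obtain ⟨t, q⟩ := z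
  obtain ⟨x, rfl⟩ := QuotientAddGroup.mk_surjective q
  refine hz ?_
  have := h.dx_eq t x
  rw [fderiv_eq_zero t x hz'] at this
  exact this

lemma exists_bound (h : IsTestFunction T ζ) : ∃ C : ℝ, 0 ≤ C ∧ ∀ z, |dt ζ z| ≤ C ∧ |dx ζ z| ≤ C := by
  obtain ⟨C1, h1⟩ := h.continuous_dt.bounded_above_of_compact_support h.hasCompactSupport_dt
  obtain ⟨C2, h2⟩ := h.continuous_dx.bounded_above_of_compact_support h.hasCompactSupport_dx
  refine ⟨max (max C1 C2) 0, le_max_right _ _, fun z => ⟨?_, ?_⟩⟩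
  · exact (h1 z).trans ((le_max_left _ _).trans (le_max_left _ _))
  · exact (h2 z).trans ((le_max_right _ _).trans (le_max_left _ _))

lemma exists_lipschitz (h : IsTestFunction T ζ) : ∃ C : ℝ, ∀ s t (p q : Q),
    |ζ (s, p) - ζ (t, q)| ≤ C * (dist s t + dist p q) := by
  obtain ⟨C, hC0, hC⟩ := h.exists_bound
  refine ⟨2 * C, fun s t p q => ?_⟩
  obtain ⟨x, rfl⟩ := QuotientAddGroup.mk_surjective q
  -- The lift of `p` is the one nearest to the chosen lift of `q`; the distance of the lifts is then
  -- the distance on the torus, and the mean value inequality in the plane applies.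
  have hp : p = ((x + circleRep (p - (x : Q)) : ℝ) : Q) := by
    rw [AddCircle.coe_add, coe_circleRep]; simp
  set r := circleRep (p - (x : Q)) with hr
  have hd : dist p (x : Q) = |r| := by rw [dist_eq_norm, norm_eq_abs_circleRep]
  have h1 : ‖lift ζ (s, x + r) - lift ζ (t, x)‖ ≤ (2 * C) * ‖(s, x + r) - (t, x)‖ := by
    refine convex_univ.norm_image_sub_le_of_norm_fderiv_le (𝕜 := ℝ)
      (fun p _ => (h.smooth.differentiable (by simp)).differentiableAt) (fun p _ => ?_)
      (mem_univ _) (mem_univ _)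
    refine ContinuousLinearMap.opNorm_le_bound _ (by positivity) fun v => ?_
    obtain ⟨a, b⟩ := v
    obtain ⟨u, y⟩ := p
    have h2 := h.fderiv_apply u y a b
    have h3 := hC (u, (y : Q))
    show ‖fderiv ℝ (lift ζ) (u, y) (a, b)‖ ≤ _
    rw [h2]
    have ha : |a| ≤ ‖(a, b)‖ := norm_fst_le (a, b)
    have hb : |b| ≤ ‖(a, b)‖ := norm_snd_le (a, b)
    calc ‖a * dt ζ (u, (y : Q)) + b * dx ζ (u, (y : Q))‖
        ≤ |a| * |dt ζ (u, (y : Q))| + |b| * |dx ζ (u, (y : Q))| := by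
          rw [Real.norm_eq_abs, ← abs_mul, ← abs_mul]; exact abs_add_le _ _
      _ ≤ ‖(a, b)‖ * C + ‖(a, b)‖ * C := by
          gcongr
          exacts [h3.1, h3.2]
      _ = 2 * C * ‖(a, b)‖ := by ring
  rw [hd]
  have h2 : ‖(s, x + r) - (t, x)‖ ≤ dist s t + |r| := by
    rw [Prod.mk_sub_mk, Prod.norm_mk, Real.dist_eq]
    simp only [add_sub_cancel_left, Real.norm_eq_abs]
    exact max_le (le_add_of_nonneg_right (abs_nonneg _)) (le_add_of_nonneg_left (abs_nonneg _))
  have h3 : ζ (s, p) - ζ (t, (x : Q)) = lift ζ (s, x + r) - lift ζ (t, x) := by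
    unfold lift
    rw [hp]
  have h4 := h1.trans (mul_le_mul_of_nonneg_left h2 (by positivity))
  rw [← h3] at h4
  exact h4

lemma hasDerivAt_comp (h : IsTestFunction T ζ) {γ : ℝ → Q} {t c : ℝ}
    (hγ : HasDerivAt (fun s => circleRep (γ s - γ t)) c t) :
    HasDerivAt (fun s => ζ (s, γ s)) (dt ζ (t, γ t) + c * dx ζ (t, γ t)) t := by
  obtain ⟨x, hx⟩ := QuotientAddGroup.mk_surjective (γ t)
  have hx' : (x : Q) = γ t := hx
  have h1 : (fun s => ζ (s, γ s)) = fun s => lift ζ (s, x + circleRep (γ s - γ t)) := by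
    ext s
    unfold lift
    rw [AddCircle.coe_add, coe_circleRep, hx']; simp
  have h2 : HasDerivAt (fun s => (s, x + circleRep (γ s - γ t))) ((1 : ℝ), c) t :=
    (hasDerivAt_id t).prodMk (hγ.const_add x)
  have h3 : HasFDerivAt (lift ζ) (fderiv ℝ (lift ζ) (t, x))
      ((fun s => (s, x + circleRep (γ s - γ t))) t) := by
    simpa using h.hasFDerivAt_lift (t, x)
  rw [h1]
  have h4 := h3.comp_hasDerivAt t h2
  rw [h.fderiv_apply, one_mul, hx'] at h4
  exact h4

lemma absolutelyContinuous_comp (h : IsTestFunction T ζ) {γ : ℝ → Q} {a b : ℝ}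
    (hγ : AbsolutelyContinuousOnInterval γ a b) :
    AbsolutelyContinuousOnInterval (fun s => ζ (s, γ s)) a b := by
  obtain ⟨C, hC⟩ := h.exists_lipschitz
  exact AbsolutelyContinuousOnInterval.of_dist_le hγ fun s _ t _ => hC s t (γ s) (γ t)

lemma eq_zero_of_notMem (h : IsTestFunction T ζ) {t : ℝ} (ht : t ∉ Ioo (-T) T) (q : Q) :
    ζ (t, q) = 0 := by
  by_contra hne
  exact ht (h.tsupport_subset (subset_tsupport _ hne)).1

/-- The continuity equation along a single curve. -/
lemma integral_along_curve (h : IsTestFunction T ζ) (hT : 0 ≤ T) {γ : ℝ → Q}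
    (hγ : AbsolutelyContinuousOnInterval γ (-T) T) :
    ∫ t in Ioo (-T) T, (dt ζ (t, γ t) + circleDeriv γ t * dx ζ (t, γ t)) = 0 := by
  have h1 := (h.absolutelyContinuous_comp hγ).integral_deriv_eq_sub
  rw [h.eq_zero_of_notMem (by simp), h.eq_zero_of_notMem (by simp), sub_zero,
    intervalIntegral.integral_of_le (by linarith), integral_Ioc_eq_integral_Ioo] at h1
  rw [← h1]
  refine integral_congr_ae ?_
  filter_upwards [ae_hasDerivAt_circleRep (by linarith) hγ] with t ht
  exact (h.hasDerivAt_comp ht).deriv.symm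

end IsTestFunction

/-! ### Kinetic energy, displacement and averaged velocities -/

lemma sq_lintegral_le {α : Type*} [MeasurableSpace α] {μ : Measure α} {f : α → ℝ≥0∞}
    (hf : AEMeasurable f μ) : (∫⁻ x, f x ∂μ) ^ 2 ≤ μ univ * ∫⁻ x, f x ^ 2 ∂μ := by
  have h := ENNReal.lintegral_mul_le_Lp_mul_Lq μ (p := 2) (q := 2)
    (by constructor <;> norm_num) hf (aemeasurable_const (b := (1 : ℝ≥0∞)))
  simp only [Pi.mul_apply, mul_one, lintegral_const, ENNReal.rpow_ofNat, one_pow, one_mul] at h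
  calc (∫⁻ x, f x ∂μ) ^ 2 ≤ ((∫⁻ x, f x ^ 2 ∂μ) ^ (1 / 2 : ℝ) * μ univ ^ (1 / 2 : ℝ)) ^ 2 := by
        gcongr
    _ = μ univ * ∫⁻ x, f x ^ 2 ∂μ := by
        rw [mul_pow, ← ENNReal.rpow_natCast, ← ENNReal.rpow_mul, ← ENNReal.rpow_natCast,
          ← ENNReal.rpow_mul]
        norm_num
        rw [mul_comm]

/-- The displacement of a curve is bounded by its kinetic energy. -/
lemma enorm_sub_sq_le {γ : ℝ → Q} {a b : ℝ} (hab : a ≤ b)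
    (h : AbsolutelyContinuousOnInterval γ a b) :
    ‖γ b - γ a‖ₑ ^ 2 ≤ ENNReal.ofReal (b - a) * ∫⁻ t in Ioo a b, ‖circleDeriv γ t‖ₑ ^ 2 := by
  -- The distance from the starting point is a real absolutely continuous function, and by the
  -- reverse triangle inequality its derivative is bounded by the speed. This makes a lift of the
  -- curve unnecessary.
  set g : ℝ → ℝ := fun t => ‖γ t - γ a‖ with hg
  have hgac : AbsolutelyContinuousOnInterval g a b := by
    refine AbsolutelyContinuousOnInterval.of_dist_le h (C := 1) fun s _ t _ => ?_
    rw [one_mul, Real.dist_eq]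
    refine (abs_norm_sub_norm_le _ _).trans ?_
    rw [sub_sub_sub_cancel_right, ← dist_eq_norm]
    exact le_add_of_nonneg_left dist_nonneg
  have hder : ∀ᵐ t ∂volume.restrict (Ioo a b), ‖deriv g t‖ₑ ≤ ‖circleDeriv γ t‖ₑ := by
    have h1 := hgac.ae_differentiableAt
    rw [uIcc_of_le hab] at h1
    filter_upwards [ae_hasDerivAt_circleRep hab h, ae_restrict_of_ae h1,
      ae_restrict_mem measurableSet_Ioo] with t ht ht1 htm
    have h2 := (ht1 (Ioo_subset_Icc_self htm)).hasDerivAt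
    have h3 : ∀ᶠ s in 𝓝[≠] t, ‖slope g t s‖ ≤ ‖slope (fun s => circleRep (γ s - γ t)) t s‖ := by
      refine Eventually.of_forall fun s => ?_
      simp only [slope_def_field, sub_self, circleRep_zero, sub_zero, norm_div]
      gcongr
      rw [Real.norm_eq_abs, Real.norm_eq_abs, ← norm_eq_abs_circleRep]
      refine (abs_norm_sub_norm_le _ _).trans ?_
      rw [sub_sub_sub_cancel_right]
    have h4 := le_of_tendsto_of_tendsto (hasDerivAt_iff_tendsto_slope.1 h2).norm
      (hasDerivAt_iff_tendsto_slope.1 ht).norm h3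
    rw [← ofReal_norm, ← ofReal_norm]
    exact ENNReal.ofReal_le_ofReal h4
  have h1 := hgac.integral_deriv_eq_sub
  rw [intervalIntegral.integral_of_le hab, integral_Ioc_eq_integral_Ioo] at h1
  have h2 : ‖γ b - γ a‖ₑ ≤ ∫⁻ t in Ioo a b, ‖deriv g t‖ₑ := by
    have : ‖γ b - γ a‖ₑ = ‖∫ t in Ioo a b, deriv g t‖ₑ := by
      rw [h1]; simp [hg]
    rw [this]
    exact enorm_integral_le_lintegral_enorm _
  calc ‖γ b - γ a‖ₑ ^ 2 ≤ (∫⁻ t in Ioo a b, ‖deriv g t‖ₑ) ^ 2 := by gcongr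
    _ ≤ volume.restrict (Ioo a b) univ * ∫⁻ t in Ioo a b, ‖deriv g t‖ₑ ^ 2 :=
        sq_lintegral_le (measurable_deriv g).enorm.aemeasurable
    _ ≤ _ := by
        rw [Measure.restrict_apply_univ, Real.volume_Ioo]
        refine mul_le_mul_right (lintegral_mono_ae ?_) _
        filter_upwards [hder] with t ht
        gcongr

lemma lintegral_enorm_sq_eq {α : Type*} [MeasurableSpace α] (μ : Measure α) (g : α → ℝ) :
    ∫⁻ y, ‖g y‖ₑ ^ 2 ∂μ = eLpNorm g 2 μ ^ 2 := by
  rw [eLpNorm_eq_lintegral_rpow_enorm_toReal (by norm_num) (by norm_num)]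
  simp only [ENNReal.toReal_ofNat, ENNReal.rpow_ofNat]
  rw [← ENNReal.rpow_natCast, ← ENNReal.rpow_mul]
  norm_num

/-- The conditional expectation of a square integrable function with respect to a map, as a
function on the target. -/
lemma exists_memLp_pushforward {α β : Type*} [MeasurableSpace α] [MeasurableSpace β]
    {P : Measure α} {Φ : α → β} (hΦ : Measurable Φ) {u : α → ℝ} (hu : MemLp u 2 P) :
    ∃ v : β → ℝ, MemLp v 2 (P.map Φ) ∧ (∫⁻ y, ‖v y‖ₑ ^ 2 ∂(P.map Φ) ≤ ∫⁻ x, ‖u x‖ₑ ^ 2 ∂P) ∧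
      ∀ f : β → ℝ, MemLp f 2 (P.map Φ) → ∫ y, v y * f y ∂(P.map Φ) = ∫ x, u x * f (Φ x) ∂P := by
  have hmp : MeasurePreserving Φ P (P.map Φ) := hΦ.measurePreserving P
  -- Composition with Φ is an isometry between L² spaces. Its adjoint is the conditional
  -- expectation, so the contraction property and the duality formula both come for free.
  let C : Lp ℝ 2 (P.map Φ) →L[ℝ] Lp ℝ 2 P :=
    (Lp.compMeasurePreservingₗᵢ ℝ Φ hmp).toContinuousLinearMap
  let v : Lp ℝ 2 (P.map Φ) := ContinuousLinearMap.adjoint C (hu.toLp u)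
  have hC : ‖C‖ ≤ 1 := LinearIsometry.norm_toContinuousLinearMap_le _
  have hv : ‖v‖ ≤ ‖hu.toLp u‖ := by
    refine (ContinuousLinearMap.le_opNorm _ _).trans ?_
    rw [(ContinuousLinearMap.adjoint (𝕜 := ℝ)).norm_map C]
    exact mul_le_of_le_one_left (norm_nonneg _) hC
  refine ⟨v, Lp.memLp v, ?_, fun f hf => ?_⟩
  · have h1 : eLpNorm v 2 (P.map Φ) ≤ eLpNorm u 2 P := by
      rw [← eLpNorm_congr_ae hu.coeFn_toLp, ← Lp.enorm_def, ← Lp.enorm_def]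
      rw [← ofReal_norm, ← ofReal_norm]
      exact ENNReal.ofReal_le_ofReal hv
    rw [lintegral_enorm_sq_eq, lintegral_enorm_sq_eq]
    gcongr
  · have h1 : inner ℝ v (hf.toLp f) = inner ℝ (hu.toLp u) (C (hf.toLp f)) :=
      ContinuousLinearMap.adjoint_inner_left C _ _
    rw [L2.inner_def, L2.inner_def] at h1
    have h2 : ∫ y, v y * f y ∂(P.map Φ) = ∫ y, inner ℝ (v y) (hf.toLp f y) ∂(P.map Φ) := by
      refine integral_congr_ae ?_
      filter_upwards [hf.coeFn_toLp] with y hy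
      rw [hy]; simp [mul_comm]
    rw [h2, h1]
    refine integral_congr_ae ?_
    have h3 : C (hf.toLp f) =ᵐ[P] f ∘ Φ :=
      (Lp.coeFn_compMeasurePreserving (hf.toLp f) hmp).trans
        (hmp.quasiMeasurePreserving.ae_eq hf.coeFn_toLp)
    filter_upwards [h3, hu.coeFn_toLp] with x h4 h5
    rw [h4, h5]; simp [mul_comm]

/-! ### From curve families to admissible measures -/

lemma kinetic_eq_add {T τ : ℝ} (hT : 0 < T) (hτ : T ≤ τ) (X : ℝ → Q → Q)
    (hc : ∀ x, Continuous fun t => X t x) (hm : ∀ t, Measurable (X t)) :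
    (∫⁻ x : Q, ∫⁻ t in Ioo (-T) T, ‖circleDeriv (fun s => X s x) t‖ₑ ^ 2) +
      ((∫⁻ x : Q, ∫⁻ t in Ioo T τ, ‖circleDeriv (fun s => X s x) t‖ₑ ^ 2) +
      ∫⁻ x : Q, ∫⁻ t in Ioo (-τ) (-T), ‖circleDeriv (fun s => X s x) t‖ₑ ^ 2) ≤ kinetic τ X := by
  have hmeas : Measurable fun p : Q × ℝ => ‖circleDeriv (fun s => X s p.1) p.2‖ₑ ^ 2 :=
    ((measurable_circleDeriv hc hm).comp measurable_swap).enorm.pow_const 2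
  rw [← lintegral_add_right _ hmeas.lintegral_prod_right',
    ← lintegral_add_left hmeas.lintegral_prod_right']
  refine lintegral_mono fun x => ?_
  rw [← lintegral_union measurableSet_Ioo (by
      rw [Set.disjoint_left]; intro t h1 h2; linarith [h1.1, h2.2]),
    ← lintegral_union (measurableSet_Ioo.union measurableSet_Ioo) (by
      rw [Set.disjoint_left]
      rintro t h1 (h2 | h2)
      · linarith [h1.2, h2.1]
      · linarith [h1.1, h2.2])]
  refine lintegral_mono_set ?_
  rintro t (h | h | h)
  · exact ⟨by linarith [h.1], by linarith [h.2]⟩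
  · exact ⟨by linarith [h.1], by linarith [h.2]⟩
  · exact ⟨by linarith [h.1], by linarith [h.2]⟩

/-- The slices and the traces of the measure induced by a curve family. -/
lemma IsCurveFamily.hasSlices_map {τ T : ℝ} (hτ : T ≤ τ) {X X' : ℝ → Q → Q}
    (hc : ∀ x, Continuous fun t => X' t x) (hm : ∀ t, Measurable (X' t))
    (hae : ∀ᵐ x : Q, ∀ t ∈ Icc (-τ) τ, X' t x = X t x) :
    HasSlices T (((volume.restrict (Ioo (-T) T)).prod volume).map fun z : ℝ × Q => (z.1, X' z.1 z.2))
      fun t => (volume : Measure Q).map (X t) := by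
  have hu := measurable_uncurry_of_continuous_of_measurable hc hm
  have hΦ : Measurable fun z : ℝ × Q => (z.1, X' z.1 z.2) := measurable_fst.prodMk hu
  have h1 : HasSlices T
      (((volume.restrict (Ioo (-T) T)).prod volume).map fun z : ℝ × Q => (z.1, X' z.1 z.2))
      fun t => (volume : Measure Q).map (X' t) := by
    refine ⟨Measurable.aemeasurable ?_, fun A hA => ?_⟩
    · refine Measure.measurable_of_measurable_coe _ fun s hs => ?_
      simp_rw [fun t => Measure.map_apply (μ := volume) (hm t) hs]
      exact measurable_measure_prodMk_left (hu hs)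
    · rw [Measure.map_apply hΦ hA, Measure.prod_apply (hΦ hA)]
      refine lintegral_congr fun t => ?_
      rw [Measure.map_apply (hm t) (measurable_prodMk_left hA)]
      rfl
  refine h1.congr ?_
  filter_upwards [ae_restrict_mem measurableSet_Ioo] with t ht
  refine Measure.map_congr ?_
  filter_upwards [hae] with x hx
  exact hx t ⟨by linarith [ht.1], by linarith [ht.2]⟩

/-- The integral of a test function against the law is continuous in time by dominated convergence.
The chosen slices agree with the laws only for almost every time, which is all that an essential
limit sees. -/
lemma isTrace_map {T : ℝ} {X' : ℝ → Q → Q} {μ : Measure (ℝ × Q)} [IsFiniteMeasure μ]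
    (hc : ∀ x, Continuous fun t => X' t x) (hm : ∀ t, Measurable (X' t))
    (hs : HasSlices T μ fun t => (volume : Measure Q).map (X' t)) {l : Filter ℝ} {t₀ : ℝ}
    (hl : l ≤ 𝓝 t₀) (hl' : Ioo (-T) T ∈ l) :
    IsTrace T μ l ((volume : Measure Q).map (X' t₀)) := by
  refine ⟨inferInstance, fun ξ => ?_⟩
  have h1 : Continuous fun t => ∫ x, ξ (X' t x) := by
    refine continuous_of_dominated (bound := fun _ => ‖ξ‖) (fun t => ?_) (fun t => ?_) ?_ ?_
    · exact (ξ.continuous.measurable.comp (hm t)).aestronglyMeasurable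
    · exact Eventually.of_forall fun x => ξ.norm_coe_le_norm _
    · exact integrable_const _
    · exact Eventually.of_forall fun x => ξ.continuous.comp (hc x)
  have h2 : ∀ t, ∫ x, ξ x ∂((volume : Measure Q).map (X' t)) = ∫ x, ξ (X' t x) := fun t =>
    integral_map (hm t).aemeasurable ξ.continuous.aestronglyMeasurable
  rw [h2]
  have h3 : Tendsto (fun t => ∫ x, ξ (X' t x)) (l ⊓ ae volume) (𝓝 (∫ x, ξ (X' t₀ x))) :=
    (h1.tendsto t₀).mono_left (inf_le_left.trans hl)
  refine h3.congr' ?_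
  have h4 := hs.ae_eq_slice
  rw [ae_restrict_iff' measurableSet_Ioo] at h4
  filter_upwards [mem_inf_of_left hl', mem_inf_of_right h4] with t ht ht'
  rw [ht' ht, h2]

lemma boundaryEnergy_le {T : ℝ} {μ : Measure (ℝ × Q)} {σ₁ σ₂ : Measure Q}
    (h₁ : IsTopTrace T μ σ₁) (h₂ : IsBottomTrace T μ σ₂) :
    boundaryEnergy T μ ≤ wassersteinSq σ₁ volume + wassersteinSq σ₂ volume :=
  add_le_add (iInf₂_le σ₁ h₁) (iInf₂_le σ₂ h₂)

/-- The pairs `(X s x, x)` form an admissible plan. By Cauchy-Schwarz on a leg of duration 1/lam,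
its cost is at most 1/lam times the kinetic energy of the leg. -/
lemma wassersteinSq_map_le {lam : ℝ} (hlam : 0 < lam) {X : ℝ → Q → Q} {a b s : ℝ} (hab : a ≤ b)
    (hba : b - a = lam⁻¹) (hm : Measurable (X s))
    (hac : ∀ᵐ x : Q, AbsolutelyContinuousOnInterval (fun t => X t x) a b)
    (hx : ∀ᵐ x : Q, ‖X s x - x‖ₑ = ‖X b x - X a x‖ₑ) :
    ENNReal.ofReal lam * wassersteinSq ((volume : Measure Q).map (X s)) volume ≤
      ∫⁻ x : Q, ∫⁻ t in Ioo a b, ‖circleDeriv (fun s => X s x) t‖ₑ ^ 2 := by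
  have hm2 : Measurable fun x : Q => (X s x, x) := hm.prodMk measurable_id
  have h1 : wassersteinSq ((volume : Measure Q).map (X s)) volume ≤ ∫⁻ x : Q, ‖X s x - x‖ₑ ^ 2 := by
    have hp1 : (volume.map fun x : Q => (X s x, x)).map Prod.fst =
        (volume : Measure Q).map (X s) := by
      rw [Measure.map_map measurable_fst hm2]; rfl
    have hp2 : (volume.map fun x : Q => (X s x, x)).map Prod.snd = volume := by
      rw [Measure.map_map measurable_snd hm2]
      exact Measure.map_id
    refine (iInf₂_le (volume.map fun x : Q => (X s x, x)) ⟨hp1, hp2⟩).trans ?_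
    rw [lintegral_map _ hm2]
    exact (measurable_fst.sub measurable_snd).enorm.pow_const 2
  have h2 : ∫⁻ x : Q, ‖X s x - x‖ₑ ^ 2 ≤ ENNReal.ofReal lam⁻¹ *
      ∫⁻ x : Q, ∫⁻ t in Ioo a b, ‖circleDeriv (fun s => X s x) t‖ₑ ^ 2 := by
    rw [← lintegral_const_mul' _ _ ENNReal.ofReal_ne_top]
    refine lintegral_mono_ae ?_
    filter_upwards [hac, hx] with x h3 h4
    rw [h4, ← hba]
    have h5 := enorm_sub_sq_le (γ := fun t => X t x) hab h3
    exact h5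
  have h3 := h1.trans h2
  generalize wassersteinSq ((volume : Measure Q).map (X s)) volume = w at h3 ⊢
  calc ENNReal.ofReal lam * w ≤ ENNReal.ofReal lam * (ENNReal.ofReal lam⁻¹ * _) := by gcongr
    _ = _ := by
      rw [← mul_assoc, ← ENNReal.ofReal_mul hlam.le, mul_inv_cancel₀ hlam.ne', ENNReal.ofReal_one,
        one_mul]

/-- The measure is the law of the particles in space-time and the flux is their mean velocity times
this measure. The middle part of the curves pays for the internal energy, the two end legs for the
boundary terms. Only an inequality results, since averaging velocities and inserting one particular
plan can both be wasteful. -/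
theorem IsCurveFamily.exists_admissible {T lam : ℝ} (hT : 0 < T) (hlam : 0 < lam) {X : ℝ → Q → Q}
    (hX : IsCurveFamily (extendedTime lam T) X) (hL : lagrangian lam T X < ⊤) :
    ∃ μ ∈ admissible T, energy lam T μ ≤ lagrangian lam T X ∧ IsInducedBy T μ X := by
  have hl : 0 < lam⁻¹ := inv_pos.2 hlam
  set τ := extendedTime lam T with hτdef
  have hττ : τ = T + lam⁻¹ := rfl
  have hτ : T ≤ τ := by linarith
  have hτ0 : 0 ≤ τ := by linarith
  obtain ⟨X', hc, hm, hae⟩ := hX.exists_regular hτ0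
  have hu := measurable_uncurry_of_continuous_of_measurable hc hm
  have hΦ : Measurable fun z : ℝ × Q => (z.1, X' z.1 z.2) := measurable_fst.prodMk hu
  set P : Measure (ℝ × Q) := (volume.restrict (Ioo (-T) T)).prod volume with hP
  set μ : Measure (ℝ × Q) := P.map fun z : ℝ × Q => (z.1, X' z.1 z.2) with hμ
  have hsl : HasSlices T μ fun t => (volume : Measure Q).map (X t) :=
    IsCurveFamily.hasSlices_map hτ hc hm (hae.mono fun x hx => hx.1)
  have hmapeq : ∀ t ∈ Icc (-τ) τ, (volume : Measure Q).map (X t) = (volume : Measure Q).map (X' t) := by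
    intro t ht
    refine Measure.map_congr ?_
    filter_upwards [hae] with x hx
    exact (hx.1 t ht).symm
  have hsl' : HasSlices T μ fun t => (volume : Measure Q).map (X' t) := by
    refine hsl.congr ?_
    filter_upwards [ae_restrict_mem measurableSet_Ioo] with t ht
    exact hmapeq t ⟨by linarith [ht.1], by linarith [ht.2]⟩
  have hTm : T ∈ Icc (-τ) τ := ⟨by linarith, hτ⟩
  have hTm' : -T ∈ Icc (-τ) τ := ⟨by linarith, by linarith⟩
  have htop : IsTopTrace T μ ((volume : Measure Q).map (X T)) := by
    rw [hmapeq T hTm]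
    exact isTrace_map hc hm hsl' nhdsWithin_le_nhds (Ioo_mem_nhdsLT (by linarith))
  have hbot : IsBottomTrace T μ ((volume : Measure Q).map (X (-T))) := by
    rw [hmapeq (-T) hTm']
    exact isTrace_map hc hm hsl' nhdsWithin_le_nhds (Ioo_mem_nhdsGT (by linarith))
  rw [hX.lagrangian_eq hT hlam, ← hτdef] at hL ⊢
  have hkin : kinetic τ X = kinetic τ X' := by
    unfold kinetic
    refine lintegral_congr_ae ?_
    filter_upwards [hae] with x hx
    refine setLIntegral_congr_fun measurableSet_Ioo fun t ht => ?_
    rw [circleDeriv_congr_Ioo hx.1 ht]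
  rw [hkin] at hL ⊢
  have hsplit := kinetic_eq_add hT hτ X' hc hm
  set Kmid := ∫⁻ x : Q, ∫⁻ t in Ioo (-T) T, ‖circleDeriv (fun s => X' s x) t‖ₑ ^ 2
  set Ktop := ∫⁻ x : Q, ∫⁻ t in Ioo T τ, ‖circleDeriv (fun s => X' s x) t‖ₑ ^ 2
  set Kbot := ∫⁻ x : Q, ∫⁻ t in Ioo (-τ) (-T), ‖circleDeriv (fun s => X' s x) t‖ₑ ^ 2
  set u : ℝ × Q → ℝ := fun z => circleDeriv (fun t => X' t z.2) z.1 with hudef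
  have humeas : Measurable u := measurable_circleDeriv hc hm
  have hKmid : ∫⁻ z, ‖u z‖ₑ ^ 2 ∂P = Kmid :=
    lintegral_prod_symm _ (humeas.enorm.pow_const 2).aemeasurable
  have hKfin : Kmid < ⊤ :=
    lt_of_le_of_lt (le_self_add.trans hsplit) (lt_of_le_of_lt le_add_self hL)
  have hu2 : MemLp u 2 P := by
    refine ⟨humeas.aestronglyMeasurable, ?_⟩
    rw [← hKmid, lintegral_enorm_sq_eq] at hKfin
    by_contra h
    rw [not_lt, top_le_iff] at h
    rw [h] at hKfin
    simp at hKfin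
  -- The mean velocity of the particles that share a point of space-time.
  obtain ⟨v, hv2, hvK, hvf⟩ := exists_memLp_pushforward hΦ hu2
  have hvint : Integrable v μ := hv2.integrable (by norm_num)
  obtain ⟨m, hmv⟩ : ∃ m : SignedMeasure (ℝ × Q), m = μ.withDensityᵥ v := ⟨_, rfl⟩
  have hmabs : m ≪ᵥ μ.toENNRealVectorMeasure := hmv ▸ μ.withDensityᵥ_absolutelyContinuous v
  have hrn : m.rnDeriv μ =ᵐ[μ] v := by
    refine Integrable.ae_eq_of_withDensityᵥ_eq (SignedMeasure.integrable_rnDeriv _ _) hvint ?_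
    rw [SignedMeasure.withDensityᵥ_rnDeriv_eq _ _ hmabs, hmv]
  have hatomtop : ∀ᵐ t ∂volume.restrict (Ioo (-T) T), atomSum ((volume : Measure Q).map (X t)) ≠ ⊤ := by
    have h1 : AEMeasurable (fun t => atomSum ((volume : Measure Q).map (X t)))
        (volume.restrict (Ioo (-T) T)) := by
      have h2 : Measurable fun t : ℝ => ∫⁻ x, (multiplicity X' (X' t x) t)⁻¹ :=
        (measurable_multiplicity_comp hu).inv.lintegral_prod_right'
      refine h2.aemeasurable.congr ?_
      filter_upwards [ae_restrict_mem measurableSet_Ioo] with t ht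
      rw [hmapeq t ⟨by linarith [ht.1], by linarith [ht.2]⟩, atomSum_map (hm t).aemeasurable]
      rfl
    exact (ae_lt_top' h1 (lt_of_le_of_lt le_self_add hL).ne).mono fun t ht => ht.ne
  have hadm : IsAdmissiblePair T μ m := by
    refine ⟨inferInstance, hmabs, fun ζ hζ => ?_,
      _, hsl, ?_⟩
    · have h1 : ∫ z, (dt ζ z + m.rnDeriv μ z * dx ζ z) ∂μ =
          ∫ z, (dt ζ z + v z * dx ζ z) ∂μ := by
        refine integral_congr_ae ?_
        filter_upwards [hrn] with z hz
        rw [hz]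
      obtain ⟨C, -, hC⟩ := hζ.exists_bound
      have hdx2 : MemLp (dx ζ) 2 μ :=
        MemLp.of_bound hζ.continuous_dx.aestronglyMeasurable C (Eventually.of_forall fun z => (hC z).2)
      have hdtint : Integrable (dt ζ) μ :=
        (MemLp.of_bound (p := 1) hζ.continuous_dt.aestronglyMeasurable C
          (Eventually.of_forall fun z => (hC z).1)).integrable le_rfl
      have hvdx : Integrable (fun z => v z * dx ζ z) μ := hv2.integrable_mul hdx2
      have hdxΦ : MemLp (fun z : ℝ × Q => dx ζ (z.1, X' z.1 z.2)) 2 P :=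
        hdx2.comp_measurePreserving (hΦ.measurePreserving P)
      have hdtΦ : Integrable (fun z : ℝ × Q => dt ζ (z.1, X' z.1 z.2)) P :=
        (hΦ.measurePreserving P).integrable_comp_of_integrable hdtint
      have hudx : Integrable (fun z : ℝ × Q => u z * dx ζ (z.1, X' z.1 z.2)) P :=
        hu2.integrable_mul hdxΦ
      rw [h1, integral_add hdtint hvdx, hvf _ hdx2,
        integral_map hΦ.aemeasurable hζ.continuous_dt.aestronglyMeasurable,
        ← integral_add hdtΦ hudx]
      -- After pulling back to the labels, the continuity equation is the average over all labels of
      -- the fundamental theorem of calculus for the test function along one curve.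
      refine (integral_prod_symm _ (hdtΦ.add hudx)).trans ?_
      refine integral_eq_zero_of_ae ?_
      filter_upwards [hae] with x hx
      refine hζ.integral_along_curve hT.le (hx.2.mono ?_)
      rw [uIcc_of_le (by linarith), uIcc_of_le (by linarith)]
      exact Icc_subset_Icc (by linarith) hτ
    · filter_upwards [hatomtop] with t ht
      exact isAtomic_of_atoms_compl_null (atoms_compl_null_of_atomSum_ne_top ht)
  have hint : internalEnergy T μ ≤
      (∫⁻ t in Ioo (-T) T, atomSum ((volume : Measure Q).map (X t))) + Kmid := by
    refine (iInf₂_le m hadm).trans ?_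
    unfold pairEnergy
    gcongr ?_ + ?_
    · refine (lintegral_congr_ae ?_).le
      filter_upwards [hsl.ae_eq_slice, hatomtop] with t h1 h2
      rw [h1, atomSum_eq_numAtoms (atoms_compl_null_of_atomSum_ne_top h2)]
    · rw [← hKmid]
      refine le_trans (lintegral_congr_ae ?_).le hvK
      filter_upwards [hrn] with z hz
      rw [hz]
  have hWtop := wassersteinSq_map_le hlam hτ (by rw [hττ]; ring) (hm T)
    (hae.mono fun x hx => hx.2.mono (by
      rw [uIcc_of_le hτ, uIcc_of_le (by linarith)]
      exact Icc_subset_Icc (by linarith) le_rfl)) (by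
      filter_upwards [hae] with x hx
      rw [hx.1 τ ⟨by linarith, le_rfl⟩, hX.final, ← enorm_neg]
      simp)
  have hWbot := wassersteinSq_map_le hlam (a := -τ) (b := -T) (by linarith) (by rw [hττ]; ring)
    (hm (-T))
    (hae.mono fun x hx => hx.2.mono (by
      rw [uIcc_of_le (by linarith), uIcc_of_le (by linarith)]
      exact Icc_subset_Icc le_rfl (by linarith))) (by
      filter_upwards [hae] with x hx
      rw [hx.1 (-τ) ⟨le_rfl, by linarith⟩, hX.initial])
  have hbd : ENNReal.ofReal lam * boundaryEnergy T μ ≤ Ktop + Kbot := by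
    have h1 := boundaryEnergy_le htop hbot
    rw [hmapeq T hTm, hmapeq (-T) hTm'] at h1
    calc ENNReal.ofReal lam * boundaryEnergy T μ
        ≤ ENNReal.ofReal lam * (wassersteinSq ((volume : Measure Q).map (X' T)) volume +
          wassersteinSq ((volume : Measure Q).map (X' (-T))) volume) := by gcongr
      _ ≤ _ := by
        rw [mul_add]
        exact add_le_add hWtop hWbot
  refine ⟨μ, ⟨_, hadm⟩, ?_, hsl, htop, hbot⟩
  calc energy lam T μ ≤ ((∫⁻ t in Ioo (-T) T, atomSum ((volume : Measure Q).map (X t))) + Kmid) +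
        (Ktop + Kbot) := add_le_add hint hbd
    _ = (∫⁻ t in Ioo (-T) T, atomSum ((volume : Measure Q).map (X t))) + (Kmid + (Ktop + Kbot)) := by
        rw [add_assoc]
    _ ≤ _ := by gcongr

/-! ### Weak compactness and monotone functions -/

/-- Sequential Banach-Alaoglu in the dual of a separable space, transported by the Riesz
isomorphism. -/
lemma exists_weak_subseq {H : Type*} [NormedAddCommGroup H] [InnerProductSpace ℝ H]
    [CompleteSpace H] [TopologicalSpace.SeparableSpace H] {f : ℕ → H} {R : ℝ}
    (hf : ∀ n, ‖f n‖ ≤ R) : ∃ φ : ℕ → ℕ, StrictMono φ ∧ ∃ g : H,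
      ∀ h, Tendsto (fun n => inner ℝ (f (φ n)) h) atTop (𝓝 (inner ℝ g h)) := by
  have hsc := WeakDual.isSeqCompact_closedBall ℝ H (0 : StrongDual ℝ H) R
  let u : ℕ → WeakDual ℝ H := fun n =>
    StrongDual.toWeakDual (InnerProductSpace.toDual ℝ H (f n))
  have hu : ∀ n, u n ∈ WeakDual.toStrongDual ⁻¹' Metric.closedBall (0 : StrongDual ℝ H) R := by
    intro n
    simp only [mem_preimage, Metric.mem_closedBall, dist_zero_right]
    have : WeakDual.toStrongDual (u n) = InnerProductSpace.toDual ℝ H (f n) := rfl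
    rw [this, LinearIsometryEquiv.norm_map]
    exact hf n
  obtain ⟨a, -, φ, hφ, ha⟩ := hsc hu
  refine ⟨φ, hφ, (InnerProductSpace.toDual ℝ H).symm (WeakDual.toStrongDual a), fun h => ?_⟩
  have h1 := ((WeakDual.eval_continuous (𝕜 := ℝ) h).tendsto a).comp ha
  rw [InnerProductSpace.toDual_symm_apply]
  exact h1

/-- The uniform measure on the label interval `(0, 1]`. -/
abbrev labels : Measure ℝ := volume.restrict (Ioc 0 1)

/-- A function on the labels that is nondecreasing off a null set. -/
def AEMonotone (f : ℝ → ℝ) : Prop := ∃ G : Set ℝ, (∀ᵐ s ∂labels, s ∈ G) ∧ MonotoneOn f G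

/-- A monotone function lies above its averages to the left of a point and below those to the right.
Averages converge by assumption, and at a point where the primitive of the limit is differentiable
with derivative `y' s`, short averages of the limit are close to its value. Monotonicity of the
limit is not needed. -/
lemma tendsto_of_tendsto_integral {y : ℕ → ℝ → ℝ} {y' : ℝ → ℝ}
    (hy : ∀ n, IntegrableOn (y n) (Ioc 0 1)) (hy' : IntegrableOn y' (Ioc 0 1))
    (hmono : ∀ n, AEMonotone (y n))
    (h : ∀ a b : ℝ, 0 ≤ a → a ≤ b → b ≤ 1 →
      Tendsto (fun n => ∫ s in a..b, y n s) atTop (𝓝 (∫ s in a..b, y' s))) :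
    ∀ᵐ s ∂labels, Tendsto (fun n => y n s) atTop (𝓝 (y' s)) := by
  choose G hG hGm using hmono
  have hint' : IntervalIntegrable y' volume 0 1 :=
    (intervalIntegrable_iff_integrableOn_Ioc_of_le zero_le_one).2 hy'
  have hint : ∀ n a b, 0 ≤ a → a ≤ b → b ≤ 1 → IntervalIntegrable (y n) volume a b :=
    fun n a b ha hab hb => (intervalIntegrable_iff_integrableOn_Ioc_of_le hab).2
      ((hy n).mono_set (Ioc_subset_Ioc ha hb))
  have hGall : ∀ᵐ s ∂labels, ∀ n, s ∈ G n := ae_all_iff.2 hG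
  have hder := ae_restrict_of_ae (s := Ioc (0 : ℝ) 1) hint'.ae_hasDerivAt_integral
  have hne : ∀ᵐ s ∂labels, s ≠ 1 := ae_restrict_of_ae (by simp [ae_iff])
  have hGall' : ∀ᵐ s : ℝ, s ∈ Ioc (0 : ℝ) 1 → ∀ n, s ∈ G n :=
    (ae_restrict_iff' measurableSet_Ioc).1 hGall
  have key : ∀ n a b s, 0 < a → a < b → b ≤ 1 → (s ∈ Ioc (0 : ℝ) 1) → (∀ n, s ∈ G n) →
      (s ≤ a → y n s * (b - a) ≤ ∫ x in a..b, y n x) ∧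
      (b ≤ s → ∫ x in a..b, y n x ≤ y n s * (b - a)) := by
    intro n a b s ha hab hb hs hsG
    have hc : y n s * (b - a) = ∫ _ in a..b, y n s := by
      rw [intervalIntegral.integral_const, smul_eq_mul, mul_comm]
    rw [hc]
    constructor
    · intro hsa
      refine intervalIntegral.integral_mono_ae_restrict hab.le (by simp)
        (hint n a b ha.le hab.le hb) ?_
      filter_upwards [ae_restrict_of_ae hGall', ae_restrict_mem measurableSet_Icc] with x hx hx'
      exact hGm n (hsG n) (hx ⟨by linarith [hx'.1], by linarith [hx'.2]⟩ n) (hsa.trans hx'.1)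
    · intro hbs
      refine intervalIntegral.integral_mono_ae_restrict hab.le (hint n a b ha.le hab.le hb)
        (by simp) ?_
      filter_upwards [ae_restrict_of_ae hGall', ae_restrict_mem measurableSet_Icc] with x hx hx'
      exact hGm n (hx ⟨by linarith [hx'.1], by linarith [hx'.2]⟩ n) (hsG n) (hx'.2.trans hbs)
  filter_upwards [hGall, hder, hne, ae_restrict_mem measurableSet_Ioc] with s hsG hsd hs1 hs
  have hslt : s < 1 := lt_of_le_of_ne hs.2 hs1
  have hd := hsd (by rw [uIcc_of_le zero_le_one]; exact Ioc_subset_Icc_self hs) 0 (by simp)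
  have hsl := hasDerivAt_iff_tendsto_slope.1 hd
  have hA : ∀ a b, 0 ≤ a → a ≤ b → b ≤ 1 →
      (∫ x in (0 : ℝ)..b, y' x) - ∫ x in (0 : ℝ)..a, y' x = ∫ x in a..b, y' x := by
    intro a b ha hab hb
    refine intervalIntegral.integral_interval_sub_left ?_ ?_
    · exact hint'.mono_set (by
        rw [uIcc_of_le (ha.trans hab), uIcc_of_le zero_le_one]; exact Icc_subset_Icc le_rfl hb)
    · exact hint'.mono_set (by
        rw [uIcc_of_le ha, uIcc_of_le zero_le_one]; exact Icc_subset_Icc le_rfl (hab.trans hb))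
  refine tendsto_order.2 ⟨fun c hc => ?_, fun c hc => ?_⟩
  -- Choose a to the left of s such that the mean of the limit over (a, s) exceeds c. The means of
  -- `y n` eventually exceed c as well, and `y n s` lies above them.
  · have h1 : ∀ᶠ b in 𝓝[<] s, c < slope (fun x => ∫ t in (0 : ℝ)..x, y' t) s b :=
      (hsl.mono_left (nhdsWithin_mono _ (fun x hx => ne_of_lt hx))).eventually (lt_mem_nhds hc)
    obtain ⟨a, ha1, ha2⟩ := (h1.and (Ioo_mem_nhdsLT hs.1)).exists
    have hpos : 0 < s - a := sub_pos.2 ha2.2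
    rw [slope_comm, slope_def_field, hA a s ha2.1.le ha2.2.le hs.2, lt_div_iff₀ hpos] at ha1
    filter_upwards [(h a s ha2.1.le ha2.2.le hs.2).eventually (lt_mem_nhds ha1)] with n hn
    have := hn.trans_le ((key n a s s ha2.1 ha2.2 hs.2 hs hsG).2 le_rfl)
    exact lt_of_mul_lt_mul_right this hpos.le
  · have h1 : ∀ᶠ b in 𝓝[>] s, slope (fun x => ∫ t in (0 : ℝ)..x, y' t) s b < c :=
      (hsl.mono_left (nhdsWithin_mono _ (fun x hx => ne_of_gt hx))).eventually (gt_mem_nhds hc)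
    obtain ⟨b, hb1, hb2⟩ := (h1.and (Ioo_mem_nhdsGT hslt)).exists
    have hpos : 0 < b - s := sub_pos.2 hb2.1
    rw [slope_def_field, hA s b hs.1.le hb2.1.le hb2.2.le, div_lt_iff₀ hpos] at hb1
    filter_upwards [(h s b hs.1.le hb2.1.le hb2.2.le).eventually (gt_mem_nhds hb1)] with n hn
    have := ((key n s b s hs.1 hb2.1 hb2.2.le hs hsG).1 le_rfl).trans_lt hn
    exact lt_of_mul_lt_mul_right this hpos.le

/-! ### Monotone flows -/

/-- The space of times and labels. -/
abbrev flowMeasure (τ : ℝ) : Measure (ℝ × ℝ) := (volume.restrict (Ioc 0 τ)).prod labels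

/-- The position at time `t` of the particle with label `s`, which moves with velocity `g (·, s)`
and is at `s` at time `τ`. -/
def flowMap (τ : ℝ) (g : ℝ × ℝ → ℝ) (t s : ℝ) : ℝ := s - ∫ r in t..τ, g (r, s)

/-- A flow on `[0, τ]` with velocity `g` which preserves the order of the labels and whose kinetic
energy is at most `K`. -/
structure IsFlow (τ : ℝ) (K : ℝ≥0∞) (g : ℝ × ℝ → ℝ) : Prop where
  measurable : Measurable g
  energy : ∫⁻ z, ‖g z‖ₑ ^ 2 ∂flowMeasure τ ≤ K
  monotone : ∀ t ∈ Icc 0 τ, AEMonotone (flowMap τ g t)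

lemma memLp_two_of_lintegral_ne_top {α : Type*} [MeasurableSpace α] {μ : Measure α} {g : α → ℝ}
    (hm : AEStronglyMeasurable g μ) (h : ∫⁻ z, ‖g z‖ₑ ^ 2 ∂μ ≠ ⊤) : MemLp g 2 μ := by
  refine ⟨hm, ?_⟩
  rw [lintegral_enorm_sq_eq] at h
  by_contra h'
  rw [not_lt, top_le_iff] at h'
  rw [h'] at h
  simp at h

section

variable {τ : ℝ} {g : ℝ × ℝ → ℝ}

lemma integrable_strip (hg : Integrable g (flowMeasure τ)) {t a b : ℝ} (ht : 0 ≤ t) (ha : 0 ≤ a)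
    (hb : b ≤ 1) : Integrable g ((volume.restrict (Ioc t τ)).prod (volume.restrict (Ioc a b))) :=
  hg.mono_measure (Measure.prod_mono (Measure.restrict_mono_set _ (Ioc_subset_Ioc ht le_rfl))
    (Measure.restrict_mono_set _ (Ioc_subset_Ioc ha hb)))

lemma integrableOn_flowMap (hg : Integrable g (flowMeasure τ)) {t : ℝ} (ht : t ∈ Icc 0 τ) :
    IntegrableOn (flowMap τ g t) (Ioc 0 1) := by
  have h1 : Integrable (fun s => ∫ r in Ioc t τ, g (r, s)) labels :=
    (integrable_strip hg ht.1 le_rfl le_rfl).integral_prod_right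
  have h2 : Integrable (fun s : ℝ => s) labels :=
    (continuous_id.integrableOn_Icc (a := 0) (b := 1)).mono_set Ioc_subset_Icc_self
  unfold flowMap
  simp_rw [intervalIntegral.integral_of_le ht.2]
  exact h2.sub h1

/-- Averages of positions over intervals of labels are, up to a constant, integrals of the velocity
over rectangles. Such integrals pass to weak limits. -/
lemma integral_flowMap (hg : Integrable g (flowMeasure τ)) {t a b : ℝ} (ht : t ∈ Icc 0 τ)
    (ha : 0 ≤ a) (hab : a ≤ b) (hb : b ≤ 1) :
    ∫ s in a..b, flowMap τ g t s = (∫ s in a..b, s) -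
      ∫ z in Ioc t τ ×ˢ Ioc a b, g z ∂flowMeasure τ := by
  have h0 := integrable_strip hg ht.1 ha hb
  have h1 : Integrable (fun s => ∫ r in Ioc t τ, g (r, s)) (volume.restrict (Ioc a b)) :=
    h0.integral_prod_right
  have hm : (flowMeasure τ).restrict (Ioc t τ ×ˢ Ioc a b) =
      (volume.restrict (Ioc t τ)).prod (volume.restrict (Ioc a b)) := by
    rw [← Measure.prod_restrict, Measure.restrict_restrict measurableSet_Ioc,
      Measure.restrict_restrict measurableSet_Ioc, inter_eq_left.2 (Ioc_subset_Ioc ht.1 le_rfl),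
      inter_eq_left.2 (Ioc_subset_Ioc ha hb)]
  rw [hm, integral_prod_symm _ h0]
  unfold flowMap
  simp_rw [intervalIntegral.integral_of_le ht.2]
  rw [intervalIntegral.integral_sub intervalIntegral.intervalIntegrable_id
    ((intervalIntegrable_iff_integrableOn_Ioc_of_le hab).2 h1),
    intervalIntegral.integral_of_le hab (f := fun s => ∫ r in Ioc t τ, g (r, s))]

end

namespace IsFlow

variable {τ : ℝ} {K : ℝ≥0∞} {g : ℝ × ℝ → ℝ}

lemma memLp (h : IsFlow τ K g) (hK : K ≠ ⊤) : MemLp g 2 (flowMeasure τ) :=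
  memLp_two_of_lintegral_ne_top h.measurable.aestronglyMeasurable
    (ne_top_of_le_ne_top hK h.energy)

lemma integrable (h : IsFlow τ K g) (hK : K ≠ ⊤) : Integrable g (flowMeasure τ) :=
  (h.memLp hK).integrable (by norm_num)

/-- Monotone flows are compact. -/
theorem exists_limit {K : ℕ → ℝ≥0∞} {K' : ℝ≥0∞} {g : ℕ → ℝ × ℝ → ℝ}
    (h : ∀ n, IsFlow τ (K n) (g n)) (hK : Tendsto K atTop (𝓝 K')) (hK' : K' ≠ ⊤) :
    ∃ φ : ℕ → ℕ, StrictMono φ ∧ ∃ g' : ℝ × ℝ → ℝ, IsFlow τ K' g' ∧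
      ∀ t ∈ Icc 0 τ, ∀ᵐ s ∂labels,
        Tendsto (fun n => flowMap τ (g (φ n)) t s) atTop (𝓝 (flowMap τ g' t s)) := by
  -- Finitely many of the bounds may be infinite; they are dropped by shifting the sequence by N,
  -- after which all velocities lie in one ball of L².
  obtain ⟨N, hN⟩ := eventually_atTop.1
    (hK.eventually (gt_mem_nhds (ENNReal.lt_add_right hK' one_ne_zero)))
  have hKtop : ∀ n, K (n + N) ≠ ⊤ := fun n => ((hN (n + N) (by omega)).trans
    (ENNReal.add_lt_top.2 ⟨lt_top_iff_ne_top.2 hK', ENNReal.one_lt_top⟩)).ne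
  let f : ℕ → Lp ℝ 2 (flowMeasure τ) := fun n => ((h (n + N)).memLp (hKtop n)).toLp
  have hfn : ∀ n, ‖f n‖ₑ ^ 2 ≤ K (n + N) := by
    intro n
    have : ‖f n‖ₑ = eLpNorm (g (n + N)) 2 (flowMeasure τ) := by
      rw [Lp.enorm_def]; exact eLpNorm_congr_ae (MemLp.coeFn_toLp _)
    rw [this, ← lintegral_enorm_sq_eq]
    exact (h (n + N)).energy
  have hfn' : ∀ n, ‖f n‖ ^ 2 ≤ (K (n + N)).toReal := by
    intro n
    have := ENNReal.toReal_mono (hKtop n) (hfn n)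
    simpa using this
  have hR : ∀ n, ‖f n‖ ≤ Real.sqrt (K' + 1).toReal := by
    intro n
    refine Real.le_sqrt_of_sq_le ((hfn' n).trans ?_)
    exact ENNReal.toReal_mono (by simp [hK']) (hN (n + N) (by omega)).le
  have : Fact ((2 : ℝ≥0∞) ≠ ⊤) := ⟨by norm_num⟩
  obtain ⟨ψ, hψ, G, hG⟩ := exists_weak_subseq hR
  have hGm : Measurable (G : ℝ × ℝ → ℝ) := (Lp.stronglyMeasurable G).measurable
  have hKr : Tendsto (fun n => (K (ψ n + N)).toReal) atTop (𝓝 K'.toReal) :=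
    (ENNReal.tendsto_toReal hK').comp (hK.comp ((tendsto_add_atTop_nat N).comp hψ.tendsto_atTop))
  -- Weak lower semicontinuity of the norm: pair the sequence with its own limit and use
  -- Cauchy-Schwarz. This gives the limit of the bounds rather than their supremum.
  have hGnorm : ‖G‖ ^ 2 ≤ K'.toReal := by
    have h1 : ‖G‖ ^ 2 ≤ Real.sqrt K'.toReal * ‖G‖ := by
      rw [← real_inner_self_eq_norm_sq]
      refine le_of_tendsto_of_tendsto (hG G)
        (((Real.continuous_sqrt.tendsto _).comp hKr).mul_const ‖G‖) (Eventually.of_forall fun n => ?_)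
      exact (real_inner_le_norm _ _).trans
        (mul_le_mul_of_nonneg_right (Real.le_sqrt_of_sq_le (hfn' _)) (norm_nonneg _))
    rcases (norm_nonneg G).eq_or_lt with h0 | h0
    · rw [← h0]; simp
    · have h2 : ‖G‖ ≤ Real.sqrt K'.toReal := by nlinarith
      calc ‖G‖ ^ 2 ≤ Real.sqrt K'.toReal ^ 2 := by gcongr
        _ = _ := Real.sq_sqrt ENNReal.toReal_nonneg
  have hGen : ∫⁻ z, ‖G z‖ₑ ^ 2 ∂flowMeasure τ ≤ K' := by
    rw [lintegral_enorm_sq_eq, ← Lp.enorm_def, ← ENNReal.ofReal_toReal hK', ← ofReal_norm,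
      ← ENNReal.ofReal_pow (norm_nonneg _)]
    exact ENNReal.ofReal_le_ofReal hGnorm
  have hG2 : MemLp G 2 (flowMeasure τ) := Lp.memLp G
  let φ : ℕ → ℕ := fun n => ψ n + N
  have hφ : StrictMono φ := fun a b hab => Nat.add_lt_add_right (hψ hab) N
  -- a flow without the monotonicity
  have hflow0 : ∀ t ∈ Icc 0 τ, ∀ᵐ s ∂labels,
      Tendsto (fun n => flowMap τ (g (φ n)) t s) atTop (𝓝 (flowMap τ G t s)) := by
    intro t ht
    have hGint := hG2.integrable (q := 2) (by norm_num)
    refine tendsto_of_tendsto_integral (fun n => integrableOn_flowMap ((h (φ n)).integrable (hKtop _)) ht)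
      (integrableOn_flowMap hGint ht)
      (fun n => (h (φ n)).monotone t ht) fun a b ha hab hb => ?_
    rw [integral_flowMap hGint ht ha hab hb]
    simp_rw [fun n => integral_flowMap ((h (φ n)).integrable (hKtop _)) ht ha hab hb]
    refine tendsto_const_nhds.sub ?_
    have hS : MeasurableSet (Ioc t τ ×ˢ Ioc a b) := measurableSet_Ioc.prod measurableSet_Ioc
    -- The weak convergence is tested with the indicator function of a rectangle.
    have h1 := hG (indicatorConstLp 2 hS (measure_ne_top (flowMeasure τ) _) (1 : ℝ))
    simp_rw [fun F : Lp ℝ 2 (flowMeasure τ) => real_inner_comm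
      (indicatorConstLp 2 hS (measure_ne_top (flowMeasure τ) _) (1 : ℝ)) F,
      L2.inner_indicatorConstLp_one] at h1
    refine h1.congr fun n => integral_congr_ae ?_
    exact ae_restrict_of_ae (MemLp.coeFn_toLp _)
  refine ⟨φ, hφ, G, ⟨hGm, hGen, fun t ht => ?_⟩, hflow0⟩
  choose Gs hGs hGsm using fun n => (h (φ n)).monotone t ht
  -- Monotonicity passes to the limit on the labels where every approximation is monotone and the
  -- positions converge.
  refine ⟨{s | (∀ n, s ∈ Gs n) ∧
    Tendsto (fun n => flowMap τ (g (φ n)) t s) atTop (𝓝 (flowMap τ G t s))},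
    (ae_all_iff.2 hGs).and (hflow0 t ht), fun s hs s' hs' hss => ?_⟩
  exact le_of_tendsto_of_tendsto' hs.2 hs'.2 fun n => hGsm n (hs.1 n) (hs'.1 n) hss

end IsFlow

/-! ### Labels on the circle and reflection in time -/

/-- The representative of a point of the torus in `(0, 1]`. -/
def label (q : Q) : ℝ := (AddCircle.equivIoc (1 : ℝ) 0 q : ℝ)

@[simp] lemma coe_label (q : Q) : ((label q : ℝ) : Q) = q := AddCircle.coe_equivIoc

lemma label_coe {s : ℝ} (hs : s ∈ Ioc (0 : ℝ) 1) : label (s : Q) = s := by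
  have h' : s ∈ Ioc (0 : ℝ) (0 + 1) := by simpa using hs
  unfold label
  rw [AddCircle.equivIoc_coe_eq h']

lemma measurable_label : Measurable label :=
  measurable_subtype_coe.comp (AddCircle.measurableEquivIoc (1 : ℝ) 0).measurable

lemma map_coe_labels : labels.map (fun s : ℝ => (s : Q)) = volume := by
  have := (AddCircle.measurePreserving_mk (1 : ℝ) 0).map_eq
  rw [zero_add] at this
  exact this

lemma measurePreserving_label : MeasurePreserving label volume labels := by
  refine ⟨measurable_label, ?_⟩
  rw [← map_coe_labels, Measure.map_map measurable_label measurable_coeQ]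
  have : (label ∘ fun s : ℝ => (s : Q)) =ᵐ[labels] id := by
    filter_upwards [ae_restrict_mem measurableSet_Ioc] with s hs
    exact label_coe hs
  rw [Measure.map_congr this, Measure.map_id]

lemma setLIntegral_abs (f : ℝ → ℝ≥0∞) (τ : ℝ) :
    ∫⁻ t in Ioo (-τ) τ, f |t| = 2 * ∫⁻ t in Ioo 0 τ, f t := by
  have h1 : ∫⁻ t in Ioo (-τ) 0, f |t| = ∫⁻ t in Ioo 0 τ, f t := by
    have h2 := (Measure.measurePreserving_neg (volume : Measure ℝ)).setLIntegral_comp_preimage_emb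
      (MeasurableEquiv.neg ℝ).measurableEmbedding f (Ioo 0 τ)
    rw [← h2]
    have h3 : (Neg.neg ⁻¹' Ioo 0 τ : Set ℝ) = Ioo (-τ) 0 := by simp
    rw [h3]
    exact setLIntegral_congr_fun measurableSet_Ioo fun t ht => by rw [abs_of_neg ht.2]
  have h2 : ∫⁻ t in Ico 0 τ, f |t| = ∫⁻ t in Ioo 0 τ, f t := by
    rw [setLIntegral_congr Ioo_ae_eq_Ico.symm]
    exact setLIntegral_congr_fun measurableSet_Ioo fun t ht => by rw [abs_of_pos ht.1]
  rcases le_or_gt τ 0 with hτ | hτ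
  · simp [hτ]
  rw [two_mul]
  nth_rw 1 [← h1]
  rw [← h2, ← lintegral_union measurableSet_Ico (by
    rw [Set.disjoint_left]; intro t h1 h2; linarith [h1.2, h2.1])]
  rw [Ioo_union_Ico_eq_Ioo (by linarith) hτ.le]

lemma measurable_flowMap {g : ℝ × ℝ → ℝ} (hg : Measurable g) (τ t : ℝ) :
    Measurable (flowMap τ g t) := by
  unfold flowMap intervalIntegral
  refine measurable_id.sub (Measurable.sub ?_ ?_)
  · exact (StronglyMeasurable.integral_prod_left' hg.stronglyMeasurable).measurable
  · exact (StronglyMeasurable.integral_prod_left' hg.stronglyMeasurable).measurable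

/-- The moving end point of the integral is turned into an indicator function inside an integral
over the whole line, to which measurability of parameter integrals applies. Up to time τ the sign
convention of the interval integral plays no role. -/
lemma exists_measurable_uncurry_flowMap {g : ℝ × ℝ → ℝ} (hg : Measurable g) (τ : ℝ) :
    ∃ F : ℝ × ℝ → ℝ, Measurable F ∧ ∀ t ≤ τ, ∀ s, F (t, s) = flowMap τ g t s := by
  refine ⟨fun z => z.2 - ∫ r : ℝ, (if z.1 < r ∧ r ≤ τ then g (r, z.2) else 0 : ℝ), ?_,
    fun t ht s => ?_⟩
  · have hs : StronglyMeasurable (Function.uncurry fun (z : ℝ × ℝ) (r : ℝ) =>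
        (if z.1 < r ∧ r ≤ τ then g (r, z.2) else 0 : ℝ)) := by
      refine Measurable.stronglyMeasurable ?_
      refine Measurable.ite ?_
        (hg.comp (measurable_snd.prodMk (measurable_snd.comp measurable_fst))) measurable_const
      exact (measurableSet_lt (measurable_fst.comp measurable_fst) measurable_snd).inter
        (measurableSet_le measurable_snd measurable_const)
    have hs' : StronglyMeasurable fun z : ℝ × ℝ =>
        ∫ r : ℝ, (if z.1 < r ∧ r ≤ τ then g (r, z.2) else 0 : ℝ) :=
      StronglyMeasurable.integral_prod_right (ν := (volume : Measure ℝ)) hs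
    exact measurable_snd.sub hs'.measurable
  · unfold flowMap
    rw [intervalIntegral.integral_of_le ht, ← integral_indicator measurableSet_Ioc]
    refine congrArg (fun x : ℝ => s - x) (congrArg (fun f : ℝ → ℝ => ∫ r, f r) (funext fun r => ?_))
    simp [indicator, mem_Ioc]

/-! ### Laws of flows and the direct method -/

/-- The law of the particles of a flow at time `t`. -/
def flowLaw (τ : ℝ) (g : ℝ × ℝ → ℝ) (t : ℝ) : Measure Q :=
  labels.map fun s => (flowMap τ g t s : Q)

instance (τ : ℝ) (g : ℝ × ℝ → ℝ) (t : ℝ) : IsFiniteMeasure (flowLaw τ g t) := by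
  unfold flowLaw; infer_instance

lemma integral_flowLaw {g : ℝ × ℝ → ℝ} (hg : Measurable g) (τ t : ℝ) (ξ : C(Q, ℝ)) :
    ∫ x, ξ x ∂flowLaw τ g t = ∫ s, ξ (flowMap τ g t s : Q) ∂labels :=
  integral_map (measurable_coeQ.comp (measurable_flowMap hg τ t)).aemeasurable
    ξ.continuous.aestronglyMeasurable

lemma weakTendsto_flowLaw {g : ℕ → ℝ × ℝ → ℝ} {g' : ℝ × ℝ → ℝ} (hg : ∀ n, Measurable (g n))
    (hg' : Measurable g') {τ t : ℝ}
    (h : ∀ᵐ s ∂labels, Tendsto (fun n => flowMap τ (g n) t s) atTop (𝓝 (flowMap τ g' t s))) :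
    WeakTendsto atTop (fun n => flowLaw τ (g n) t) (flowLaw τ g' t) := by
  intro ξ
  simp_rw [integral_flowLaw (hg _), integral_flowLaw hg']
  refine tendsto_integral_of_dominated_convergence (fun _ => ‖ξ‖) (fun n => ?_)
    (integrable_const _) (fun n => Eventually.of_forall fun s => ξ.norm_coe_le_norm _) ?_
  · exact (ξ.continuous.measurable.comp
      (measurable_coeQ.comp (measurable_flowMap (hg n) τ t))).aestronglyMeasurable
  · filter_upwards [h] with s hs
    exact ((ξ.continuous.comp continuous_coeQ).tendsto _).comp hs

lemma aemeasurable_atomSum_flowLaw {g : ℝ × ℝ → ℝ} (hg : Measurable g) {T τ : ℝ} (hτ : T ≤ τ) :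
    AEMeasurable (fun t => atomSum (flowLaw τ g t)) (volume.restrict (Ioo 0 T)) := by
  obtain ⟨F, hF, hFg⟩ := exists_measurable_uncurry_flowMap hg τ
  have h1 : Measurable fun t : ℝ => ∫⁻ s, (labels {s' | (F (t, s') : Q) = F (t, s)})⁻¹ ∂labels := by
    have h2 : Measurable fun z : ℝ × ℝ => labels {s' | (F (z.1, s') : Q) = F (z.1, z.2)} := by
      have h3 : Measurable fun p : (ℝ × ℝ) × ℝ => (F (p.1.1, p.2) : Q) :=
        measurable_coeQ.comp (hF.comp ((measurable_fst.comp measurable_fst).prodMk measurable_snd))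
      have h4 : Measurable fun p : (ℝ × ℝ) × ℝ => (F (p.1.1, p.1.2) : Q) :=
        measurable_coeQ.comp (hF.comp measurable_fst)
      exact measurable_measure_prodMk_left (measurableSet_eq_fun h3 h4)
    exact h2.inv.lintegral_prod_right'
  refine h1.aemeasurable.congr ?_
  filter_upwards [ae_restrict_mem measurableSet_Ioo] with t ht
  have hm : Measurable fun s => (flowMap τ g t s : Q) :=
    measurable_coeQ.comp (measurable_flowMap hg τ t)
  unfold flowLaw
  rw [atomSum_map hm.aemeasurable]
  simp_rw [hFg t (ht.2.le.trans hτ)]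

/-- The perimeter of a flow in `(0, T)`. -/
def flowPerimeter (T τ : ℝ) (g : ℝ × ℝ → ℝ) : ℝ≥0∞ := ∫⁻ t in Ioo 0 T, atomSum (flowLaw τ g t)

/-- The direct method for monotone flows. -/
theorem exists_flow_limit {T τ : ℝ} (hτ : T ≤ τ) {K : ℕ → ℝ≥0∞} {g : ℕ → ℝ × ℝ → ℝ}
    (h : ∀ n, IsFlow τ (K n) (g n)) {C : ℕ → ℝ≥0∞} {C' : ℝ≥0∞}
    (hC : ∀ n, flowPerimeter T τ (g n) + K n ≤ C n) (hCt : Tendsto C atTop (𝓝 C')) (hC' : C' ≠ ⊤) :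
    ∃ φ : ℕ → ℕ, StrictMono φ ∧ ∃ K' g', K' ≠ ⊤ ∧ IsFlow τ K' g' ∧
      flowPerimeter T τ g' + K' ≤ C' ∧
      ∀ t ∈ Icc 0 τ, WeakTendsto atTop (fun n => flowLaw τ (g (φ n)) t) (flowLaw τ g' t) := by
  -- Only the sum of perimeter and energy is controlled. By compactness of the extended half-line
  -- the two converge separately along a subsequence, so that each limit can be treated by its own
  -- semicontinuity.
  obtain ⟨⟨P', K'⟩, φ, hφ, hφt⟩ :=
    CompactSpace.tendsto_subseq fun n => (flowPerimeter T τ (g n), K n)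
  have hPt : Tendsto (fun n => flowPerimeter T τ (g (φ n))) atTop (𝓝 P') :=
    (continuous_fst.tendsto _).comp hφt
  have hKt : Tendsto (fun n => K (φ n)) atTop (𝓝 K') := (continuous_snd.tendsto _).comp hφt
  have hPK : P' + K' ≤ C' := le_of_tendsto_of_tendsto' (hPt.add hKt)
    (hCt.comp hφ.tendsto_atTop) fun n => hC (φ n)
  have hK' : K' ≠ ⊤ := ne_top_of_le_ne_top hC' (le_add_self.trans hPK)
  obtain ⟨ψ, hψ, g', hg', hconv⟩ := IsFlow.exists_limit (fun n => h (φ n)) hKt hK'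
  have hweak : ∀ t ∈ Icc 0 τ,
      WeakTendsto atTop (fun n => flowLaw τ (g (φ (ψ n))) t) (flowLaw τ g' t) := fun t ht =>
    weakTendsto_flowLaw (fun n => (h _).measurable) hg'.measurable (hconv t ht)
  refine ⟨φ ∘ ψ, hφ.comp hψ, K', g', hK', hg', ?_, hweak⟩
  refine (add_le_add ?_ le_rfl).trans hPK
  -- Lower semicontinuity at each time, then Fatou's lemma.
  have h1 : flowPerimeter T τ g' ≤
      ∫⁻ t in Ioo 0 T, liminf (fun n => atomSum (flowLaw τ (g (φ (ψ n))) t)) atTop := by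
    unfold flowPerimeter
    refine setLIntegral_mono_ae' measurableSet_Ioo (Eventually.of_forall fun t ht => ?_)
    exact (hweak t ⟨ht.1.le, ht.2.le.trans hτ⟩).atomSum_le_liminf
  refine h1.trans ((lintegral_liminf_le' fun n =>
    aemeasurable_atomSum_flowLaw (h _).measurable hτ).trans ?_)
  exact (hPt.comp hψ.tendsto_atTop).liminf_eq.le

/-! ### The curve family of a flow -/

/-- A path run backwards and then forwards has the odd extension of its velocity. Writing it as one
integral from -τ makes absolute continuity across time 0 automatic. -/
lemma flowMap_abs_eq {f : ℝ → ℝ} {τ : ℝ} (hf : IntervalIntegrable f volume 0 τ) {t : ℝ}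
    (ht : t ∈ Icc (-τ) τ) :
    IntervalIntegrable (fun r => if 0 < r then f |r| else -f |r|) volume (-τ) τ ∧
      ∫ r in (-τ)..t, (if 0 < r then f |r| else -f |r|) = -∫ r in |t|..τ, f r := by
  have hτ : 0 ≤ τ := by linarith [ht.1, ht.2]
  set k : ℝ → ℝ := fun r => if 0 < r then f |r| else -f |r| with hk
  have hneg : EqOn (fun r => -f (-r)) k (Ioc (-τ) 0) := by
    intro r hr
    simp [hk, not_lt.2 hr.2, abs_of_nonpos hr.2]
  have hpos : EqOn f k (Ioc 0 τ) := by
    intro r hr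
    simp [hk, hr.1, abs_of_pos hr.1]
  have hf' : IntervalIntegrable (fun r => -f (-r)) volume (-τ) 0 := by
    have := hf.comp_sub_left 0
    simp only [zero_sub, sub_zero] at this
    exact this.symm.neg
  have hint1 : IntervalIntegrable k volume (-τ) 0 :=
    hf'.congr (by rw [uIoc_of_le (by linarith)]; exact fun r hr => hneg hr)
  have hint2 : IntervalIntegrable k volume 0 τ :=
    hf.congr (by rw [uIoc_of_le hτ]; exact fun r hr => hpos hr)
  refine ⟨hint1.trans hint2, ?_⟩
  have hnegint : ∀ u ∈ Icc (-τ) 0, ∫ r in (-τ)..u, k r = -∫ r in (-u)..τ, f r := by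
    intro u hu
    have h1 : ∫ r in (-τ)..u, k r = ∫ r in (-τ)..u, -f (-r) := by
      refine intervalIntegral.integral_congr_ae (Eventually.of_forall fun r hr => ?_)
      rw [uIoc_of_le hu.1] at hr
      exact (hneg ⟨hr.1, hr.2.trans hu.2⟩).symm
    rw [h1, intervalIntegral.integral_neg, intervalIntegral.integral_comp_neg, neg_neg]
  rcases le_total t 0 with h0 | h0
  · rw [abs_of_nonpos h0]
    exact hnegint t ⟨ht.1, h0⟩
  · rw [abs_of_nonneg h0]
    have hi0t : IntervalIntegrable f volume 0 t := hf.mono_set (by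
      rw [uIcc_of_le h0, uIcc_of_le hτ]; exact Icc_subset_Icc le_rfl ht.2)
    have hitτ : IntervalIntegrable f volume t τ := hf.mono_set (by
      rw [uIcc_of_le ht.2, uIcc_of_le hτ]; exact Icc_subset_Icc h0 le_rfl)
    have h1 : ∫ r in (0 : ℝ)..t, k r = ∫ r in (0 : ℝ)..t, f r := by
      refine intervalIntegral.integral_congr_ae (Eventually.of_forall fun r hr => ?_)
      rw [uIoc_of_le h0] at hr
      exact (hpos ⟨hr.1, hr.2.trans ht.2⟩).symm
    have hk0t : IntervalIntegrable k volume 0 t := hint2.mono_set (by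
      rw [uIcc_of_le h0, uIcc_of_le hτ]; exact Icc_subset_Icc le_rfl ht.2)
    rw [← intervalIntegral.integral_add_adjacent_intervals hint1 hk0t,
      hnegint 0 ⟨by linarith, le_rfl⟩, h1, neg_zero,
      ← intervalIntegral.integral_add_adjacent_intervals hi0t hitτ]
    ring

/-- The symmetric family of curves of a flow. -/
def flowFamily (τ : ℝ) (g : ℝ × ℝ → ℝ) (t : ℝ) (q : Q) : Q := (flowMap τ g |t| (label q) : Q)

lemma map_flowFamily {τ : ℝ} {g : ℝ × ℝ → ℝ} (hg : Measurable g) (t : ℝ) :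
    (volume : Measure Q).map (flowFamily τ g t) = flowLaw τ g |t| := by
  have hm : Measurable fun s => (flowMap τ g |t| s : Q) :=
    measurable_coeQ.comp (measurable_flowMap hg τ _)
  unfold flowLaw
  rw [← measurePreserving_label.map_eq, Measure.map_map hm measurable_label]
  rfl

lemma ae_intervalIntegrable {τ : ℝ} (hτ : 0 ≤ τ) {g : ℝ × ℝ → ℝ}
    (hg : Integrable g (flowMeasure τ)) :
    ∀ᵐ s ∂labels, IntervalIntegrable (fun r => g (r, s)) volume 0 τ := by
  filter_upwards [hg.prod_left_ae] with s hs
  exact (intervalIntegrable_iff_integrableOn_Ioc_of_le hτ).2 hs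

lemma absolutelyContinuous_flowMap_abs {τ : ℝ} (hτ : 0 ≤ τ) {g : ℝ × ℝ → ℝ} {s : ℝ}
    (hg : IntervalIntegrable (fun r => g (r, s)) volume 0 τ) :
    AbsolutelyContinuousOnInterval (fun t => flowMap τ g |t| s) (-τ) τ ∧
      ∀ᵐ t ∂volume.restrict (Ioo (-τ) τ), ‖deriv (fun t => flowMap τ g |t| s) t‖ₑ = ‖g (|t|, s)‖ₑ := by
  set k : ℝ → ℝ := fun r => if 0 < r then g (|r|, s) else -g (|r|, s) with hk
  have hle : -τ ≤ τ := by linarith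
  have hmem : -τ ∈ Icc (-τ) τ := ⟨le_rfl, hle⟩
  have hkint : IntervalIntegrable k volume (-τ) τ := (flowMap_abs_eq hg hmem).1
  have hac := hkint.absolutelyContinuousOnInterval_intervalIntegral (c := -τ) (by simp)
  have heq : ∀ t ∈ Icc (-τ) τ, flowMap τ g |t| s = s + ∫ r in (-τ)..t, k r := by
    intro t ht
    rw [hk, (flowMap_abs_eq hg ht).2]
    rfl
  constructor
  · refine AbsolutelyContinuousOnInterval.of_dist_le hac (C := 1) fun t ht u hu => ?_
    rw [uIcc_of_le hle] at ht hu
    rw [heq t ht, heq u hu, dist_add_left, one_mul]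
    exact le_add_of_nonneg_left dist_nonneg
  · filter_upwards [ae_restrict_of_ae hkint.ae_hasDerivAt_integral,
      ae_restrict_mem measurableSet_Ioo] with t ht htm
    have htm' := Ioo_subset_Icc_self htm
    have h1 := (ht (by rwa [uIcc_of_le hle]) (-τ) (by simp)).const_add s
    have h2 : (fun t => flowMap τ g |t| s) =ᶠ[𝓝 t] fun t => s + ∫ r in (-τ)..t, k r := by
      filter_upwards [Ioo_mem_nhds htm.1 htm.2] with u hu using heq u (Ioo_subset_Icc_self hu)
    rw [h2.deriv_eq, h1.deriv, hk]
    dsimp only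
    split_ifs
    · rfl
    · rw [enorm_neg]

theorem IsFlow.isCurveFamily {τ : ℝ} (hτ : 0 < τ) {K : ℝ≥0∞} {g : ℝ × ℝ → ℝ} (h : IsFlow τ K g)
    (hK : K ≠ ⊤) : IsCurveFamily τ (flowFamily τ g) := by
  have hfin : ∀ x, flowFamily τ g τ x = x := by
    intro x
    simp [flowFamily, flowMap, abs_of_pos hτ]
  refine ⟨fun t _ => ?_, fun x => ?_, hfin, ?_⟩
  · exact (measurable_coeQ.comp ((measurable_flowMap h.measurable τ _).comp
      measurable_label)).aemeasurable
  · have : flowFamily τ g (-τ) x = flowFamily τ g τ x := by simp [flowFamily]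
    rw [this, hfin]
  · have h1 := measurePreserving_label.quasiMeasurePreserving.ae
      (ae_intervalIntegrable hτ.le (h.integrable hK))
    filter_upwards [h1] with x hx
    refine AbsolutelyContinuousOnInterval.of_dist_le
      (absolutelyContinuous_flowMap_abs hτ.le hx).1 (C := 1) fun s _ t _ => ?_
    rw [one_mul]
    refine le_trans ?_ (le_add_of_nonneg_left dist_nonneg)
    unfold flowFamily
    rw [dist_eq_norm, ← AddCircle.coe_sub]
    exact norm_coe_le_abs _

lemma IsFlow.kinetic_le {τ : ℝ} (hτ : 0 < τ) {K : ℝ≥0∞} {g : ℝ × ℝ → ℝ} (h : IsFlow τ K g)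
    (hK : K ≠ ⊤) : kinetic τ (flowFamily τ g) ≤ 2 * K := by
  have h1 : ∀ᵐ s ∂labels, ∫⁻ t in Ioo (-τ) τ,
      ‖circleDeriv (fun t => (flowMap τ g |t| s : Q)) t‖ₑ ^ 2 =
      2 * ∫⁻ t in Ioc 0 τ, ‖g (t, s)‖ₑ ^ 2 := by
    filter_upwards [ae_intervalIntegrable hτ.le (h.integrable hK)] with s hs
    obtain ⟨hac, hd⟩ := absolutelyContinuous_flowMap_abs hτ.le hs
    rw [setLIntegral_congr Ioo_ae_eq_Ioc.symm, ← setLIntegral_abs (fun t => ‖g (t, s)‖ₑ ^ 2)]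
    refine lintegral_congr_ae ?_
    filter_upwards [hd, ae_restrict_mem measurableSet_Ioo] with t ht htm
    have hc := hac.continuousOn
    rw [uIcc_of_le (by linarith)] at hc
    rw [circleDeriv_coe (hc.continuousAt (Icc_mem_nhds htm.1 htm.2)) EventuallyEq.rfl, ht]
  have h2 := measurePreserving_label.quasiMeasurePreserving.ae h1
  have hm : Measurable fun p : ℝ × ℝ => ‖g (p.2, p.1)‖ₑ ^ 2 :=
    (h.measurable.comp measurable_swap).enorm.pow_const 2
  calc kinetic τ (flowFamily τ g)
      = ∫⁻ x : Q, 2 * ∫⁻ t in Ioc 0 τ, ‖g (t, label x)‖ₑ ^ 2 := lintegral_congr_ae h2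
    _ = ∫⁻ s, 2 * (∫⁻ t in Ioc 0 τ, ‖g (t, s)‖ₑ ^ 2) ∂labels :=
        measurePreserving_label.lintegral_comp (hm.lintegral_prod_right'.const_mul 2)
    _ = 2 * ∫⁻ s, (∫⁻ t in Ioc 0 τ, ‖g (t, s)‖ₑ ^ 2) ∂labels :=
        lintegral_const_mul _ hm.lintegral_prod_right'
    _ ≤ 2 * K := by
        gcongr
        refine le_trans (le_of_eq ?_) h.energy
        exact (lintegral_prod_symm _ (h.measurable.enorm.pow_const 2).aemeasurable).symm

/-- Every label follows its path twice, with opposite orientation, and the law at time t is the law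
of the flow at |t|. Hence both parts of the cost double. -/
theorem IsFlow.lagrangian_le {T lam : ℝ} (hT : 0 < T) (hlam : 0 < lam) {K : ℝ≥0∞}
    {g : ℝ × ℝ → ℝ} (h : IsFlow (extendedTime lam T) K g) (hK : K ≠ ⊤) :
    lagrangian lam T (flowFamily (extendedTime lam T) g) ≤
      2 * (flowPerimeter T (extendedTime lam T) g + K) := by
  have hτ : 0 < extendedTime lam T := by unfold extendedTime; positivity
  rw [(h.isCurveFamily hτ hK).lagrangian_eq hT hlam, mul_add]
  refine add_le_add (le_of_eq ?_) (h.kinetic_le hτ hK)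
  simp_rw [map_flowFamily h.measurable]
  exact setLIntegral_abs (fun t => atomSum (flowLaw (extendedTime lam T) g t)) T

/-! ### Mollifiers in time and space -/

/-- A smooth step from `0` to `1` just right of the origin. -/
def timeStep (n : ℕ) (u : ℝ) : ℝ := Real.smoothTransition ((n + 3) * u - 1)

/-- A smooth approximate identity on the line, supported in `(0, 1)`. -/
def timeKernel (n : ℕ) : ℝ → ℝ := deriv (timeStep n)

lemma contDiff_timeStep (n : ℕ) : ContDiff ℝ ∞ (timeStep n) :=
  Real.smoothTransition.contDiff.comp ((contDiff_const.mul contDiff_id).sub contDiff_const)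

lemma hasDerivAt_timeStep (n : ℕ) (u : ℝ) : HasDerivAt (timeStep n) (timeKernel n u) u :=
  ((contDiff_timeStep n).differentiable (by simp) u).hasDerivAt

lemma timeStep_eq_zero {n : ℕ} {u : ℝ} (hu : (n + 3) * u ≤ 1) : timeStep n u = 0 :=
  Real.smoothTransition.zero_of_nonpos (by linarith)

lemma timeStep_eq_one {n : ℕ} {u : ℝ} (hu : 2 ≤ (n + 3) * u) : timeStep n u = 1 :=
  Real.smoothTransition.one_of_one_le (by linarith)

lemma monotone_timeStep (n : ℕ) : Monotone (timeStep n) := by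
  intro u v huv
  refine Real.smoothTransition.monotone ?_
  gcongr

lemma timeKernel_nonneg (n : ℕ) (u : ℝ) : 0 ≤ timeKernel n u := (monotone_timeStep n).deriv_nonneg

lemma continuous_timeKernel (n : ℕ) : Continuous (timeKernel n) :=
  (contDiff_timeStep n).continuous_deriv (by simp)

lemma timeKernel_eq_zero_of_lt {n : ℕ} {u : ℝ} (hu : (n + 3) * u < 1) : timeKernel n u = 0 := by
  have h : timeStep n =ᶠ[𝓝 u] fun _ => 0 := by
    have : ∀ᶠ v in 𝓝 u, ((n : ℝ) + 3) * v < 1 :=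
      (Continuous.tendsto (by fun_prop) u).eventually (gt_mem_nhds hu)
    filter_upwards [this] with v hv using timeStep_eq_zero hv.le
  rw [timeKernel, h.deriv_eq, deriv_const]

lemma timeKernel_eq_zero_of_gt {n : ℕ} {u : ℝ} (hu : 2 < (n + 3) * u) : timeKernel n u = 0 := by
  have h : timeStep n =ᶠ[𝓝 u] fun _ => 1 := by
    have : ∀ᶠ v in 𝓝 u, 2 < ((n : ℝ) + 3) * v :=
      (Continuous.tendsto (by fun_prop) u).eventually (lt_mem_nhds hu)
    filter_upwards [this] with v hv using timeStep_eq_one hv.le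
  rw [timeKernel, h.deriv_eq, deriv_const]

lemma timeKernel_eq_zero_of_nonpos {n : ℕ} {u : ℝ} (hu : u ≤ 0) : timeKernel n u = 0 :=
  timeKernel_eq_zero_of_lt (lt_of_le_of_lt (mul_nonpos_of_nonneg_of_nonpos (by positivity) hu)
    one_pos)

/-- The kernel lives between 1/(n+3) and 2/(n+3), and the 3 makes the latter less than 1. Being
supported at positive arguments, it averages over the future only: it needs no data before time 0,
and less than one unit of time after τ. -/
lemma timeKernel_eq_zero_of_one_le {n : ℕ} {u : ℝ} (hu : 1 ≤ u) : timeKernel n u = 0 := by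
  refine timeKernel_eq_zero_of_gt ?_
  have : (0 : ℝ) ≤ n := n.cast_nonneg
  nlinarith

lemma hasCompactSupport_timeKernel (n : ℕ) : HasCompactSupport (timeKernel n) :=
  HasCompactSupport.of_support_subset_isCompact (isCompact_Icc (a := (0 : ℝ)) (b := 1)) fun _ hu =>
    ⟨le_of_not_ge fun h => hu (timeKernel_eq_zero_of_nonpos h),
      le_of_not_ge fun h => hu (timeKernel_eq_zero_of_one_le h)⟩

lemma integrable_timeKernel (n : ℕ) : Integrable (timeKernel n) :=
  (continuous_timeKernel n).integrable_of_hasCompactSupport (hasCompactSupport_timeKernel n)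

lemma integral_timeKernel (n : ℕ) : ∫ u, timeKernel n u = 1 := by
  have h : Function.support (timeKernel n) ⊆ Ioc 0 1 := fun u hu =>
    ⟨lt_of_not_ge fun h => hu (timeKernel_eq_zero_of_nonpos h),
      le_of_not_ge fun h => hu (timeKernel_eq_zero_of_one_le h)⟩
  rw [← intervalIntegral.integral_eq_integral_of_support_subset h,
    intervalIntegral.integral_eq_sub_of_hasDerivAt (fun u _ => hasDerivAt_timeStep n u)
      ((continuous_timeKernel n).intervalIntegrable _ _),
    timeStep_eq_one (by have : (0 : ℝ) ≤ n := n.cast_nonneg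
                        linarith), timeStep_eq_zero (by simp), sub_zero]

lemma integral_timeKernel_sub (n : ℕ) (r : ℝ) : ∫ t, timeKernel n (r - t) = 1 := by
  rw [integral_sub_left_eq_self (timeKernel n) volume r, integral_timeKernel]

lemma tendsto_integral_mul_timeKernel {α : ℝ → ℝ} (hα : Continuous α) (r : ℝ) :
    Tendsto (fun n => ∫ t, α t * timeKernel n (r - t)) atTop (𝓝 (α r)) := by
  have h := convolution_tendsto_right (μ := (volume : Measure ℝ)) (φ := timeKernel)
    (g := fun _ => α) (k := fun _ => r) (x₀ := r) (z₀ := α r) (l := atTop)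
    (Eventually.of_forall fun n => timeKernel_nonneg n)
    (Eventually.of_forall integral_timeKernel) ?_
    (Eventually.of_forall fun _ => hα.aestronglyMeasurable)
    ((hα.tendsto r).comp tendsto_snd) tendsto_const_nhds
  · refine h.congr fun n => ?_
    rw [convolution_lsmul_swap]
    simp [mul_comm]
  · rw [tendsto_smallSets_iff]
    intro U hU
    obtain ⟨ε, hε, hεU⟩ := Metric.mem_nhds_iff.1 hU
    have h1 : Tendsto (fun n : ℕ => ((n : ℝ) + 3) * ε) atTop atTop :=
      (tendsto_atTop_add_const_right _ _ tendsto_natCast_atTop_atTop).atTop_mul_const hε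
    filter_upwards [h1.eventually_gt_atTop 2] with n hn u hu
    refine hεU ?_
    have hu0 : 0 < u := lt_of_not_ge fun h => hu (timeKernel_eq_zero_of_nonpos h)
    rw [Metric.mem_ball, dist_zero_right, Real.norm_eq_abs, abs_of_pos hu0]
    by_contra hc
    refine hu (timeKernel_eq_zero_of_gt (hn.trans_le ?_))
    gcongr
    exact not_lt.1 hc

lemma support_timeStep_sub_subset {n : ℕ} {t τ : ℝ} (h : t ≤ τ) :
    Function.support (fun r => timeStep n (r - t) - timeStep n (r - τ)) ⊆
      Icc (t + 1 / (n + 3)) (τ + 2 / (n + 3)) := by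
  have hn : (0 : ℝ) < n + 3 := by positivity
  intro r hr
  by_contra hc
  refine hr ?_
  dsimp only
  rcases not_and_or.1 hc with hc | hc
  · have h1 : (n + 3) * (r - t) ≤ 1 := by
      have := (lt_div_iff₀ hn).1 (show r - t < 1 / (n + 3) by linarith)
      linarith
    have h2 : ((n : ℝ) + 3) * (r - τ) ≤ (n + 3) * (r - t) := by gcongr
    rw [timeStep_eq_zero h1, timeStep_eq_zero (h2.trans h1), sub_zero]
  · have h1 : 2 ≤ (n + 3) * (r - τ) := by
      have := (div_lt_iff₀ hn).1 (show 2 / (n + 3) < r - τ by linarith)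
      linarith
    have h2 : ((n : ℝ) + 3) * (r - τ) ≤ (n + 3) * (r - t) := by gcongr
    rw [timeStep_eq_one h1, timeStep_eq_one (h1.trans h2), sub_self]

/-- The profile of the mollifier in space. -/
def profile (x : Q) : ℝ := 2 + (expQ x).re

lemma continuous_profile : Continuous profile :=
  continuous_const.add (Complex.continuous_re.comp continuous_expQ)

lemma one_le_profile (x : Q) : 1 ≤ profile x := by
  have h := neg_le_of_abs_le ((Complex.abs_re_le_norm (expQ x)).trans (norm_expQ x).le)
  unfold profile
  linarith

lemma profile_lt {x : Q} (hx : x ≠ 0) : profile x < profile 0 := by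
  have h1 := (Complex.abs_re_le_norm (expQ x)).trans (norm_expQ x).le
  have h0 : expQ 0 = 1 := by simp [expQ]
  have hne : (expQ x).re ≠ 1 := by
    intro hre
    have h2 := Complex.sq_norm (expQ x)
    rw [norm_expQ, Complex.normSq_apply, hre] at h2
    have him : (expQ x).im = 0 := by nlinarith
    have h3 : expQ x = 1 := Complex.ext (by simp [hre]) (by simp [him])
    refine hx (AddCircle.injective_toCircle (T := 1) one_ne_zero ?_)
    refine Subtype.ext ?_
    change expQ x = expQ 0
    rw [h3, h0]
  unfold profile
  rw [h0, Complex.one_re]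
  have := lt_of_le_of_ne (le_of_abs_le h1) hne
  linarith

lemma contDiff_profile : ContDiff ℝ ∞ fun x : ℝ => profile x := by
  have : (fun x : ℝ => profile x) =
      fun x : ℝ => 2 + (Complex.exp (2 * Real.pi * x * Complex.I)).re := by
    funext x; rw [profile, expQ_coe]
  rw [this]
  refine contDiff_const.add (Complex.reCLM.contDiff.comp ?_)
  refine Complex.contDiff_exp.comp ?_
  exact (contDiff_const.mul Complex.ofRealCLM.contDiff).mul contDiff_const

/-- A smooth positive approximate identity on the torus. -/
def spaceKernel (n : ℕ) (x : Q) : ℝ := (∫ y, profile y ^ n)⁻¹ * profile x ^ n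

lemma continuous_spaceKernel (n : ℕ) : Continuous (spaceKernel n) :=
  continuous_const.mul (continuous_profile.pow n)

lemma integrable_of_continuous {f : Q → ℝ} (hf : Continuous f) : Integrable f :=
  hf.integrable_of_hasCompactSupport (HasCompactSupport.of_compactSpace f)

lemma integral_profile_pow_pos (n : ℕ) : 0 < ∫ y, profile y ^ n := by
  have h : ∫ _ : Q, (1 : ℝ) ≤ ∫ y, profile y ^ n :=
    integral_mono (integrable_const _) (integrable_of_continuous (continuous_profile.pow n))
      fun y => one_le_pow₀ (one_le_profile y)
  rw [integral_const, Measure.real, UnitAddCircle.measure_univ] at h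
  simp only [ENNReal.toReal_one, smul_eq_mul, mul_one] at h
  linarith

lemma spaceKernel_pos (n : ℕ) (x : Q) : 0 < spaceKernel n x :=
  mul_pos (inv_pos.2 (integral_profile_pow_pos n))
    (pow_pos (one_pos.trans_le (one_le_profile x)) n)

lemma integral_spaceKernel (n : ℕ) : ∫ x, spaceKernel n x = 1 := by
  unfold spaceKernel
  rw [integral_const_mul, inv_mul_cancel₀ (integral_profile_pow_pos n).ne']

lemma contDiff_spaceKernel (n : ℕ) : ContDiff ℝ ∞ fun x : ℝ => spaceKernel n x :=
  contDiff_const.mul (contDiff_profile.pow n)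

lemma integral_spaceKernel_sub (n : ℕ) (y : Q) : ∫ x, spaceKernel n (x - y) = 1 := by
  rw [integral_sub_right_eq_self, integral_spaceKernel]

/-- Normalized powers of a function concentrate at its unique maximum. Kernels of this kind are
positive on the whole circle, which later makes the mollified densities positive everywhere. -/
lemma tendsto_integral_mul_spaceKernel {ξ : Q → ℝ} (hξ : Continuous ξ) (y : Q) :
    Tendsto (fun n => ∫ x, ξ x * spaceKernel n (x - y)) atTop (𝓝 (ξ y)) := by
  have h := tendsto_setIntegral_pow_smul_of_unique_maximum_of_isCompact_of_continuousOn
    (μ := (volume : Measure Q)) (s := univ) (x₀ := 0) (c := profile) (g := fun x => ξ (x + y))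
    isCompact_univ continuous_profile.continuousOn (fun x _ hx => profile_lt hx)
    (fun x _ => zero_le_one.trans (one_le_profile x)) (one_pos.trans_le (one_le_profile 0))
    (by simp) (by fun_prop)
  simp only [zero_add, Measure.restrict_univ] at h
  refine h.congr fun n => ?_
  rw [← integral_sub_right_eq_self (fun x => profile x ^ n • ξ (x + y)) y, smul_eq_mul,
    ← integral_const_mul]
  refine integral_congr_ae (Eventually.of_forall fun x => ?_)
  simp [spaceKernel]
  ring

lemma exists_spaceKernel_bound (n : ℕ) : ∃ C, ∀ x, ‖spaceKernel n x‖ ≤ C := by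
  obtain ⟨C, hC⟩ := isCompact_univ.exists_bound_of_continuousOn
    (continuous_spaceKernel n).continuousOn
  exact ⟨C, fun x => hC x (mem_univ x)⟩

lemma exists_timeKernel_bound (n : ℕ) : ∃ C, ∀ x, ‖timeKernel n x‖ ≤ C :=
  (continuous_timeKernel n).bounded_above_of_compact_support (hasCompactSupport_timeKernel n)

/-- The mass that the mollifier around `y` gives to `[a, b]`. -/
def spaceStep (n : ℕ) (a b : ℝ) (y : Q) : ℝ := ∫ z in a..b, spaceKernel n (z - y)

lemma continuous_spaceKernel_coe (n : ℕ) : Continuous fun x : ℝ => spaceKernel n x :=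
  (continuous_spaceKernel n).comp continuous_coeQ

lemma spaceStep_coe (n : ℕ) (a b u : ℝ) :
    spaceStep n a b u = (∫ z in (0 : ℝ)..(b - u), spaceKernel n z) -
      ∫ z in (0 : ℝ)..(a - u), spaceKernel n z := by
  have h := intervalIntegral.integral_comp_sub_right (fun x : ℝ => spaceKernel n x) u (a := a)
    (b := b)
  have hi := fun c d => (continuous_spaceKernel_coe n).intervalIntegrable (μ := volume) c d
  rw [intervalIntegral.integral_interval_sub_left (hi _ _) (hi _ _), ← h]
  simp [spaceStep]

lemma hasDerivAt_primitive_spaceKernel (n : ℕ) (x : ℝ) :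
    HasDerivAt (fun x => ∫ z in (0 : ℝ)..x, spaceKernel n z) (spaceKernel n x) x :=
  (continuous_spaceKernel_coe n).integral_hasStrictDerivAt 0 x |>.hasDerivAt

/-- The mass in a window changes only through its two ends. This turns the continuity equation,
tested with a window, into a balance of boundary fluxes. -/
lemma hasDerivAt_spaceStep (n : ℕ) (a b u : ℝ) :
    HasDerivAt (fun u : ℝ => spaceStep n a b u)
      (spaceKernel n ((a : Q) - u) - spaceKernel n ((b : Q) - u)) u := by
  have h1 := (hasDerivAt_primitive_spaceKernel n (b - u)).comp u ((hasDerivAt_id u).const_sub b)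
  have h2 := (hasDerivAt_primitive_spaceKernel n (a - u)).comp u ((hasDerivAt_id u).const_sub a)
  have h3 := h1.sub h2
  have heq : (fun u : ℝ => spaceStep n a b u) =
    ((fun x => ∫ z in (0 : ℝ)..x, spaceKernel n z) ∘ fun u => b - u) -
    ((fun x => ∫ z in (0 : ℝ)..x, spaceKernel n z) ∘ fun u => a - u) := by
    funext v; simp [spaceStep_coe]
  rw [heq]
  refine h3.congr_deriv ?_
  rw [AddCircle.coe_sub, AddCircle.coe_sub]
  ring

lemma contDiff_spaceStep (n : ℕ) (a b : ℝ) : ContDiff ℝ ∞ fun u : ℝ => spaceStep n a b u := by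
  rw [contDiff_infty_iff_deriv]
  refine ⟨fun u => (hasDerivAt_spaceStep n a b u).differentiableAt, ?_⟩
  have : deriv (fun u : ℝ => spaceStep n a b u) =
      fun u : ℝ => spaceKernel n ((a - u : ℝ) : Q) - spaceKernel n ((b - u : ℝ) : Q) := by
    funext u; rw [(hasDerivAt_spaceStep n a b u).deriv]; simp
  rw [this]
  exact ((contDiff_spaceKernel n).comp (contDiff_const.sub contDiff_id)).sub
    ((contDiff_spaceKernel n).comp (contDiff_const.sub contDiff_id))

lemma spaceStep_add_one (n : ℕ) (a : ℝ) (y : Q) : spaceStep n a (a + 1) y = 1 := by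
  unfold spaceStep
  rw [UnitAddCircle.intervalIntegral_preimage a fun z => spaceKernel n (z - y),
    integral_spaceKernel_sub]

lemma continuous_spaceStep (n : ℕ) (a b : ℝ) : Continuous (spaceStep n a b) :=
  intervalIntegral.continuous_parametric_intervalIntegral_of_continuous'
    (by
      have := continuous_spaceKernel n
      have := continuous_coeQ
      fun_prop) a b

/-! ### The monotone flow of a smooth density -/

/-- `F t` is the distribution function of the smooth positive density `ρ (t, ·)`, normalized by
the flux `m` and by the final condition `F τ x = x`. -/
structure IsSmoothDensity (τ : ℝ) (ρ m : ℝ × ℝ → ℝ) (F : ℝ → ℝ → ℝ) : Prop where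
  continuous_density : Continuous ρ
  continuous_flux : Continuous m
  continuous : Continuous (Function.uncurry F)
  pos : ∀ z, 0 < ρ z
  density_periodic : ∀ t x, ρ (t, x + 1) = ρ (t, x)
  flux_periodic : ∀ t x, m (t, x + 1) = m (t, x)
  sub_eq : ∀ t a b, F t b - F t a = ∫ x in a..b, ρ (t, x)
  add_one : ∀ t x, F t (x + 1) = F t x + 1
  hasDerivAt : ∀ t ∈ Ioo 0 τ, ∀ x, HasDerivAt (fun t => F t x) (-m (t, x)) t
  final : ∀ x, F τ x = x

namespace IsSmoothDensity

variable {τ : ℝ} {ρ m : ℝ × ℝ → ℝ} {F : ℝ → ℝ → ℝ}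

lemma continuous_slice (h : IsSmoothDensity τ ρ m F) (t : ℝ) : Continuous fun x => ρ (t, x) :=
  h.continuous_density.comp (by fun_prop)

lemma hasDerivAt_space (h : IsSmoothDensity τ ρ m F) (t x : ℝ) : HasDerivAt (F t) (ρ (t, x)) x := by
  have heq : F t = fun x => F t 0 + ∫ y in (0 : ℝ)..x, ρ (t, y) := by
    funext x; rw [← h.sub_eq]; ring
  rw [heq]
  exact ((h.continuous_slice t).integral_hasStrictDerivAt 0 x).hasDerivAt.const_add _

lemma strictMono (h : IsSmoothDensity τ ρ m F) (t : ℝ) : StrictMono (F t) :=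
  strictMono_of_deriv_pos fun x => by rw [(h.hasDerivAt_space t x).deriv]; exact h.pos _

/-- The distribution function gains 1 per period, so it is unbounded in both directions. -/
lemma surjective (h : IsSmoothDensity τ ρ m F) (t : ℝ) : Function.Surjective (F t) := by
  have hn : ∀ n : ℕ, ∀ x, F t (x + n) = F t x + n := by
    intro n x
    induction n with
    | zero => simp
    | succ n ih => rw [Nat.cast_succ, ← add_assoc, h.add_one, ih, add_assoc]
  have hc : Continuous (F t) := h.continuous.comp (by fun_prop : Continuous fun x : ℝ => (t, x))
  refine hc.surjective ?_ ?_
  · refine tendsto_atTop_atTop_of_monotone (h.strictMono t).monotone fun b => ?_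
    obtain ⟨n, hn'⟩ := exists_nat_ge (b - F t 0)
    exact ⟨0 + n, by rw [hn]; linarith⟩
  · refine tendsto_atBot_atBot_of_monotone (h.strictMono t).monotone fun b => ?_
    obtain ⟨n, hn'⟩ := exists_nat_ge (F t 0 - b)
    refine ⟨-n, ?_⟩
    have := hn n (-n)
    rw [neg_add_cancel] at this
    linarith

/-- The quantile function of the density. -/
def quantile (h : IsSmoothDensity τ ρ m F) (t s : ℝ) : ℝ := (h.surjective t s).choose

lemma apply_quantile (h : IsSmoothDensity τ ρ m F) (t s : ℝ) : F t (h.quantile t s) = s :=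
  (h.surjective t s).choose_spec

lemma quantile_apply (h : IsSmoothDensity τ ρ m F) (t x : ℝ) : h.quantile t (F t x) = x :=
  (h.strictMono t).injective (h.apply_quantile t _)

lemma monotone_quantile (h : IsSmoothDensity τ ρ m F) (t : ℝ) : Monotone (h.quantile t) := by
  intro s s' hs
  rw [← (h.strictMono t).le_iff_le, h.apply_quantile, h.apply_quantile]
  exact hs

lemma quantile_add_one (h : IsSmoothDensity τ ρ m F) (t s : ℝ) :
    h.quantile t (s + 1) = h.quantile t s + 1 :=
  (h.strictMono t).injective (by rw [h.apply_quantile, h.add_one, h.apply_quantile])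

lemma quantile_final (h : IsSmoothDensity τ ρ m F) (s : ℝ) : h.quantile τ s = s := by
  have := h.apply_quantile τ s
  rwa [h.final] at this

lemma continuous_quantile (h : IsSmoothDensity τ ρ m F) :
    Continuous fun z : ℝ × ℝ => h.quantile z.1 z.2 := by
  rw [continuous_iff_continuousAt]
  rintro ⟨t, s⟩
  have hc : ∀ x, Continuous fun z : ℝ × ℝ => F z.1 x := fun x =>
    h.continuous.comp (by fun_prop : Continuous fun z : ℝ × ℝ => (z.1, x))
  refine tendsto_order.2 ⟨fun a ha => ?_, fun a ha => ?_⟩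
  · have h1 : F t a < s := by
      conv_rhs => rw [← h.apply_quantile t s]
      exact h.strictMono t ha
    filter_upwards [((hc a).tendsto (t, s)).eventually_lt (continuous_snd.tendsto (t, s)) h1]
      with z hz
    rw [← (h.strictMono z.1).lt_iff_lt, h.apply_quantile]
    exact hz
  · have h1 : s < F t a := by
      conv_lhs => rw [← h.apply_quantile t s]
      exact h.strictMono t ha
    filter_upwards [(continuous_snd.tendsto (t, s)).eventually_lt ((hc a).tendsto (t, s)) h1]
      with z hz
    rw [← (h.strictMono z.1).lt_iff_lt, h.apply_quantile]
    exact hz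

/-- The velocity of the flow of a smooth density, in terms of labels. -/
def velocity (h : IsSmoothDensity τ ρ m F) (z : ℝ × ℝ) : ℝ :=
  m (z.1, h.quantile z.1 z.2) / ρ (z.1, h.quantile z.1 z.2)

lemma continuous_velocity (h : IsSmoothDensity τ ρ m F) : Continuous h.velocity := by
  have hc : Continuous fun z : ℝ × ℝ => (z.1, h.quantile z.1 z.2) :=
    continuous_fst.prodMk h.continuous_quantile
  exact (h.continuous_flux.comp hc).div (h.continuous_density.comp hc) fun z => (h.pos _).ne'

lemma hasDerivAt_quantile (h : IsSmoothDensity τ ρ m F) {t : ℝ} (ht : t ∈ Ioo 0 τ) (s : ℝ) :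
    HasDerivAt (fun t => h.quantile t s) (h.velocity (t, s)) t := by
  set γ : ℝ → ℝ := fun t => h.quantile t s with hγ
  have hγc : Continuous γ :=
    h.continuous_quantile.comp (by fun_prop : Continuous fun t : ℝ => (t, s))
  -- The mean density between the old and the new position. Since the distribution function takes
  -- the same value s along the quantile, the displacement times this mean is the change of the
  -- distribution function at a fixed point. Dividing by time gives velocity = flux/density without
  -- joint differentiability in time and space.
  set D : ℝ → ℝ := fun r => ∫ u in (0 : ℝ)..1, ρ (r, γ t + (γ r - γ t) * u) with hD
  have hDc : Continuous D := by
    refine intervalIntegral.continuous_parametric_intervalIntegral_of_continuous' ?_ _ _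
    have := h.continuous_density
    fun_prop
  have hDt : D t = ρ (t, γ t) := by simp [hD]
  have hDpos : ∀ r, 0 < D r := fun r =>
    intervalIntegral.intervalIntegral_pos_of_pos_on
      ((h.continuous_density.comp (by fun_prop)).intervalIntegrable _ _) (fun u _ => h.pos _)
      one_pos
  have hDeq : ∀ r, D r * (γ r - γ t) = s - F r (γ t) := by
    intro r
    have h1 := h.sub_eq r (γ t) (γ r)
    have h2 : F r (γ r) = s := h.apply_quantile r s
    rw [h2] at h1
    have h3 := intervalIntegral.smul_integral_comp_add_mul (fun x => ρ (r, x)) (γ r - γ t) (γ t)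
      (a := 0) (b := 1)
    simp only [mul_zero, add_zero, mul_one, add_sub_cancel, smul_eq_mul] at h3
    rw [h1, ← h3, mul_comm]
  have hFt : F t (γ t) = s := h.apply_quantile t s
  have hder := h.hasDerivAt t ht (γ t)
  rw [hasDerivAt_iff_tendsto_slope] at hder ⊢
  have h1 : Tendsto (fun r => -slope (fun t' => F t' (γ t)) t r * (D r)⁻¹) (𝓝[≠] t)
      (𝓝 (-(-m (t, γ t)) * (D t)⁻¹)) :=
    hder.neg.mul ((hDc.tendsto t).inv₀ (hDpos t).ne' |>.mono_left nhdsWithin_le_nhds)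
  have h2 : -(-m (t, γ t)) * (D t)⁻¹ = h.velocity (t, s) := by
    rw [hDt, neg_neg, velocity, div_eq_mul_inv]
  rw [← h2]
  refine h1.congr' ?_
  filter_upwards [self_mem_nhdsWithin] with r hr
  have hr' : r - t ≠ 0 := sub_ne_zero.2 hr
  have h4 := hDeq r
  have h5 : γ r - γ t = (s - F r (γ t)) * (D r)⁻¹ := by
    rw [← h4]; field_simp [(hDpos r).ne']
  rw [slope_def_field, slope_def_field, hFt, h5]
  field_simp [(hDpos r).ne']
  ring

lemma flowMap_velocity (h : IsSmoothDensity τ ρ m F) {t : ℝ} (ht : t ∈ Icc 0 τ) (s : ℝ) :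
    flowMap τ h.velocity t s = h.quantile t s := by
  have h1 := intervalIntegral.integral_eq_sub_of_hasDerivAt_of_le ht.2
    (h.continuous_quantile.comp (by fun_prop : Continuous fun t : ℝ => (t, s))).continuousOn
    (fun r hr => h.hasDerivAt_quantile (t := r) ⟨ht.1.trans_lt hr.1, hr.2⟩ s)
    ((h.continuous_velocity.comp
      (by fun_prop : Continuous fun t : ℝ => (t, s))).intervalIntegrable _ _)
  have h2 : ∫ r in t..τ, h.velocity (r, s) = h.quantile τ s - h.quantile t s := h1
  rw [flowMap, h2, h.quantile_final]
  ring

/-- The substitution s = F(t, x) maps a period to the interval from F(t, 0) to F(t, 0) + 1; by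
periodicity it may be shifted back to the labels. -/
lemma integral_comp_quantile (h : IsSmoothDensity τ ρ m F) (t : ℝ) {f : ℝ → ℝ} (hf : Continuous f)
    (hper : Function.Periodic f 1) :
    ∫ s in (0 : ℝ)..1, f (h.quantile t s) = ∫ x in (0 : ℝ)..1, f x * ρ (t, x) := by
  have hq : Continuous (h.quantile t) :=
    h.continuous_quantile.comp (by fun_prop : Continuous fun s : ℝ => (t, s))
  have h1 := intervalIntegral.integral_comp_mul_deriv (a := 0) (b := 1)
    (fun x _ => h.hasDerivAt_space t x) (h.continuous_slice t).continuousOn (hf.comp hq)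
  simp only [Function.comp_apply, h.quantile_apply] at h1
  rw [h1]
  have h2 : Function.Periodic (fun s => f (h.quantile t s)) 1 := fun s => by
    simp only [h.quantile_add_one, hper (h.quantile t s)]
  have h3 := h2.intervalIntegral_add_eq 0 (F t 0)
  have h4 := h.add_one t 0
  rw [zero_add] at h3 h4
  rw [h3, h4]

/-- In labels the energy is the integral of velocity², and the substitution turns it into the
integral of flux²/density. Monotonicity holds because positions are quantiles. -/
theorem isFlow (h : IsSmoothDensity τ ρ m F) {K : ℝ≥0∞}
    (hK : ∫⁻ t in Ioc 0 τ, ENNReal.ofReal (∫ x in (0 : ℝ)..1, m (t, x) ^ 2 / ρ (t, x)) ≤ K) :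
    IsFlow τ K h.velocity := by
  refine ⟨h.continuous_velocity.measurable, ?_, fun t ht => ?_⟩
  · rw [lintegral_prod _ (by
      exact (h.continuous_velocity.measurable.enorm.pow_const 2).aemeasurable)]
    refine le_trans (lintegral_mono fun t => ?_) hK
    have hc : Continuous fun s => h.velocity (t, s) ^ 2 :=
      (h.continuous_velocity.comp (by fun_prop : Continuous fun s : ℝ => (t, s))).pow 2
    have h1 : ∫⁻ s, ‖h.velocity (t, s)‖ₑ ^ 2 ∂labels =
        ENNReal.ofReal (∫ s, h.velocity (t, s) ^ 2 ∂labels) := by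
      rw [ofReal_integral_eq_lintegral_ofReal]
      · refine lintegral_congr fun s => ?_
        rw [← ofReal_norm, ← ENNReal.ofReal_pow (norm_nonneg _), Real.norm_eq_abs, sq_abs]
      · exact (hc.intervalIntegrable 0 1).1
      · exact Eventually.of_forall fun s => sq_nonneg _
    rw [h1, ← intervalIntegral.integral_of_le zero_le_one]
    have hm : Continuous fun x => m (t, x) := h.continuous_flux.comp (by fun_prop)
    have h2 := h.integral_comp_quantile t (f := fun x => (m (t, x) / ρ (t, x)) ^ 2)
      ((hm.div (h.continuous_slice t) fun x => (h.pos _).ne').pow 2)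
      (fun x => by simp only [h.flux_periodic, h.density_periodic])
    refine (congrArg ENNReal.ofReal (h2.trans ?_)).le
    refine intervalIntegral.integral_congr fun x _ => ?_
    have := (h.pos (t, x)).ne'
    field_simp
  · refine ⟨univ, by simp, ?_⟩
    have : flowMap τ h.velocity t = h.quantile t := funext fun s => h.flowMap_velocity ht s
    rw [this]
    exact (h.monotone_quantile t).monotoneOn _

lemma integral_flowLaw_velocity (h : IsSmoothDensity τ ρ m F) {t : ℝ} (ht : t ∈ Icc 0 τ)
    (ξ : C(Q, ℝ)) :
    ∫ x, ξ x ∂flowLaw τ h.velocity t = ∫ x in (0 : ℝ)..1, ξ (x : Q) * ρ (t, x) := by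
  rw [integral_flowLaw h.continuous_velocity.measurable,
    ← h.integral_comp_quantile t (f := fun x : ℝ => ξ x) (ξ.continuous.comp continuous_coeQ)
      (fun x => by simp), intervalIntegral.integral_of_le zero_le_one]
  simp_rw [h.flowMap_velocity ht]

end IsSmoothDensity

/-! ### Mollification of a transport -/

/-- A measure on time × position × velocity that solves the continuity equation on `(0, τ + 1)` and
is uniform after time `τ`. -/
structure IsTransport (τ : ℝ) (K : ℝ≥0∞) (θ : Measure (ℝ × Q × ℝ)) : Prop where
  isFiniteMeasure : IsFiniteMeasure θ
  energy : ∫⁻ z, ‖z.2.2‖ₑ ^ 2 ∂θ ≤ K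
  continuityEq : ∀ (α : ℝ → ℝ) (β β' : Q → ℝ), ContDiff ℝ ∞ α → HasCompactSupport α →
    tsupport α ⊆ Ioo 0 (τ + 1) → ContDiff ℝ ∞ (fun u : ℝ => β u) → Continuous β' →
    (∀ u : ℝ, HasDerivAt (fun u : ℝ => β u) (β' u) u) →
    ∫ z, (deriv α z.1 * β z.2.1 + z.2.2 * (α z.1 * β' z.2.1)) ∂θ = 0
  final : ∀ (α : ℝ → ℝ) (β : Q → ℝ), Continuous α → (∀ r ≤ τ, α r = 0) →
    (∀ r, τ + 1 ≤ r → α r = 0) → Continuous β →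
    ∫ z, α z.1 * β z.2.1 ∂θ = (∫ r, α r) * ∫ y, β y

/-- The mollifier on space-time, evaluated at a point of time × position × velocity. -/
def mollifier (n : ℕ) (p : ℝ × ℝ) (z : ℝ × Q × ℝ) : ℝ :=
  timeKernel n (z.1 - p.1) * spaceKernel n (p.2 - z.2.1)

lemma continuous_mollifier (n : ℕ) :
    Continuous fun q : (ℝ × ℝ) × (ℝ × Q × ℝ) => mollifier n q.1 q.2 := by
  have := continuous_timeKernel n
  have := continuous_spaceKernel n
  have := continuous_coeQ
  unfold mollifier
  fun_prop

lemma continuous_mollifier_left (n : ℕ) (z : ℝ × Q × ℝ) : Continuous fun p => mollifier n p z :=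
  (continuous_mollifier n).comp (by fun_prop : Continuous fun p : ℝ × ℝ => (p, z))

lemma continuous_mollifier_right (n : ℕ) (p : ℝ × ℝ) : Continuous (mollifier n p) :=
  (continuous_mollifier n).comp (by fun_prop : Continuous fun z : ℝ × Q × ℝ => (p, z))

lemma mollifier_nonneg (n : ℕ) (p : ℝ × ℝ) (z : ℝ × Q × ℝ) : 0 ≤ mollifier n p z :=
  mul_nonneg (timeKernel_nonneg _ _) (spaceKernel_pos _ _).le

lemma exists_mollifier_bound (n : ℕ) : ∃ C, ∀ p z, ‖mollifier n p z‖ ≤ C := by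
  obtain ⟨A, hA⟩ := exists_timeKernel_bound n
  obtain ⟨B, hB⟩ := exists_spaceKernel_bound n
  refine ⟨A * B, fun p z => ?_⟩
  rw [mollifier, norm_mul]
  exact mul_le_mul (hA _) (hB _) (norm_nonneg _) ((norm_nonneg _).trans (hA 0))

/-- The mollification of the moment of `θ` with weight `v (velocity)`. -/
def mollify (θ : Measure (ℝ × Q × ℝ)) (n : ℕ) (v : ℝ → ℝ) (p : ℝ × ℝ) : ℝ :=
  ∫ z, mollifier n p z * v z.2.2 ∂θ

section

variable {θ : Measure (ℝ × Q × ℝ)} {v : ℝ → ℝ}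

lemma integrable_mollifier_mul (n : ℕ) (hv : Integrable (fun z => v z.2.2) θ) (p : ℝ × ℝ) :
    Integrable (fun z => mollifier n p z * v z.2.2) θ := by
  obtain ⟨C, hC⟩ := exists_mollifier_bound n
  exact hv.bdd_mul (continuous_mollifier_right n p).aestronglyMeasurable
    (Eventually.of_forall fun z => hC p z)

lemma continuous_mollify (n : ℕ) (hv : Integrable (fun z => v z.2.2) θ) :
    Continuous (mollify θ n v) := by
  obtain ⟨C, hC⟩ := exists_mollifier_bound n
  refine continuous_of_dominated (bound := fun z => C * ‖v z.2.2‖)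
    (fun p => (integrable_mollifier_mul n hv p).aestronglyMeasurable) (fun p => ?_)
    (hv.norm.const_mul C) (Eventually.of_forall fun z => ?_)
  · refine Eventually.of_forall fun z => ?_
    rw [norm_mul]
    gcongr
    exact hC p z
  · exact (continuous_mollifier_left n z).mul continuous_const

lemma mollify_periodic (n : ℕ) (t x : ℝ) : mollify θ n v (t, x + 1) = mollify θ n v (t, x) := by
  simp [mollify, mollifier]

lemma integrable_mollifier_curve [SFinite θ] (n : ℕ) (hv : Integrable (fun z => v z.2.2) θ)
    {c : ℝ → ℝ × ℝ} (hc : Continuous c) (a b : ℝ) :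
    Integrable (Function.uncurry fun (s : ℝ) (z : ℝ × Q × ℝ) => mollifier n (c s) z * v z.2.2)
      ((volume.restrict (uIoc a b)).prod θ) := by
  obtain ⟨C, hC⟩ := exists_mollifier_bound n
  have h1 : Integrable (fun q : ℝ × (ℝ × Q × ℝ) => v q.2.2.2)
      ((volume.restrict (uIoc a b)).prod θ) :=
    have : IsFiniteMeasure (volume.restrict (uIoc a b)) :=
      ⟨by rw [Measure.restrict_apply_univ]; exact measure_Ioc_lt_top⟩
    hv.comp_snd (volume.restrict (uIoc a b))
  refine h1.bdd_mul (c := C) ?_ (Eventually.of_forall fun q => hC (c q.1) q.2)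
  exact ((continuous_mollifier n).comp ((hc.comp continuous_fst).prodMk
    continuous_snd)).aestronglyMeasurable

lemma integral_mollify_space [SFinite θ] (n : ℕ) (hv : Integrable (fun z => v z.2.2) θ)
    (t a b : ℝ) :
    ∫ x in a..b, mollify θ n v (t, x) =
      ∫ z, timeKernel n (z.1 - t) * spaceStep n a b z.2.1 * v z.2.2 ∂θ := by
  unfold mollify
  rw [intervalIntegral_integral_swap (f := fun x z => mollifier n (t, x) z * v z.2.2)
    (integrable_mollifier_curve n hv (c := fun x => (t, x)) (by fun_prop) a b)]
  refine integral_congr_ae (Eventually.of_forall fun z => ?_)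
  simp only [mollifier, spaceStep]
  rw [intervalIntegral.integral_mul_const, intervalIntegral.integral_const_mul]

lemma integral_mollify_time [SFinite θ] (n : ℕ) (hv : Integrable (fun z => v z.2.2) θ)
    (t τ x : ℝ) :
    ∫ s in t..τ, mollify θ n v (s, x) =
      ∫ z, (timeStep n (z.1 - t) - timeStep n (z.1 - τ)) * spaceKernel n (x - z.2.1) * v z.2.2
        ∂θ := by
  unfold mollify
  rw [intervalIntegral_integral_swap (f := fun s z => mollifier n (s, x) z * v z.2.2)
    (integrable_mollifier_curve n hv (c := fun s => (s, x)) (by fun_prop) t τ)]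
  refine integral_congr_ae (Eventually.of_forall fun z => ?_)
  simp only [mollifier]
  rw [intervalIntegral.integral_mul_const, intervalIntegral.integral_mul_const]
  have h1 : ∫ s in t..τ, timeKernel n (z.1 - s) = timeStep n (z.1 - t) - timeStep n (z.1 - τ) := by
    rw [intervalIntegral.integral_comp_sub_left (timeKernel n) z.1]
    exact intervalIntegral.integral_eq_sub_of_hasDerivAt (fun u _ => hasDerivAt_timeStep n u)
      ((continuous_timeKernel n).intervalIntegrable _ _)
  rw [h1]

end

namespace IsTransport

variable {τ : ℝ} {K : ℝ≥0∞} {θ : Measure (ℝ × Q × ℝ)}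

lemma memLp_velocity (h : IsTransport τ K θ) (hK : K ≠ ⊤) :
    MemLp (fun z : ℝ × Q × ℝ => z.2.2) 2 θ :=
  memLp_two_of_lintegral_ne_top (by fun_prop) (ne_top_of_le_ne_top hK h.energy)

lemma integrable_velocity (h : IsTransport τ K θ) (hK : K ≠ ⊤) :
    Integrable (fun z : ℝ × Q × ℝ => id z.2.2) θ :=
  have := h.isFiniteMeasure
  (h.memLp_velocity hK).integrable (by norm_num)

lemma integrable_sq_velocity (h : IsTransport τ K θ) (hK : K ≠ ⊤) :
    Integrable (fun z : ℝ × Q × ℝ => z.2.2 ^ 2) θ := (h.memLp_velocity hK).integrable_sq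

lemma integrable_one (h : IsTransport τ K θ) :
    Integrable (fun z : ℝ × Q × ℝ => (fun _ => (1 : ℝ)) z.2.2) θ :=
  have := h.isFiniteMeasure
  integrable_const _

/-- The increments of the distribution function of the mollified density. -/
lemma integral_mollify_eq (h : IsTransport τ K θ) (hK : K ≠ ⊤) (n : ℕ) {t : ℝ} (ht : t ∈ Icc 0 τ)
    (a b : ℝ) :
    ∫ x in a..b, mollify θ n (fun _ => 1) (t, x) =
      (b - a) + ∫ s in t..τ, (mollify θ n id (s, b) - mollify θ n id (s, a)) := by
  have := h.isFiniteMeasure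
  have hw := h.integrable_velocity hK
  have hn : (0 : ℝ) ≤ n := n.cast_nonneg
  obtain ⟨Ck, hCk⟩ := exists_spaceKernel_bound n
  obtain ⟨Cκ, hCκ⟩ := exists_timeKernel_bound n
  obtain ⟨CS, hCS⟩ := isCompact_univ.exists_bound_of_continuousOn
    (continuous_spaceStep n a b).continuousOn
  have hcS := continuous_spaceStep n a b
  have hcκ := continuous_timeKernel n
  have hck := continuous_spaceKernel n
  have hcK := (contDiff_timeStep n).continuous
  have hKb : ∀ u, ‖timeStep n u‖ ≤ 1 := fun u => by
    rw [Real.norm_eq_abs, abs_le]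
    exact ⟨neg_one_lt_zero.le.trans (Real.smoothTransition.nonneg _),
      Real.smoothTransition.le_one _⟩
  have hi1 : ∀ s, Integrable (fun z : ℝ × Q × ℝ => timeKernel n (z.1 - s) * spaceStep n a b z.2.1)
      θ := fun s => Integrable.of_bound (by fun_prop) (Cκ * CS) (Eventually.of_forall fun z => by
        rw [norm_mul]
        exact mul_le_mul (hCκ _) (hCS _ (mem_univ _)) (norm_nonneg _)
          ((norm_nonneg _).trans (hCκ 0)))
  have hi2 : ∀ x : ℝ, Integrable (fun z : ℝ × Q × ℝ =>
      (timeStep n (z.1 - t) - timeStep n (z.1 - τ)) * spaceKernel n (x - z.2.1) * id z.2.2) θ :=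
    fun x => hw.bdd_mul (c := 2 * Ck) (by fun_prop) (Eventually.of_forall fun z => by
      rw [norm_mul]
      refine mul_le_mul ?_ (hCk _) (norm_nonneg _) zero_le_two
      exact (norm_sub_le _ _).trans (by linarith [hKb (z.1 - t), hKb (z.1 - τ)]))
  -- the continuity equation, tested with a step in time and a step in space
  have hweak := h.continuityEq (fun r => timeStep n (r - t) - timeStep n (r - τ)) (spaceStep n a b)
    (fun y => spaceKernel n (a - y) - spaceKernel n (b - y))
    (((contDiff_timeStep n).comp (contDiff_id.sub contDiff_const)).sub
      ((contDiff_timeStep n).comp (contDiff_id.sub contDiff_const))) ?_ ?_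
    (contDiff_spaceStep n a b) (by fun_prop) (hasDerivAt_spaceStep n a b)
  rotate_left
  · refine HasCompactSupport.of_support_subset_isCompact
      (isCompact_Icc (a := t + 1 / (n + 3)) (b := τ + 2 / (n + 3))) ?_
    exact support_timeStep_sub_subset ht.2
  · refine (closure_minimal (support_timeStep_sub_subset ht.2) isClosed_Icc).trans ?_
    refine Icc_subset_Ioo ?_ ?_
    · have : (0 : ℝ) < 1 / (n + 3) := by positivity
      linarith [ht.1]
    · have : (2 : ℝ) / (n + 3) < 1 := by rw [div_lt_one (by positivity)]; linarith
      linarith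
  have hderiv : ∀ r, deriv (fun r => timeStep n (r - t) - timeStep n (r - τ)) r =
      timeKernel n (r - t) - timeKernel n (r - τ) := fun r =>
    (((hasDerivAt_timeStep n (r - t)).comp_sub_const r t).sub
      ((hasDerivAt_timeStep n (r - τ)).comp_sub_const r τ)).deriv
  have hsplit : ∀ z : ℝ × Q × ℝ,
      deriv (fun r => timeStep n (r - t) - timeStep n (r - τ)) z.1 * spaceStep n a b z.2.1 +
        z.2.2 * ((timeStep n (z.1 - t) - timeStep n (z.1 - τ)) *
          (spaceKernel n (a - z.2.1) - spaceKernel n (b - z.2.1))) =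
      (timeKernel n (z.1 - t) * spaceStep n a b z.2.1 -
        timeKernel n (z.1 - τ) * spaceStep n a b z.2.1) -
      ((timeStep n (z.1 - t) - timeStep n (z.1 - τ)) * spaceKernel n (b - z.2.1) * id z.2.2 -
        (timeStep n (z.1 - t) - timeStep n (z.1 - τ)) * spaceKernel n (a - z.2.1) * id z.2.2) := by
    intro z
    rw [hderiv, id]
    ring
  simp_rw [hsplit] at hweak
  have hi1s : Integrable (fun z : ℝ × Q × ℝ => timeKernel n (z.1 - t) * spaceStep n a b z.2.1 -
    timeKernel n (z.1 - τ) * spaceStep n a b z.2.1) θ := (hi1 t).sub (hi1 τ)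
  have hi2s : Integrable (fun z : ℝ × Q × ℝ =>
    (timeStep n (z.1 - t) - timeStep n (z.1 - τ)) * spaceKernel n (b - z.2.1) * id z.2.2 -
    (timeStep n (z.1 - t) - timeStep n (z.1 - τ)) * spaceKernel n (a - z.2.1) * id z.2.2) θ :=
    (hi2 b).sub (hi2 a)
  rw [integral_sub hi1s hi2s, integral_sub (hi1 t) (hi1 τ),
    integral_sub (hi2 b) (hi2 a), ← integral_mollify_time n hw, ← integral_mollify_time n hw]
    at hweak
  -- The kernel shifted to τ sees only times at which the measure is already uniform, so the
  -- mollified density at τ is exactly 1.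
  have hfin := h.final (fun r => timeKernel n (r - τ)) (spaceStep n a b) (by fun_prop)
    (fun r hr => timeKernel_eq_zero_of_nonpos (by linarith))
    (fun r hr => timeKernel_eq_zero_of_one_le (by linarith)) hcS
  rw [integral_sub_right_eq_self (timeKernel n) τ, integral_timeKernel, one_mul] at hfin
  have hS : ∫ y, spaceStep n a b y = b - a := by
    unfold spaceStep
    rw [← intervalIntegral_integral_swap (f := fun (z : ℝ) (y : Q) => spaceKernel n (z - y))]
    · simp_rw [integral_sub_left_eq_self (spaceKernel n), integral_spaceKernel]
      simp
    · have : IsFiniteMeasure (volume.restrict (uIoc a b)) :=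
        ⟨by rw [Measure.restrict_apply_univ]; exact measure_Ioc_lt_top⟩
      have hcQ := continuous_coeQ
      exact Integrable.of_bound (by unfold Function.uncurry; fun_prop) Ck
        (Eventually.of_forall fun z => hCk _)
  have hmi : ∀ x : ℝ, IntervalIntegrable (fun s => mollify θ n id (s, x)) volume t τ := fun x =>
    ((continuous_mollify n hw).comp
      (by fun_prop : Continuous fun s : ℝ => (s, x))).intervalIntegrable _ _
  rw [integral_mollify_space n h.integrable_one, intervalIntegral.integral_sub (hmi b) (hmi a)]
  simp only [mul_one]
  linarith

/-- The total mass of the mollified measure at each time. -/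
lemma integral_timeKernel_eq_one (h : IsTransport τ K θ) (hK : K ≠ ⊤) (n : ℕ) {t : ℝ}
    (ht : t ∈ Icc 0 τ) : ∫ z, timeKernel n (z.1 - t) ∂θ = 1 := by
  have := h.isFiniteMeasure
  -- Over a full period the fluxes at the two ends cancel.
  have h1 := h.integral_mollify_eq hK n ht 0 (0 + 1)
  rw [integral_mollify_space n h.integrable_one] at h1
  simp_rw [spaceStep_add_one, mul_one] at h1
  rw [h1]
  simp_rw [fun s => mollify_periodic (θ := θ) (v := id) n s 0]
  simp

/-- The density is at least the minimum of the space kernel times the mass seen by the time kernel,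
which is 1 at times in [0, τ]. -/
lemma mollify_one_pos (h : IsTransport τ K θ) (hK : K ≠ ⊤) (n : ℕ) {t : ℝ} (ht : t ∈ Icc 0 τ)
    (x : ℝ) : 0 < mollify θ n (fun _ => 1) (t, x) := by
  have := h.isFiniteMeasure
  obtain ⟨y, -, hy⟩ := isCompact_univ.exists_isMinOn univ_nonempty
    (continuous_spaceKernel n).continuousOn
  have h1 : spaceKernel n y * ∫ z, timeKernel n (z.1 - t) ∂θ ≤ mollify θ n (fun _ => 1) (t, x) := by
    rw [← integral_const_mul]
    refine integral_mono ?_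
      (integrable_mollifier_mul (v := fun _ => 1) n h.integrable_one _) fun z => ?_
    · obtain ⟨C, hC⟩ := exists_timeKernel_bound n
      have := continuous_timeKernel n
      exact (Integrable.of_bound (by fun_prop) C (Eventually.of_forall fun z => hC _)).const_mul _
    · simp only [mollifier, mul_one]
      rw [mul_comm]
      exact mul_le_mul_of_nonneg_left (hy (mem_univ _)) (timeKernel_nonneg _ _)
  rw [h.integral_timeKernel_eq_one hK n ht, mul_one] at h1
  exact (spaceKernel_pos n y).trans_le h1

/-- Cauchy-Schwarz for the mollifier as a weight: expand the second moment of the velocity about its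
weighted mean c. -/
lemma sq_mollify_div_le (h : IsTransport τ K θ) (hK : K ≠ ⊤) (n : ℕ) {t : ℝ} (ht : t ∈ Icc 0 τ)
    (x : ℝ) :
    mollify θ n id (t, x) ^ 2 / mollify θ n (fun _ => 1) (t, x) ≤ mollify θ n (· ^ 2) (t, x) := by
  have hpos := h.mollify_one_pos hK n ht x
  set c := mollify θ n id (t, x) / mollify θ n (fun _ => 1) (t, x) with hc
  have h2 := integrable_mollifier_mul (v := (· ^ 2)) n (h.integrable_sq_velocity hK) (t, x)
  have h1 := integrable_mollifier_mul (v := id) n (h.integrable_velocity hK) (t, x)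
  have h0 := integrable_mollifier_mul (v := fun _ => 1) n h.integrable_one (t, x)
  have h3 : 0 ≤ ∫ z, mollifier n (t, x) z * (z.2.2 - c) ^ 2 ∂θ :=
    integral_nonneg fun z => mul_nonneg (mollifier_nonneg _ _ _) (sq_nonneg _)
  have h4 : ∀ z : ℝ × Q × ℝ, mollifier n (t, x) z * (z.2.2 - c) ^ 2 =
      mollifier n (t, x) z * z.2.2 ^ 2 - 2 * c * (mollifier n (t, x) z * id z.2.2) +
        c ^ 2 * (mollifier n (t, x) z * 1) := by
    intro z; simp only [id]; ring
  simp_rw [h4] at h3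
  have h21 : Integrable (fun z : ℝ × Q × ℝ => mollifier n (t, x) z * z.2.2 ^ 2 -
    2 * c * (mollifier n (t, x) z * id z.2.2)) θ := h2.sub (h1.const_mul (2 * c))
  rw [integral_add h21 (h0.const_mul (c ^ 2)),
    integral_sub h2 (h1.const_mul (2 * c)), integral_const_mul, integral_const_mul] at h3
  change 0 ≤ mollify θ n (· ^ 2) (t, x) - 2 * c * mollify θ n id (t, x) +
    c ^ 2 * mollify θ n (fun _ => 1) (t, x) at h3
  have h5 : c * mollify θ n (fun _ => 1) (t, x) = mollify θ n id (t, x) := by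
    rw [hc]; field_simp
  have h6 : mollify θ n id (t, x) ^ 2 / mollify θ n (fun _ => 1) (t, x) =
      c * mollify θ n id (t, x) := by rw [hc]; ring
  rw [h6]
  have h7 : c ^ 2 * mollify θ n (fun _ => 1) (t, x) = c * mollify θ n id (t, x) := by
    rw [sq, mul_assoc, h5]
  linarith

/-- After the pointwise inequality the bound is the mollified second moment of the velocity. The
kernel has integral 1 in space and at most 1 over the times in [0, τ], so no energy is gained. -/
lemma lintegral_sq_mollify_div_le (h : IsTransport τ K θ) (hK : K ≠ ⊤) (n : ℕ) :
    ∫⁻ t in Ioc 0 τ, ENNReal.ofReal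
      (∫ x in (0 : ℝ)..1, mollify θ n id (t, x) ^ 2 / mollify θ n (fun _ => 1) (t, x)) ≤ K := by
  have := h.isFiniteMeasure
  have hκ := continuous_timeKernel n
  have hw2 := h.integrable_sq_velocity hK
  obtain ⟨C, hC⟩ := exists_timeKernel_bound n
  calc (∫⁻ t in Ioc 0 τ, ENNReal.ofReal
      (∫ x in (0 : ℝ)..1, mollify θ n id (t, x) ^ 2 / mollify θ n (fun _ => 1) (t, x)))
      ≤ ∫⁻ t in Ioc 0 τ, ∫⁻ z, ENNReal.ofReal (timeKernel n (z.1 - t)) * ‖z.2.2‖ₑ ^ 2 ∂θ := by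
        refine setLIntegral_mono_ae' measurableSet_Ioc (Eventually.of_forall fun t ht => ?_)
        have ht' := Ioc_subset_Icc_self ht
        have hc : ∀ v : ℝ → ℝ, Integrable (fun z => v z.2.2) θ →
            Continuous fun x => mollify θ n v (t, x) :=
          fun v hv => (continuous_mollify n hv).comp (by fun_prop)
        have h1 : ∫ x in (0 : ℝ)..1, mollify θ n id (t, x) ^ 2 / mollify θ n (fun _ => 1) (t, x) ≤
            ∫ x in (0 : ℝ)..1, mollify θ n (· ^ 2) (t, x) := by
          refine intervalIntegral.integral_mono_on zero_le_one ?_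
            ((hc _ hw2).intervalIntegrable _ _) fun x _ => h.sq_mollify_div_le hK n ht' x
          exact (((hc _ (h.integrable_velocity hK)).pow 2).div (hc _ h.integrable_one) fun x =>
            (h.mollify_one_pos hK n ht' x).ne').intervalIntegrable _ _
        refine (ENNReal.ofReal_le_ofReal h1).trans ?_
        rw [integral_mollify_space n hw2]
        have h2 := spaceStep_add_one n 0
        rw [zero_add] at h2
        simp_rw [h2, mul_one]
        rw [ofReal_integral_eq_lintegral_ofReal
          (hw2.bdd_mul (by fun_prop) (Eventually.of_forall fun z => hC _))
          (Eventually.of_forall fun z => mul_nonneg (timeKernel_nonneg _ _) (sq_nonneg _))]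
        refine lintegral_mono fun z => ?_
        rw [ENNReal.ofReal_mul (timeKernel_nonneg _ _), ← ofReal_norm,
          ← ENNReal.ofReal_pow (norm_nonneg _), Real.norm_eq_abs, sq_abs]
    _ = ∫⁻ z, (∫⁻ t in Ioc 0 τ, ENNReal.ofReal (timeKernel n (z.1 - t))) * ‖z.2.2‖ₑ ^ 2 ∂θ := by
        rw [lintegral_lintegral_swap (by fun_prop)]
        refine lintegral_congr fun z => ?_
        rw [lintegral_mul_const _ (by fun_prop)]
    _ ≤ ∫⁻ z, 1 * ‖z.2.2‖ₑ ^ 2 ∂θ := by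
        gcongr with z
        refine (setLIntegral_le_lintegral _ _).trans ?_
        rw [← ofReal_integral_eq_lintegral_ofReal
          ((integrable_timeKernel n).comp_sub_left z.1)
          (Eventually.of_forall fun t => timeKernel_nonneg _ _), integral_timeKernel_sub]
        simp
    _ ≤ K := by simpa using h.energy

end IsTransport

/-! ### The monotone flow of a transport -/

/-- The projection of a time to `[0, τ]`. -/
def clampTime (τ t : ℝ) : ℝ := max 0 (min t τ)

lemma continuous_clampTime (τ : ℝ) : Continuous (clampTime τ) := by
  unfold clampTime; fun_prop

lemma clampTime_mem {τ : ℝ} (hτ : 0 ≤ τ) (t : ℝ) : clampTime τ t ∈ Icc 0 τ :=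
  ⟨le_max_left _ _, max_le hτ (min_le_right _ _)⟩

lemma clampTime_eq {τ t : ℝ} (ht : t ∈ Icc 0 τ) : clampTime τ t = t := by
  rw [clampTime, min_eq_left ht.2, max_eq_right ht.1]

namespace IsTransport

variable {τ : ℝ} {K : ℝ≥0∞} {θ : Measure (ℝ × Q × ℝ)}

/-- The distribution function is the identity at time τ, where the density is uniform, plus the flux
that passes a point until then. Times are clamped because positivity of the density is known on [0,
τ] only. -/
theorem isSmoothDensity (h : IsTransport τ K θ) (hτ : 0 ≤ τ) (hK : K ≠ ⊤) (n : ℕ) :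
    IsSmoothDensity τ (fun p => mollify θ n (fun _ => 1) (clampTime τ p.1, p.2))
      (fun p => mollify θ n id (clampTime τ p.1, p.2))
      (fun t x => x + ∫ r in clampTime τ t..τ, mollify θ n id (r, x)) := by
  have hw := h.integrable_velocity hK
  have hcm := continuous_mollify n hw
  have hct := continuous_clampTime τ
  have hcl : Continuous fun p : ℝ × ℝ => (clampTime τ p.1, p.2) := by fun_prop
  have hper : ∀ r x, mollify θ n id (r, x + 1) = mollify θ n id (r, x) := mollify_periodic n
  have hmi : ∀ x a b : ℝ, IntervalIntegrable (fun s => mollify θ n id (s, x)) volume a b :=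
    fun x a b => (hcm.comp (by fun_prop : Continuous fun s : ℝ => (s, x))).intervalIntegrable _ _
  refine ⟨(continuous_mollify n h.integrable_one).comp hcl, hcm.comp hcl, ?_,
    fun z => h.mollify_one_pos hK n (clampTime_mem hτ _) _, fun t x => mollify_periodic n _ _,
    fun t x => hper _ _, fun t a b => ?_, fun t x => ?_, fun t ht x => ?_, fun x => ?_⟩
  · have h1 : Continuous fun q : ℝ × ℝ => ∫ r in τ..clampTime τ q.1, mollify θ n id (r, q.2) := by
      refine intervalIntegral.continuous_parametric_intervalIntegral_of_continuous
        (f := fun (q : ℝ × ℝ) r => mollify θ n id (r, q.2)) ?_ (by fun_prop)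
      exact hcm.comp (by fun_prop : Continuous fun q : (ℝ × ℝ) × ℝ => (q.2, q.1.2))
    refine (continuous_snd.add h1.neg).congr fun q => ?_
    change q.2 + -(∫ r in τ..clampTime τ q.1, mollify θ n id (r, q.2)) =
      q.2 + ∫ r in clampTime τ q.1..τ, mollify θ n id (r, q.2)
    rw [← intervalIntegral.integral_symm]
  · have h1 := h.integral_mollify_eq hK n (clampTime_mem hτ t) a b
    rw [intervalIntegral.integral_sub (hmi _ _ _) (hmi _ _ _)] at h1
    rw [h1]
    ring
  · simp_rw [hper]
    ring
  · have h1 := intervalIntegral.integral_hasDerivAt_left (hmi x t τ)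
      (Continuous.stronglyMeasurableAtFilter
        (hcm.comp (by fun_prop : Continuous fun s : ℝ => (s, x))) _ _)
      (hcm.comp (by fun_prop : Continuous fun s : ℝ => (s, x))).continuousAt
    rw [clampTime_eq (Ioo_subset_Icc_self ht)]
    refine (h1.const_add x).congr_of_eventuallyEq ?_
    filter_upwards [Ioo_mem_nhds ht.1 ht.2] with u hu
    rw [clampTime_eq (Ioo_subset_Icc_self hu)]
  · simp [clampTime_eq (show τ ∈ Icc 0 τ from ⟨hτ, le_rfl⟩)]

/-- Fubini's theorem moves the mollification from the measure to the test functions, where it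
converges. -/
lemma integral_mul_mollify (h : IsTransport τ K θ) (n : ℕ) {α : ℝ → ℝ} (hα : Continuous α)
    (hα0 : ∀ t ∉ Ioo 0 τ, α t = 0) (ξ : C(Q, ℝ)) :
    ∫ t in Ioo 0 τ, α t * ∫ x in (0 : ℝ)..1, ξ (x : Q) * mollify θ n (fun _ => 1) (t, x) =
      ∫ z, (∫ t, α t * timeKernel n (z.1 - t)) * (∫ x, ξ x * spaceKernel n (x - z.2.1)) ∂θ := by
  have := h.isFiniteMeasure
  obtain ⟨C, hC⟩ := exists_mollifier_bound n
  obtain ⟨Cκ, hCκ⟩ := exists_timeKernel_bound n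
  obtain ⟨A, hA⟩ := hα.bounded_above_of_compact_support
    (HasCompactSupport.of_support_subset_isCompact (isCompact_Icc (a := 0) (b := τ)) fun t ht =>
      Ioo_subset_Icc_self (by by_contra hc; exact ht (hα0 t hc)))
  have hcm := continuous_mollifier n
  have hck := continuous_spaceKernel n
  have hcκ := continuous_timeKernel n
  have hcQ := continuous_coeQ
  set J : Q → ℝ := fun y => ∫ x, ξ x * spaceKernel n (x - y) with hJ
  have hJeq : ∀ y, ∫ x in (0 : ℝ)..1, ξ (x : Q) * spaceKernel n (x - y) = J y := by
    intro y
    have := UnitAddCircle.intervalIntegral_preimage 0 fun x => ξ x * spaceKernel n (x - y)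
    rwa [zero_add] at this
  have hJc : Continuous J := by
    have : Continuous fun y : Q => ∫ x in (0 : ℝ)..1, ξ (x : Q) * spaceKernel n (x - y) :=
      intervalIntegral.continuous_parametric_intervalIntegral_of_continuous' (by fun_prop) _ _
    exact this.congr hJeq
  obtain ⟨B, hB⟩ := isCompact_univ.exists_bound_of_continuousOn hJc.continuousOn
  have h1 : ∀ t, ∫ x in (0 : ℝ)..1, ξ (x : Q) * mollify θ n (fun _ => 1) (t, x) =
      ∫ z, timeKernel n (z.1 - t) * J z.2.1 ∂θ := by
    intro t
    simp only [mollify, mul_one, ← integral_const_mul]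
    rw [intervalIntegral_integral_swap (f := fun x z => ξ (x : Q) * mollifier n (t, x) z)]
    · refine integral_congr_ae (Eventually.of_forall fun z => ?_)
      simp only [← hJeq, mollifier, ← intervalIntegral.integral_const_mul]
      exact intervalIntegral.integral_congr fun x _ => by ring
    · have : IsFiniteMeasure (volume.restrict (uIoc (0 : ℝ) 1)) :=
        ⟨by rw [Measure.restrict_apply_univ]; exact measure_Ioc_lt_top⟩
      have hcm' : Continuous fun q : ℝ × (ℝ × Q × ℝ) => mollifier n (t, q.1) q.2 :=
        hcm.comp (by fun_prop : Continuous fun q : ℝ × (ℝ × Q × ℝ) => ((t, q.1), q.2))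
      refine Integrable.of_bound (by unfold Function.uncurry; fun_prop) (‖ξ‖ * C)
        (Eventually.of_forall fun q => ?_)
      simp only [Function.uncurry, norm_mul]
      exact mul_le_mul (ξ.norm_coe_le_norm _) (hC _ _) (norm_nonneg _) (norm_nonneg _)
  have h2 : ∀ t, α t * ∫ z, timeKernel n (z.1 - t) * J z.2.1 ∂θ =
      ∫ z, α t * (timeKernel n (z.1 - t) * J z.2.1) ∂θ := fun t => (integral_const_mul _ _).symm
  simp_rw [h1, h2]
  rw [integral_integral_swap]
  · refine integral_congr_ae (Eventually.of_forall fun z => ?_)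
    change ∫ t in Ioo 0 τ, α t * (timeKernel n (z.1 - t) * J z.2.1) =
      (∫ t, α t * timeKernel n (z.1 - t)) * J z.2.1
    rw [← integral_mul_const, setIntegral_eq_integral_of_forall_compl_eq_zero fun t ht => by
      rw [hα0 t ht, zero_mul]]
    exact integral_congr_ae (Eventually.of_forall fun t => (mul_assoc _ _ _).symm)
  · refine Integrable.of_bound (by unfold Function.uncurry; fun_prop) (A * (Cκ * B))
      (Eventually.of_forall fun q => ?_)
    simp only [Function.uncurry, norm_mul]
    have hA0 : 0 ≤ A := (norm_nonneg _).trans (hA 0)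
    have hC0 : 0 ≤ Cκ := (norm_nonneg _).trans (hCκ 0)
    gcongr
    · exact hA _
    · exact hCκ _
    · exact hB _ (mem_univ _)

lemma tendsto_integral_mul_mollify (h : IsTransport τ K θ) {α : ℝ → ℝ} (hα : Continuous α)
    (hα0 : ∀ t ∉ Ioo 0 τ, α t = 0) (ξ : C(Q, ℝ)) :
    Tendsto (fun n => ∫ t in Ioo 0 τ,
      α t * ∫ x in (0 : ℝ)..1, ξ (x : Q) * mollify θ n (fun _ => 1) (t, x)) atTop
      (𝓝 (∫ z, α z.1 * ξ z.2.1 ∂θ)) := by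
  have := h.isFiniteMeasure
  simp_rw [h.integral_mul_mollify _ hα hα0 ξ]
  obtain ⟨A, hA⟩ := hα.bounded_above_of_compact_support
    (HasCompactSupport.of_support_subset_isCompact (isCompact_Icc (a := 0) (b := τ)) fun t ht =>
      Ioo_subset_Icc_self (by by_contra hc; exact ht (hα0 t hc)))
  have hA0 : 0 ≤ A := (norm_nonneg _).trans (hA 0)
  have hcξ := ξ.continuous
  refine tendsto_integral_of_dominated_convergence (fun _ => A * ‖ξ‖) (fun n => ?_)
    (integrable_const _) (fun n => Eventually.of_forall fun z => ?_)
    (Eventually.of_forall fun z => (tendsto_integral_mul_timeKernel hα z.1).mul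
      (tendsto_integral_mul_spaceKernel hcξ z.2.1))
  · have hck := continuous_spaceKernel n
    have hcκ := continuous_timeKernel n
    have h1 : StronglyMeasurable fun r : ℝ => ∫ t, α t * timeKernel n (r - t) :=
      StronglyMeasurable.integral_prod_right (f := fun r t : ℝ => α t * timeKernel n (r - t))
        (Continuous.stronglyMeasurable (by fun_prop))
    have h2 : StronglyMeasurable fun y : Q => ∫ x, ξ x * spaceKernel n (x - y) :=
      StronglyMeasurable.integral_prod_right (f := fun y x : Q => ξ x * spaceKernel n (x - y))
        (Continuous.stronglyMeasurable (by fun_prop))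
    exact ((h1.comp_measurable measurable_fst).mul
      (h2.comp_measurable (measurable_fst.comp measurable_snd))).aestronglyMeasurable
  · rw [norm_mul]
    have h1 : ‖∫ t, α t * timeKernel n (z.1 - t)‖ ≤ A := by
      refine (norm_integral_le_of_norm_le (((integrable_timeKernel n).comp_sub_left z.1).const_mul A)
        (Eventually.of_forall fun t => ?_)).trans ?_
      · rw [norm_mul, Real.norm_of_nonneg (timeKernel_nonneg _ _)]
        exact mul_le_mul_of_nonneg_right (hA _) (timeKernel_nonneg _ _)
      · rw [integral_const_mul, integral_timeKernel_sub, mul_one]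
    have h2 : ‖∫ x, ξ x * spaceKernel n (x - z.2.1)‖ ≤ ‖ξ‖ := by
      refine (norm_integral_le_of_norm_le ((integrable_of_continuous ((continuous_spaceKernel n).comp
        (by fun_prop : Continuous fun x : Q => x - z.2.1))).const_mul ‖ξ‖)
        (Eventually.of_forall fun x => ?_)).trans ?_
      · rw [norm_mul, Real.norm_of_nonneg (spaceKernel_pos _ _).le]
        exact mul_le_mul_of_nonneg_right (ξ.norm_coe_le_norm _) (spaceKernel_pos _ _).le
      · rw [integral_const_mul]
        simp only [Function.comp_apply]
        rw [integral_spaceKernel_sub, mul_one]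
    exact mul_le_mul h1 h2 (norm_nonneg _) hA0

/-- A transport is carried by a monotone flow with the same energy. -/
theorem exists_flow (h : IsTransport τ K θ) (hτ : 0 ≤ τ) (hK : K ≠ ⊤) :
    ∃ g, IsFlow τ K g ∧ ∀ α : ℝ → ℝ, Continuous α → (∀ t ∉ Ioo 0 τ, α t = 0) → ∀ ξ : C(Q, ℝ),
      ∫ t in Ioo 0 τ, α t * ∫ x, ξ x ∂flowLaw τ g t = ∫ z, α z.1 * ξ z.2.1 ∂θ := by
  have hd := fun n => h.isSmoothDensity hτ hK n
  have hflow : ∀ n, IsFlow τ K (hd n).velocity := by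
    intro n
    refine (hd n).isFlow (le_of_eq_of_le ?_ (h.lintegral_sq_mollify_div_le hK n))
    refine setLIntegral_congr_fun measurableSet_Ioc fun t ht => ?_
    simp only [clampTime_eq (Ioc_subset_Icc_self ht)]
  -- The energy bound is the same for every degree of mollification, hence it survives in the limit.
  obtain ⟨φ, hφ, g, hg, hlim⟩ := IsFlow.exists_limit hflow tendsto_const_nhds hK
  refine ⟨g, hg, fun α hα hα0 ξ => ?_⟩
  obtain ⟨A, hA⟩ := hα.bounded_above_of_compact_support
    (HasCompactSupport.of_support_subset_isCompact (isCompact_Icc (a := 0) (b := τ)) fun t ht =>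
      Ioo_subset_Icc_self (by by_contra hc; exact ht (hα0 t hc)))
  refine tendsto_nhds_unique ?_
    ((h.tendsto_integral_mul_mollify hα hα0 ξ).comp hφ.tendsto_atTop)
  have hlaw : ∀ n, ∀ t ∈ Ioo 0 τ, ∫ x, ξ x ∂flowLaw τ (hd n).velocity t =
      ∫ x in (0 : ℝ)..1, ξ (x : Q) * mollify θ n (fun _ => 1) (t, x) := by
    intro n t ht
    rw [(hd n).integral_flowLaw_velocity (Ioo_subset_Icc_self ht)]
    simp only [clampTime_eq (Ioo_subset_Icc_self ht)]
  refine tendsto_integral_of_dominated_convergence (fun _ => A * ‖ξ‖) (fun n => ?_)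
    (integrable_const _) (fun n => ?_) ?_
  · have hcQ := continuous_coeQ
    have : Continuous fun t : ℝ =>
        ∫ x in (0 : ℝ)..1, ξ (x : Q) * mollify θ (φ n) (fun _ => 1) (t, x) := by
      have hcm := continuous_mollify (v := fun _ => 1) (φ n) h.integrable_one
      exact intervalIntegral.continuous_parametric_intervalIntegral_of_continuous' (by fun_prop) _ _
    exact (hα.mul this).aestronglyMeasurable
  · filter_upwards [ae_restrict_mem measurableSet_Ioo] with t ht
    rw [← hlaw _ t ht, norm_mul]
    refine mul_le_mul (hA _) ?_ (norm_nonneg _) ((norm_nonneg _).trans (hA 0))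
    rw [integral_flowLaw (hflow _).measurable]
    refine (norm_integral_le_of_norm_le_const
      (Eventually.of_forall fun s => ξ.norm_coe_le_norm _)).trans ?_
    simp [Measure.real]
  · filter_upwards [ae_restrict_mem measurableSet_Ioo] with t ht
    refine Tendsto.const_mul _ ?_
    simp_rw [← hlaw _ t ht]
    exact weakTendsto_flowLaw (fun n => (hflow _).measurable) hg.measurable
      (hlim t (Ioo_subset_Icc_self ht)) ξ

end IsTransport

/-! ### Extension of an evolution by an optimal transport to the uniform measure -/

/-- A measure on time × position × velocity that solves the continuity equation on `(0, T)` with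
final trace `σ`. -/
structure IsHalfTransport (T : ℝ) (η : Measure (ℝ × Q × ℝ)) (σ : Measure Q) : Prop where
  isFiniteMeasure : IsFiniteMeasure η
  time_mem : ∀ᵐ z ∂η, z.1 ∈ Ioo 0 T
  continuityEq : ∀ (α : ℝ → ℝ) (β β' : Q → ℝ), ContDiff ℝ ∞ α → HasCompactSupport α →
    tsupport α ⊆ Ioi 0 → ContDiff ℝ ∞ (fun u : ℝ => β u) → Continuous β' →
    (∀ u : ℝ, HasDerivAt (fun u : ℝ => β u) (β' u) u) →
    ∫ z, (deriv α z.1 * β z.2.1 + z.2.2 * (α z.1 * β' z.2.1)) ∂η = α T * ∫ x, β x ∂σ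

/-- The geodesic from `q.1` to `q.2` run through during the times `[T, T + lam⁻¹]`. -/
def geodesic (lam T t : ℝ) (q : Q × Q) : Q :=
  q.1 + ((min 1 (lam * (t - T)) * circleRep (q.2 - q.1) : ℝ) : Q)

/-- The speed of `geodesic`. -/
def geodesicSpeed (lam T t : ℝ) (q : Q × Q) : ℝ :=
  if t < extendedTime lam T then lam * circleRep (q.2 - q.1) else 0

/-- The transport along geodesics, followed by rest. -/
def geodesicTransport (lam T : ℝ) (π : Measure (Q × Q)) : Measure (ℝ × Q × ℝ) :=
  ((volume.restrict (Ioc T (extendedTime lam T + 1))).prod π).map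
    fun p => (p.1, geodesic lam T p.1 p.2, geodesicSpeed lam T p.1 p.2)

lemma measurable_circleRep_sub : Measurable fun q : Q × Q => circleRep (q.2 - q.1) :=
  measurable_circleRep.comp (measurable_snd.sub measurable_fst)

lemma measurable_geodesicTransport_map (lam T : ℝ) : Measurable fun p : ℝ × (Q × Q) =>
    (p.1, geodesic lam T p.1 p.2, geodesicSpeed lam T p.1 p.2) := by
  have h := measurable_circleRep_sub
  have h2 : Measurable fun p : ℝ × (Q × Q) => circleRep (p.2.2 - p.2.1) := h.comp measurable_snd
  refine measurable_fst.prodMk (Measurable.prodMk ?_ ?_)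
  · unfold geodesic
    refine (measurable_fst.comp measurable_snd).add (measurable_coeQ.comp ?_)
    exact (measurable_const.min (measurable_const.mul (measurable_fst.sub_const T))).mul h2
  · unfold geodesicSpeed
    exact Measurable.ite (measurableSet_lt measurable_fst measurable_const) (h2.const_mul lam)
      measurable_const

lemma geodesic_of_le {lam T t : ℝ} (hlam : 0 < lam) (ht : t ≤ extendedTime lam T) (q : Q × Q) :
    geodesic lam T t q = q.1 + ((lam * (t - T) * circleRep (q.2 - q.1) : ℝ) : Q) := by
  have h1 : t - T ≤ lam⁻¹ := by unfold extendedTime at ht; linarith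
  have h : lam * (t - T) ≤ 1 := by
    calc lam * (t - T) ≤ lam * lam⁻¹ := by gcongr
      _ = 1 := mul_inv_cancel₀ hlam.ne'
  rw [geodesic, min_eq_right h]

lemma geodesic_of_ge {lam T t : ℝ} (hlam : 0 < lam) (ht : extendedTime lam T ≤ t) (q : Q × Q) :
    geodesic lam T t q = q.2 := by
  have h1 : lam⁻¹ ≤ t - T := by unfold extendedTime at ht; linarith
  have h : 1 ≤ lam * (t - T) := by
    calc 1 = lam * lam⁻¹ := (mul_inv_cancel₀ hlam.ne').symm
      _ ≤ lam * (t - T) := by gcongr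
  rw [geodesic, min_eq_left h, one_mul, coe_circleRep]
  abel

lemma continuous_of_contDiff_coe {β : Q → ℝ} (hβ : ContDiff ℝ ∞ fun u : ℝ => β u) :
    Continuous β :=
  QuotientAddGroup.isOpenQuotientMap_mk.isQuotientMap.continuous_iff.2 hβ.continuous

/-- The fundamental theorem of calculus, applied to the motion until `extendedTime` and to the rest
afterwards. The test function vanishes at the end of the rest, so only the term at time T remains;
it is the opposite of the boundary term in `IsHalfTransport.continuityEq`. -/
lemma integral_along_geodesic {lam T : ℝ} (hlam : 0 < lam) {α : ℝ → ℝ} {β β' : Q → ℝ}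
    (hα : ContDiff ℝ ∞ α) (hα1 : α (extendedTime lam T + 1) = 0)
    (hβ : ContDiff ℝ ∞ fun u : ℝ => β u) (hβ'c : Continuous β')
    (hβ' : ∀ u : ℝ, HasDerivAt (fun u : ℝ => β u) (β' u) u) (q : Q × Q) :
    ∫ t in Ioc T (extendedTime lam T + 1), (deriv α t * β (geodesic lam T t q) +
      geodesicSpeed lam T t q * (α t * β' (geodesic lam T t q))) = -(α T * β q.1) := by
  set τ := extendedTime lam T with hτ
  have hTτ : T ≤ τ := by
    have := inv_pos.2 hlam
    rw [hτ, extendedTime]; linarith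
  obtain ⟨x, hx⟩ : ∃ x : ℝ, (x : Q) = q.1 := QuotientAddGroup.mk_surjective q.1
  set c := circleRep (q.2 - q.1) with hc
  have hβc := continuous_of_contDiff_coe hβ
  have hαd : ∀ t, HasDerivAt α (deriv α t) t := fun t =>
    (hα.differentiable (by simp) t).hasDerivAt
  have hαc := hα.continuous
  have hα'c : Continuous (deriv α) := hα.continuous_deriv (by simp)
  have hcQ := continuous_coeQ
  have hlin : ∀ t, HasDerivAt (fun t => x + lam * (t - T) * c) (lam * c) t := by
    intro t
    have := ((((hasDerivAt_id t).sub_const T).const_mul lam).mul_const c).const_add x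
    simpa using this
  have hd1 : ∀ t, HasDerivAt (fun t => α t * β ((x + lam * (t - T) * c : ℝ) : Q))
      (deriv α t * β ((x + lam * (t - T) * c : ℝ) : Q) +
        lam * c * (α t * β' ((x + lam * (t - T) * c : ℝ) : Q))) t := by
    intro t
    have h1 := (hβ' (x + lam * (t - T) * c)).comp t (hlin t)
    refine ((hαd t).mul h1).congr_deriv ?_
    simp only [Function.comp_apply]
    ring
  have hd2 : ∀ t, HasDerivAt (fun t => α t * β q.2) (deriv α t * β q.2) t := fun t =>
    (hαd t).mul_const _
  have hI1 : ∫ t in T..τ, (deriv α t * β (geodesic lam T t q) +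
      geodesicSpeed lam T t q * (α t * β' (geodesic lam T t q))) =
      α τ * β q.2 - α T * β q.1 := by
    have h1 := intervalIntegral.integral_eq_sub_of_hasDerivAt (fun t _ => hd1 t)
      (Continuous.intervalIntegrable (by fun_prop) T τ)
    have h2 : ((x + lam * (τ - T) * c : ℝ) : Q) = q.2 := by
      rw [AddCircle.coe_add, hx, ← geodesic_of_le hlam le_rfl, geodesic_of_ge hlam le_rfl]
    have h3 : ((x + lam * (T - T) * c : ℝ) : Q) = q.1 := by simp [hx]
    rw [h2, h3] at h1
    rw [← h1]
    refine intervalIntegral.integral_congr_ae ?_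
    have hne : ∀ᵐ t : ℝ, t ≠ τ := by simp [ae_iff]
    filter_upwards [hne] with t ht htm
    rw [uIoc_of_le hTτ] at htm
    rw [geodesic_of_le hlam htm.2, ← hx, ← AddCircle.coe_add, geodesicSpeed,
      if_pos (lt_of_le_of_ne htm.2 ht), hx]
  have hI2 : ∫ t in τ..(τ + 1), (deriv α t * β (geodesic lam T t q) +
      geodesicSpeed lam T t q * (α t * β' (geodesic lam T t q))) = -(α τ * β q.2) := by
    have h1 := intervalIntegral.integral_eq_sub_of_hasDerivAt (fun t _ => hd2 t)
      (Continuous.intervalIntegrable (by fun_prop) τ (τ + 1))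
    rw [hα1, zero_mul, zero_sub] at h1
    rw [← h1]
    refine intervalIntegral.integral_congr fun t ht => ?_
    rw [uIcc_of_le (by linarith)] at ht
    rw [geodesic_of_ge hlam ht.1, geodesicSpeed, if_neg (not_lt.2 ht.1)]
    ring
  have hint : ∀ a b, IntervalIntegrable (fun t => deriv α t * β (geodesic lam T t q) +
      geodesicSpeed lam T t q * (α t * β' (geodesic lam T t q))) volume a b := by
    intro a b
    have hg : Continuous fun t => geodesic lam T t q := by unfold geodesic; fun_prop
    refine (Continuous.intervalIntegrable (by fun_prop) a b).add ?_
    have hg2 : Continuous fun t => α t * β' (geodesic lam T t q) := by fun_prop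
    have hb : ∀ t, ‖geodesicSpeed lam T t q‖ ≤ lam * |c| := by
      intro t
      unfold geodesicSpeed
      split_ifs
      · rw [norm_mul, Real.norm_of_nonneg hlam.le, Real.norm_eq_abs]
      · rw [norm_zero]; positivity
    have hm : Measurable fun t => geodesicSpeed lam T t q := by
      unfold geodesicSpeed
      exact Measurable.ite measurableSet_Iio measurable_const measurable_const
    exact ⟨(hg2.intervalIntegrable a b).1.bdd_mul hm.aestronglyMeasurable (Eventually.of_forall hb),
      (hg2.intervalIntegrable a b).2.bdd_mul hm.aestronglyMeasurable (Eventually.of_forall hb)⟩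
  rw [← intervalIntegral.integral_of_le (by linarith),
    ← intervalIntegral.integral_add_adjacent_intervals (hint T τ) (hint τ (τ + 1)), hI1, hI2]
  ring

lemma abs_geodesicSpeed_le {lam : ℝ} (hlam : 0 < lam) (T t : ℝ) (q : Q × Q) :
    |geodesicSpeed lam T t q| ≤ lam := by
  unfold geodesicSpeed
  split_ifs
  · rw [abs_mul, abs_of_pos hlam]
    have := abs_circleRep_le (q.2 - q.1)
    nlinarith
  · simpa using hlam.le

lemma lintegral_geodesicTransport (lam T : ℝ) (π : Measure (Q × Q)) [SFinite π]
    {f : ℝ × Q × ℝ → ℝ≥0∞} (hf : Measurable f) :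
    ∫⁻ z, f z ∂geodesicTransport lam T π = ∫⁻ q, (∫⁻ t in Ioc T (extendedTime lam T + 1),
      f (t, geodesic lam T t q, geodesicSpeed lam T t q)) ∂π := by
  unfold geodesicTransport
  rw [lintegral_map hf (measurable_geodesicTransport_map lam T)]
  exact lintegral_prod_symm _ (hf.comp (measurable_geodesicTransport_map lam T)).aemeasurable

lemma integral_geodesicTransport (lam T : ℝ) (π : Measure (Q × Q)) [IsFiniteMeasure π]
    {f : ℝ × Q × ℝ → ℝ} (hf : Measurable f) (hint : Integrable f (geodesicTransport lam T π)) :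
    ∫ z, f z ∂geodesicTransport lam T π = ∫ q, (∫ t in Ioc T (extendedTime lam T + 1),
      f (t, geodesic lam T t q, geodesicSpeed lam T t q)) ∂π := by
  unfold geodesicTransport at hint ⊢
  have hm := measurable_geodesicTransport_map lam T
  rw [integral_map hm.aemeasurable hf.aestronglyMeasurable]
  rw [integrable_map_measure hf.aestronglyMeasurable hm.aemeasurable] at hint
  exact integral_prod_symm _ hint

instance (lam T : ℝ) (π : Measure (Q × Q)) [IsFiniteMeasure π] :
    IsFiniteMeasure (geodesicTransport lam T π) := by
  unfold geodesicTransport; infer_instance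

lemma ae_geodesicTransport {lam : ℝ} (hlam : 0 < lam) (T : ℝ) (π : Measure (Q × Q)) [SFinite π] :
    ∀ᵐ z ∂geodesicTransport lam T π, z.1 ∈ Ioc T (extendedTime lam T + 1) ∧ |z.2.2| ≤ lam := by
  have hset : MeasurableSet
      {z : ℝ × Q × ℝ | z.1 ∈ Ioc T (extendedTime lam T + 1) ∧ |z.2.2| ≤ lam} :=
    (measurable_fst measurableSet_Ioc).inter
      (measurableSet_le (f := fun z : ℝ × Q × ℝ => |z.2.2|) (by fun_prop) measurable_const)
  unfold geodesicTransport
  rw [ae_map_iff (measurable_geodesicTransport_map lam T).aemeasurable hset]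
  have h : ∀ᵐ p ∂(volume.restrict (Ioc T (extendedTime lam T + 1))).prod π,
      p.1 ∈ Ioc T (extendedTime lam T + 1) :=
    Measure.quasiMeasurePreserving_fst.ae (ae_restrict_mem measurableSet_Ioc)
  filter_upwards [h] with p hp using ⟨hp, abs_geodesicSpeed_le hlam T p.1 p.2⟩

/-- The flux of a test function is integrable. -/
lemma integrable_flux {θ : Measure (ℝ × Q × ℝ)} [IsFiniteMeasure θ] {α : ℝ → ℝ} {β β' : Q → ℝ}
    (hα : ContDiff ℝ ∞ α) (hαs : HasCompactSupport α) (hβ : Continuous β) (hβ' : Continuous β')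
    (hw : Integrable (fun z : ℝ × Q × ℝ => z.2.2) θ) :
    Integrable (fun z => deriv α z.1 * β z.2.1 + z.2.2 * (α z.1 * β' z.2.1)) θ := by
  have hαc := hα.continuous
  have hα'c : Continuous (deriv α) := hα.continuous_deriv (by simp)
  obtain ⟨A, hA⟩ := hαc.bounded_above_of_compact_support hαs
  obtain ⟨A', hA'⟩ := hα'c.bounded_above_of_compact_support hαs.deriv
  obtain ⟨B, hB⟩ := isCompact_univ.exists_bound_of_continuousOn hβ.continuousOn
  obtain ⟨B', hB'⟩ := isCompact_univ.exists_bound_of_continuousOn hβ'.continuousOn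
  refine Integrable.add ?_ ?_
  · refine Integrable.of_bound (by fun_prop) (A' * B) (Eventually.of_forall fun z => ?_)
    rw [norm_mul]
    exact mul_le_mul (hA' _) (hB _ (mem_univ _)) (norm_nonneg _) ((norm_nonneg _).trans (hA' 0))
  · refine hw.mul_bdd (c := A * B') (by fun_prop) (Eventually.of_forall fun z => ?_)
    rw [norm_mul]
    exact mul_le_mul (hA _) (hB' _ (mem_univ _)) (norm_nonneg _) ((norm_nonneg _).trans (hA 0))

/-- A displacement d is covered at speed lam·|d| during a time 1/lam, at the cost lam·|d|²; the rest
costs nothing. -/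
lemma lintegral_sq_geodesicTransport_le {lam : ℝ} (hlam : 0 < lam) (T : ℝ) (π : Measure (Q × Q))
    [SFinite π] : ∫⁻ z, ‖z.2.2‖ₑ ^ 2 ∂geodesicTransport lam T π ≤
      ENNReal.ofReal lam * ∫⁻ q, ‖q.1 - q.2‖ₑ ^ 2 ∂π := by
  rw [lintegral_geodesicTransport lam T π (by fun_prop),
    ← lintegral_const_mul _ (by fun_prop)]
  refine lintegral_mono fun q => ?_
  have hle : ∀ t ∈ Ioc T (extendedTime lam T + 1), ‖geodesicSpeed lam T t q‖ₑ ^ 2 ≤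
      (Ioo T (extendedTime lam T)).indicator
        (fun _ => ENNReal.ofReal (lam * lam) * ‖q.1 - q.2‖ₑ ^ 2) t := by
    intro t ht
    unfold geodesicSpeed
    split_ifs with h
    · rw [indicator_of_mem (show t ∈ Ioo T (extendedTime lam T) from ⟨ht.1, h⟩), enorm_mul, mul_pow,
        ← ofReal_norm lam, Real.norm_of_nonneg hlam.le, ← ENNReal.ofReal_pow hlam.le, sq lam]
      gcongr
      rw [← ofReal_norm, ← ofReal_norm, Real.norm_eq_abs, ← norm_eq_abs_circleRep, norm_sub_rev]
    · simp
  refine (setLIntegral_mono' measurableSet_Ioc hle).trans ?_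
  refine (setLIntegral_le_lintegral _ _).trans ?_
  rw [lintegral_indicator measurableSet_Ioo, setLIntegral_const, Real.volume_Ioo, mul_right_comm,
    ← ENNReal.ofReal_mul (by positivity)]
  have : lam * lam * (extendedTime lam T - T) = lam := by
    unfold extendedTime; field_simp; ring
  rw [this]

/-- Extension of a half transport by geodesics. -/
theorem IsHalfTransport.isTransport {lam T : ℝ} (hlam : 0 < lam)
    {η : Measure (ℝ × Q × ℝ)} {σ : Measure Q} (h : IsHalfTransport T η σ) {π : Measure (Q × Q)}
    (hπ1 : π.map Prod.fst = σ) (hπ2 : π.map Prod.snd = volume)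
    (hK : ∫⁻ z, ‖z.2.2‖ₑ ^ 2 ∂η ≠ ⊤) :
    IsTransport (extendedTime lam T)
      (∫⁻ z, ‖z.2.2‖ₑ ^ 2 ∂η + ENNReal.ofReal lam * ∫⁻ q, ‖q.1 - q.2‖ₑ ^ 2 ∂π)
      (η + geodesicTransport lam T π) := by
  have hη := h.isFiniteMeasure
  have hπfin : IsFiniteMeasure π := ⟨by
    have h1 : π.map Prod.snd univ = volume (univ : Set Q) := by rw [hπ2]
    rw [Measure.map_apply measurable_snd MeasurableSet.univ, preimage_univ] at h1
    rw [h1]; simp⟩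
  have hTτ : T ≤ extendedTime lam T := by
    have := inv_pos.2 hlam
    unfold extendedTime; linarith
  have hw1 : Integrable (fun z : ℝ × Q × ℝ => z.2.2) η :=
    (memLp_two_of_lintegral_ne_top (by fun_prop) hK).integrable (by norm_num)
  have hw2 : Integrable (fun z : ℝ × Q × ℝ => z.2.2) (geodesicTransport lam T π) :=
    Integrable.of_bound (by fun_prop) lam
      ((ae_geodesicTransport hlam T π).mono fun z hz => hz.2)
  refine ⟨inferInstance, ?_, fun α β β' hα hαs hαsupp hβ hβ'c hβ' => ?_,
    fun α β hα hα0 hα1 hβ => ?_⟩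
  · rw [lintegral_add_measure]
    gcongr
    exact lintegral_sq_geodesicTransport_le hlam T π
  · have hβc := continuous_of_contDiff_coe hβ
    have hαc := hα.continuous
    have hα'c : Continuous (deriv α) := hα.continuous_deriv (by simp)
    rw [integral_add_measure (integrable_flux hα hαs hβc hβ'c hw1)
      (integrable_flux hα hαs hβc hβ'c hw2),
      h.continuityEq α β β' hα hαs (hαsupp.trans Ioo_subset_Ioi_self) hβ hβ'c hβ',
      integral_geodesicTransport lam T π (Continuous.measurable (by fun_prop))
        (integrable_flux hα hαs hβc hβ'c hw2)]
    have hα1 : α (extendedTime lam T + 1) = 0 := by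
      by_contra hne
      exact lt_irrefl _ (hαsupp (subset_tsupport _ hne)).2
    simp_rw [integral_along_geodesic hlam hα hα1 hβ hβ'c hβ']
    rw [integral_neg, integral_const_mul, ← hπ1,
      integral_map measurable_fst.aemeasurable hβc.aestronglyMeasurable, add_neg_cancel]
  · obtain ⟨A, hA⟩ := hα.bounded_above_of_compact_support
      (HasCompactSupport.of_support_subset_isCompact
        (isCompact_Icc (a := extendedTime lam T) (b := extendedTime lam T + 1)) fun t ht =>
        ⟨le_of_not_ge fun hc => ht (hα0 t hc), le_of_not_ge fun hc => ht (hα1 t hc)⟩)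
    obtain ⟨B, hB⟩ := isCompact_univ.exists_bound_of_continuousOn hβ.continuousOn
    have hint : ∀ ρ : Measure (ℝ × Q × ℝ), IsFiniteMeasure ρ →
        Integrable (fun z => α z.1 * β z.2.1) ρ := fun ρ _ =>
      Integrable.of_bound (by fun_prop) (A * B) (Eventually.of_forall fun z => by
        rw [norm_mul]
        exact mul_le_mul (hA _) (hB _ (mem_univ _)) (norm_nonneg _)
          ((norm_nonneg _).trans (hA 0)))
    rw [integral_add_measure (hint _ hη) (hint _ inferInstance)]
    have h1 : ∫ z, α z.1 * β z.2.1 ∂η = 0 := by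
      refine integral_eq_zero_of_ae ?_
      filter_upwards [h.time_mem] with z hz
      simp [hα0 z.1 (hz.2.le.trans hTτ)]
    rw [h1, zero_add, integral_geodesicTransport lam T π (Continuous.measurable (by fun_prop))
      (hint _ inferInstance)]
    have h2 : ∀ q : Q × Q, ∫ t in Ioc T (extendedTime lam T + 1), α t * β (geodesic lam T t q) =
        (∫ t, α t) * β q.2 := by
      intro q
      rw [← integral_mul_const]
      rw [← setIntegral_eq_integral_of_forall_compl_eq_zero
        (s := Ioc T (extendedTime lam T + 1)) (f := fun t => α t * β q.2)]
      · refine setIntegral_congr_fun measurableSet_Ioc fun t _ => ?_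
        rcases le_total t (extendedTime lam T) with ht | ht
        · simp [hα0 t ht]
        · simp only [geodesic_of_ge hlam ht]
      · intro t ht
        rcases le_or_gt t T with h3 | h3
        · rw [hα0 t (h3.trans hTτ), zero_mul]
        · rw [hα1 t (le_of_not_ge fun h4 => ht ⟨h3, h4⟩), zero_mul]
    simp_rw [h2]
    rw [integral_const_mul, ← hπ2,
      integral_map measurable_snd.aemeasurable hβ.aestronglyMeasurable]

/-! ### Disintegration in time -/

namespace HasSlices

variable {T : ℝ} {μ : Measure (ℝ × Q)} {ν : ℝ → Measure Q}

lemma fst_eq (h : HasSlices T μ ν) :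
    μ.fst = (volume.restrict (Ioo (-T) T)).withDensity fun t => ν t univ := by
  ext B hB
  rw [Measure.fst_apply hB, withDensity_apply _ hB, h.setLIntegral_eq MeasurableSet.univ hB]
  congr 1
  ext z; simp

lemma ae_lt_top [IsFiniteMeasure μ] (h : HasSlices T μ ν) :
    ∀ᵐ t ∂volume.restrict (Ioo (-T) T), ν t univ < ⊤ := by
  refine ae_lt_top' (h.aemeasurable_apply MeasurableSet.univ) ?_
  have := h.setLIntegral_eq MeasurableSet.univ MeasurableSet.univ
  rw [Measure.restrict_univ] at this
  rw [this]
  exact measure_ne_top _ _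

/-- Identifies the slices with the conditional kernel, rescaled by the mass of the slice, so that
Fubini for signed integrands becomes available. -/
lemma ae_eq_condKernel [IsFiniteMeasure μ] (h : HasSlices T μ ν) :
    ∀ᵐ t ∂volume.restrict (Ioo (-T) T), ν t = ν t univ • μ.condKernel t := by
  refine h.ae_eq ⟨?_, fun A hA => ?_⟩
  · have h1 := h.aemeasurable_apply MeasurableSet.univ
    refine ⟨fun t => h1.mk _ t • μ.condKernel t, ?_, ?_⟩
    · refine Measure.measurable_of_measurable_coe _ fun s hs => ?_
      simp only [Measure.smul_apply, smul_eq_mul]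
      exact h1.measurable_mk.mul (ProbabilityTheory.Kernel.measurable_coe _ hs)
    · filter_upwards [h1.ae_eq_mk] with t ht
      rw [← ht]
  · rw [← Measure.lintegral_condKernel_mem hA, h.fst_eq, lintegral_withDensity_eq_lintegral_mul₀
      (h.aemeasurable_apply MeasurableSet.univ)]
    · rfl
    · exact (ProbabilityTheory.Kernel.measurable_kernel_prodMk_left hA).aemeasurable

lemma integrable_integral [IsFiniteMeasure μ] (h : HasSlices T μ ν) {F : ℝ × Q → ℝ}
    (hF : Integrable F μ) : IntegrableOn (fun t => ∫ x, F (t, x) ∂ν t) (Ioo (-T) T) := by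
  have h1 := hF.integral_condKernel
  rw [h.fst_eq, integrable_withDensity_iff_integrable_smul₀'
    (h.aemeasurable_apply MeasurableSet.univ) h.ae_lt_top] at h1
  refine h1.congr ?_
  filter_upwards [h.ae_eq_condKernel] with t ht
  conv_rhs => rw [ht]
  rw [integral_smul_measure]

lemma integral_eq [IsFiniteMeasure μ] (h : HasSlices T μ ν) {F : ℝ × Q → ℝ}
    (hF : Integrable F μ) : ∫ z, F z ∂μ = ∫ t in Ioo (-T) T, ∫ x, F (t, x) ∂ν t := by
  rw [← Measure.disintegrate μ μ.condKernel] at hF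
  conv_lhs => rw [← Measure.disintegrate μ μ.condKernel]
  rw [Measure.integral_compProd hF, h.fst_eq, integral_withDensity_eq_integral_toReal_smul₀
    (h.aemeasurable_apply MeasurableSet.univ) h.ae_lt_top]
  refine integral_congr_ae ?_
  filter_upwards [h.ae_eq_condKernel] with t ht
  conv_rhs => rw [ht]
  rw [integral_smul_measure]

end HasSlices

/-! ### Evolutions -/

/-- A solution of the continuity equation on `(-T, T)` with slices `ν` and final trace `σ`, as a
measure on time × position × velocity. -/
structure IsEvolution (T : ℝ) (η : Measure (ℝ × Q × ℝ)) (ν : ℝ → Measure Q) (σ : Measure Q) :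
    Prop where
  isFiniteMeasure : IsFiniteMeasure η
  energy_ne_top : ∫⁻ z, ‖z.2.2‖ₑ ^ 2 ∂η ≠ ⊤
  hasSlices : HasSlices T (η.map fun z => (z.1, z.2.1)) ν
  continuityEq : ∀ (α : ℝ → ℝ) (β β' : Q → ℝ), ContDiff ℝ ∞ α → HasCompactSupport α →
    tsupport α ⊆ Ioo (-T) T → ContDiff ℝ ∞ (fun u : ℝ => β u) → Continuous β' →
    (∀ u : ℝ, HasDerivAt (fun u : ℝ => β u) (β' u) u) →
    ∫ z, (deriv α z.1 * β z.2.1 + z.2.2 * (α z.1 * β' z.2.1)) ∂η = 0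
  trace : ∀ ξ : C(Q, ℝ), Tendsto (fun t => ∫ x, ξ x ∂ν t) (𝓝[<] T ⊓ ae volume) (𝓝 (∫ x, ξ x ∂σ))

/-- One-sided essential limits are limits of one-sided mollifications. -/
lemma tendsto_integral_timeKernel_of_essential {T : ℝ} (hT : 0 < T) {f : ℝ → ℝ} {L : ℝ}
    (hf : IntegrableOn f (Ioo (-T) T)) (h : Tendsto f (𝓝[<] T ⊓ ae volume) (𝓝 L)) :
    Tendsto (fun n => ∫ t in Ioo (-T) T, timeKernel n (T - t) * f t) atTop (𝓝 L) := by
  rw [Metric.tendsto_atTop]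
  intro ε hε
  obtain ⟨s, hs, u, hu, hsu⟩ := eventually_inf.1 (h.eventually (Metric.ball_mem_nhds L (half_pos hε)))
  obtain ⟨l, hl, hls⟩ := mem_nhdsLT_iff_exists_Ioo_subset.1 hs
  set l' := max l (-T) with hl'
  have hl'T : l' < T := max_lt hl (by linarith)
  have hev : ∀ᶠ n : ℕ in atTop, 2 < ((n : ℝ) + 3) * (T - l') :=
    ((tendsto_atTop_add_const_right _ _ tendsto_natCast_atTop_atTop).atTop_mul_const
      (sub_pos.2 hl'T)).eventually_gt_atTop 2
  obtain ⟨N, hN⟩ := eventually_atTop.1 hev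
  refine ⟨N, fun n hn => ?_⟩
  -- For large n the kernel lives in an interval just before T on which, up to a null set, the
  -- function is within ε/2 of its limit.
  have hκ0 : ∀ t, t ∉ Ioo l' T → timeKernel n (T - t) = 0 := by
    intro t ht
    rcases le_or_gt t l' with h1 | h1
    · refine timeKernel_eq_zero_of_gt ((hN n hn).trans_le ?_)
      gcongr
    · exact timeKernel_eq_zero_of_nonpos (by
        have : T ≤ t := le_of_not_gt fun h2 => ht ⟨h1, h2⟩
        linarith)
  have hsub : Ioo l' T ⊆ Ioo (-T) T := Ioo_subset_Ioo_left (le_max_right _ _)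
  have hκi : Integrable fun t => timeKernel n (T - t) := (integrable_timeKernel n).comp_sub_left T
  have hκint : ∫ t in Ioo (-T) T, timeKernel n (T - t) = 1 := by
    rw [setIntegral_eq_integral_of_forall_compl_eq_zero fun t ht => hκ0 t fun hc => ht (hsub hc),
      integral_timeKernel_sub]
  obtain ⟨C, hC⟩ := exists_timeKernel_bound n
  have hκf : IntegrableOn (fun t => timeKernel n (T - t) * f t) (Ioo (-T) T) := by
    have := continuous_timeKernel n
    exact hf.bdd_mul (by fun_prop) (Eventually.of_forall fun t => hC _)
  have h2 : (∫ t in Ioo (-T) T, timeKernel n (T - t) * f t) - L =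
      ∫ t in Ioo (-T) T, timeKernel n (T - t) * (f t - L) := by
    simp_rw [mul_sub]
    rw [integral_sub hκf (hκi.integrableOn.mul_const L), integral_mul_const, hκint, one_mul]
  rw [Real.dist_eq, h2, ← Real.norm_eq_abs]
  refine lt_of_le_of_lt (norm_integral_le_of_norm_le (hκi.integrableOn.mul_const (ε / 2)) ?_)
    (show _ < ε from ?_)
  · refine ae_restrict_of_ae ?_
    filter_upwards [hu] with t ht
    by_cases htm : t ∈ Ioo l' T
    · rw [norm_mul, Real.norm_of_nonneg (timeKernel_nonneg _ _)]
      have h3 := hsu t ⟨hls ⟨(le_max_left _ _).trans_lt htm.1, htm.2⟩, ht⟩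
      rw [Real.dist_eq] at h3
      exact mul_le_mul_of_nonneg_left h3.le (timeKernel_nonneg _ _)
    · rw [hκ0 t htm, zero_mul, zero_mul, norm_zero]
  · rw [integral_mul_const, hκint]
    linarith

namespace IsEvolution

variable {T : ℝ} {η : Measure (ℝ × Q × ℝ)} {ν : ℝ → Measure Q} {σ : Measure Q}

lemma integrable_velocity (h : IsEvolution T η ν σ) :
    Integrable (fun z : ℝ × Q × ℝ => z.2.2) η :=
  have := h.isFiniteMeasure
  (memLp_two_of_lintegral_ne_top (by fun_prop) h.energy_ne_top).integrable (by norm_num)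

lemma ae_mem (h : IsEvolution T η ν σ) : ∀ᵐ z ∂η, z.1 ∈ Ioo (-T) T := by
  have hm : Measurable fun z : ℝ × Q × ℝ => (z.1, z.2.1) := by fun_prop
  have h1 : (η.map fun z => (z.1, z.2.1)) ((Ioo (-T) T)ᶜ ×ˢ univ) = 0 := by
    rw [← h.hasSlices.setLIntegral_eq MeasurableSet.univ measurableSet_Ioo.compl,
      Measure.restrict_restrict measurableSet_Ioo.compl, compl_inter_self, Measure.restrict_empty,
      lintegral_zero_measure]
  rw [Measure.map_apply hm (measurableSet_Ioo.compl.prod MeasurableSet.univ)] at h1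
  rw [ae_iff]
  convert h1 using 2
  ext z; simp

lemma integrableOn_integral (h : IsEvolution T η ν σ) (ξ : C(Q, ℝ)) :
    IntegrableOn (fun t => ∫ x, ξ x ∂ν t) (Ioo (-T) T) := by
  have := h.isFiniteMeasure
  exact h.hasSlices.integrable_integral (F := fun z => ξ z.2)
    (Integrable.of_bound (by fun_prop) ‖ξ‖ (Eventually.of_forall fun z => ξ.norm_coe_le_norm _))

lemma integral_mul (h : IsEvolution T η ν σ) {α : ℝ → ℝ} (hα : Continuous α) {A : ℝ}
    (hA : ∀ t, ‖α t‖ ≤ A) (ξ : C(Q, ℝ)) :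
    ∫ z, α z.1 * ξ z.2.1 ∂η = ∫ t in Ioo (-T) T, α t * ∫ x, ξ x ∂ν t := by
  have := h.isFiniteMeasure
  have hm : Measurable fun z : ℝ × Q × ℝ => (z.1, z.2.1) := by fun_prop
  have hc : Continuous fun z : ℝ × Q => α z.1 * ξ z.2 := by fun_prop
  have h1 := h.hasSlices.integral_eq (F := fun z => α z.1 * ξ z.2)
    (Integrable.of_bound hc.aestronglyMeasurable (A * ‖ξ‖) (Eventually.of_forall fun z => by
      rw [norm_mul]
      exact mul_le_mul (hA _) (ξ.norm_coe_le_norm _) (norm_nonneg _)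
        ((norm_nonneg _).trans (hA 0))))
  rw [integral_map hm.aemeasurable hc.aestronglyMeasurable] at h1
  rw [h1]
  simp_rw [integral_const_mul]

/-- The continuity equation up to the final time. -/
lemma continuityEq_trace (h : IsEvolution T η ν σ) (hT : 0 < T) {α : ℝ → ℝ} {β β' : Q → ℝ}
    (hα : ContDiff ℝ ∞ α) (hαs : HasCompactSupport α) (hαsupp : tsupport α ⊆ Ioi (-T))
    (hβ : ContDiff ℝ ∞ (fun u : ℝ => β u)) (hβ'c : Continuous β')
    (hβ' : ∀ u : ℝ, HasDerivAt (fun u : ℝ => β u) (β' u) u) :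
    ∫ z, (deriv α z.1 * β z.2.1 + z.2.2 * (α z.1 * β' z.2.1)) ∂η = α T * ∫ x, β x ∂σ := by
  have := h.isFiniteMeasure
  have hβc := continuous_of_contDiff_coe hβ
  have hαc := hα.continuous
  obtain ⟨A, hA⟩ := hαc.bounded_above_of_compact_support hαs
  set G : ℝ × Q × ℝ → ℝ := fun z => deriv α z.1 * β z.2.1 + z.2.2 * (α z.1 * β' z.2.1) with hG
  have hGi : Integrable G η := integrable_flux hα hαs hβc hβ'c h.integrable_velocity
  have hcK := fun n => (contDiff_timeStep n).continuous
  have hKb : ∀ n u, ‖timeStep n u‖ ≤ 1 := fun n u => by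
    rw [Real.norm_eq_abs, abs_le]
    exact ⟨neg_one_lt_zero.le.trans (Real.smoothTransition.nonneg _),
      Real.smoothTransition.le_one _⟩
  -- Multiplying by a smooth cutoff that vanishes near T gives an admissible test function. The
  -- derivative of the cutoff produces averages of the slices just before T, and these tend to the
  -- trace.
  have key : ∀ n, ∫ z, timeStep n (T - z.1) * G z ∂η =
      ∫ t in Ioo (-T) T, timeKernel n (T - t) * (α t * ∫ x, β x ∂ν t) := by
    intro n
    have hχd : ∀ t, HasDerivAt (fun t => timeStep n (T - t)) (-timeKernel n (T - t)) t := by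
      intro t
      have := (hasDerivAt_timeStep n (T - t)).comp_const_sub T t
      exact this
    have hd : ∀ t, deriv (fun t => α t * timeStep n (T - t)) t =
        deriv α t * timeStep n (T - t) + α t * -timeKernel n (T - t) := fun t =>
      (((hα.differentiable (by simp) t).hasDerivAt).mul (hχd t)).deriv
    have hweak := h.continuityEq (fun t => α t * timeStep n (T - t)) β β'
      (hα.mul ((contDiff_timeStep n).comp (contDiff_const.sub contDiff_id))) hαs.mul_right ?_
      hβ hβ'c hβ'
    swap
    · have hcl : IsClosed (tsupport α ∩ {t | 1 ≤ ((n : ℝ) + 3) * (T - t)}) :=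
        (isClosed_tsupport α).inter (isClosed_le continuous_const (by fun_prop))
      refine (closure_minimal (fun t ht => ?_) hcl).trans fun t ht => ⟨hαsupp ht.1, ?_⟩
      · refine ⟨subset_tsupport _ (left_ne_zero_of_mul ht), ?_⟩
        by_contra hc
        exact right_ne_zero_of_mul ht (timeStep_eq_zero (not_le.1 hc).le)
      · have h1 : 1 ≤ ((n : ℝ) + 3) * (T - t) := ht.2
        by_contra hc
        have : ((n : ℝ) + 3) * (T - t) ≤ 0 :=
          mul_nonpos_of_nonneg_of_nonpos (by positivity) (by linarith)
        linarith
    have hsplit : ∀ z : ℝ × Q × ℝ, deriv (fun t => α t * timeStep n (T - t)) z.1 * β z.2.1 +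
        z.2.2 * (α z.1 * timeStep n (T - z.1) * β' z.2.1) =
        timeStep n (T - z.1) * G z - timeKernel n (T - z.1) * α z.1 * β z.2.1 := by
      intro z
      rw [hd]
      simp only [hG]
      ring
    simp_rw [hsplit] at hweak
    obtain ⟨C, hC⟩ := exists_timeKernel_bound n
    obtain ⟨B, hB⟩ := isCompact_univ.exists_bound_of_continuousOn hβc.continuousOn
    have hcκ := continuous_timeKernel n
    have hA0 : 0 ≤ A := (norm_nonneg _).trans (hA 0)
    have hC0 : 0 ≤ C := (norm_nonneg _).trans (hC 0)
    have hb : ∀ t, ‖timeKernel n (T - t) * α t‖ ≤ C * A := fun t => by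
      rw [norm_mul]
      exact mul_le_mul (hC _) (hA _) (norm_nonneg _) hC0
    rw [integral_sub (hGi.bdd_mul (by have := hcK n; fun_prop)
        (Eventually.of_forall fun z => hKb n _))
      (Integrable.of_bound (by fun_prop) (C * A * B) (Eventually.of_forall fun z => by
        rw [norm_mul]
        exact mul_le_mul (hb _) (hB _ (mem_univ _)) (norm_nonneg _) (by positivity))),
      sub_eq_zero] at hweak
    rw [hweak]
    have := h.integral_mul (α := fun t => timeKernel n (T - t) * α t) (by fun_prop) hb ⟨β, hβc⟩
    simp only [ContinuousMap.coe_mk] at this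
    rw [this]
    simp_rw [mul_assoc]
  have hlim1 : Tendsto (fun n => ∫ z, timeStep n (T - z.1) * G z ∂η) atTop (𝓝 (∫ z, G z ∂η)) := by
    refine tendsto_integral_of_dominated_convergence (fun z => ‖G z‖) (fun n => ?_) hGi.norm
      (fun n => Eventually.of_forall fun z => ?_) ?_
    · have := hcK n
      exact (Continuous.aestronglyMeasurable (by fun_prop)).mul hGi.aestronglyMeasurable
    · rw [norm_mul]
      exact mul_le_of_le_one_left (norm_nonneg _) (hKb n _)
    · filter_upwards [h.ae_mem] with z hz
      refine tendsto_const_nhds.congr' ?_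
      have hev : ∀ᶠ n : ℕ in atTop, 2 < ((n : ℝ) + 3) * (T - z.1) :=
        ((tendsto_atTop_add_const_right _ _ tendsto_natCast_atTop_atTop).atTop_mul_const
          (sub_pos.2 hz.2)).eventually_gt_atTop 2
      filter_upwards [hev] with n hn
      rw [timeStep_eq_one hn.le, one_mul]
  have hint := h.integrableOn_integral ⟨β, hβc⟩
  have hlim2 := tendsto_integral_timeKernel_of_essential hT
    (f := fun t => α t * ∫ x, β x ∂ν t) (hint.bdd_mul hαc.aestronglyMeasurable
      (Eventually.of_forall hA))
    (((hαc.tendsto T).mono_left (inf_le_left.trans nhdsWithin_le_nhds)).mul (h.trace ⟨β, hβc⟩))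
  simp_rw [key] at hlim1
  exact tendsto_nhds_unique hlim1 hlim2

/-- Test functions supported at positive times do not notice the restriction to positive times. -/
lemma isHalfTransport (h : IsEvolution T η ν σ) (hT : 0 < T) :
    IsHalfTransport T (η.restrict {z | 0 < z.1}) σ := by
  have := h.isFiniteMeasure
  have hm : MeasurableSet {z : ℝ × Q × ℝ | 0 < z.1} := measurableSet_lt (by fun_prop) (by fun_prop)
  refine ⟨inferInstance, ?_, fun α β β' hα hαs hαsupp hβ hβ'c hβ' => ?_⟩
  · filter_upwards [ae_restrict_of_ae h.ae_mem, ae_restrict_mem hm] with z hz hz0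
    exact ⟨hz0, hz.2⟩
  · rw [← h.continuityEq_trace hT hα hαs (hαsupp.trans (Ioi_subset_Ioi (by linarith))) hβ hβ'c hβ']
    refine setIntegral_eq_integral_of_forall_compl_eq_zero fun z hz => ?_
    have hz' : z.1 ∉ tsupport α := fun hc => hz (hαsupp hc)
    have h1 : α z.1 = 0 := image_eq_zero_of_notMem_tsupport hz'
    have h2 : deriv α z.1 = 0 :=
      image_eq_zero_of_notMem_tsupport fun hc => hz' (tsupport_deriv_subset hc)
    rw [h1, h2]
    ring

end IsEvolution

/-! ### The flow of an admissible measure -/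

/-- For each test function in space, the fundamental lemma of the calculus of variations in time. A
countable dense set of such functions leaves a single null set, and continuity in the uniform norm
gives all of them. -/
lemma ae_eq_of_forall_integral_mul_eq {T : ℝ} {ν ν' : ℝ → Measure Q}
    (hf : ∀ᵐ t ∂volume.restrict (Ioo 0 T), IsFiniteMeasure (ν t))
    (hf' : ∀ᵐ t ∂volume.restrict (Ioo 0 T), IsFiniteMeasure (ν' t))
    (hi : ∀ ξ : C(Q, ℝ), IntegrableOn (fun t => ∫ x, ξ x ∂ν t) (Ioo 0 T))
    (hi' : ∀ ξ : C(Q, ℝ), IntegrableOn (fun t => ∫ x, ξ x ∂ν' t) (Ioo 0 T))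
    (h : ∀ α : ℝ → ℝ, Continuous α → (∀ t ∉ Ioo 0 T, α t = 0) → ∀ ξ : C(Q, ℝ),
      ∫ t in Ioo 0 T, α t * ∫ x, ξ x ∂ν t = ∫ t in Ioo 0 T, α t * ∫ x, ξ x ∂ν' t) :
    ∀ᵐ t ∂volume.restrict (Ioo 0 T), ν t = ν' t := by
  have h1 : ∀ ξ : C(Q, ℝ), ∀ᵐ t ∂volume.restrict (Ioo 0 T), ∫ x, ξ x ∂ν t = ∫ x, ξ x ∂ν' t := by
    intro ξ
    have h2 := IsOpen.ae_eq_zero_of_integral_contDiff_smul_eq_zero (isOpen_Ioo (a := 0) (b := T))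
      (((hi ξ).sub (hi' ξ)).locallyIntegrableOn) fun α hα hαc hαs => ?_
    · rw [← ae_restrict_iff' measurableSet_Ioo] at h2
      filter_upwards [h2] with t ht using sub_eq_zero.1 ht
    · obtain ⟨A, hA⟩ := hα.continuous.bounded_above_of_compact_support hαc
      have hα0 : ∀ t ∉ Ioo 0 T, α t = 0 := fun t ht =>
        image_eq_zero_of_notMem_tsupport fun hc => ht (hαs hc)
      rw [← setIntegral_eq_integral_of_forall_compl_eq_zero (μ := volume) (s := Ioo 0 T)
        (f := fun t => α t • ((fun t => ∫ x, ξ x ∂ν t) - fun t => ∫ x, ξ x ∂ν' t) t)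
        fun t ht => by rw [hα0 t ht, zero_smul]]
      have hαi : ∀ {f : ℝ → ℝ}, IntegrableOn f (Ioo 0 T) →
          IntegrableOn (fun t => α t * f t) (Ioo 0 T) := fun hf =>
        hf.bdd_mul hα.continuous.aestronglyMeasurable (Eventually.of_forall hA)
      have h3 := h α hα.continuous hα0 ξ
      rw [← sub_eq_zero, ← integral_sub (hαi (hi ξ)) (hαi (hi' ξ))] at h3
      refine Eq.trans (integral_congr_ae (Eventually.of_forall fun t => ?_)) h3
      simp only [Pi.sub_apply, smul_eq_mul]
      ring
  have h2 := ae_all_iff.2 fun n => h1 (TopologicalSpace.denseSeq C(Q, ℝ) n)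
  filter_upwards [h2, hf, hf'] with t ht htf htf'
  have hcont : ∀ (σ : Measure Q) [IsFiniteMeasure σ],
      Continuous fun ξ : C(Q, ℝ) => ∫ x, ξ x ∂σ := fun σ _ => by
    have hint : ∀ ξ : C(Q, ℝ), Integrable ξ σ := fun ξ =>
      Integrable.of_bound ξ.continuous.aestronglyMeasurable ‖ξ‖
        (Eventually.of_forall fun x => ξ.norm_coe_le_norm x)
    refine LipschitzWith.continuous (K := (σ.real univ).toNNReal)
      (LipschitzWith.of_dist_le_mul fun ξ ξ' => ?_)
    rw [Real.dist_eq, ← integral_sub (hint ξ) (hint ξ'), ← Real.norm_eq_abs,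
      Real.coe_toNNReal _ measureReal_nonneg, mul_comm, dist_eq_norm]
    exact norm_integral_le_of_norm_le_const
      (Eventually.of_forall fun x => (ξ - ξ').norm_coe_le_norm x)
  have h3 : (fun ξ : C(Q, ℝ) => ∫ x, ξ x ∂ν t) = fun ξ : C(Q, ℝ) => ∫ x, ξ x ∂ν' t :=
    Continuous.ext_on (TopologicalSpace.denseRange_denseSeq C(Q, ℝ)) (hcont _) (hcont _) (by
      rintro _ ⟨n, rfl⟩
      exact ht n)
  exact ext_of_forall_integral_eq_of_IsFiniteMeasure fun f => congrFun h3 f.toContinuousMap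

lemma integrableOn_integral_flowLaw {T τ : ℝ} (hTτ : T ≤ τ) {g : ℝ × ℝ → ℝ} (hg : Measurable g)
    (ξ : C(Q, ℝ)) : IntegrableOn (fun t => ∫ x, ξ x ∂flowLaw τ g t) (Ioo 0 T) := by
  obtain ⟨F, hF, hFg⟩ := exists_measurable_uncurry_flowMap hg τ
  have h1 : StronglyMeasurable fun t : ℝ => ∫ s, ξ (F (t, s) : Q) ∂labels :=
    StronglyMeasurable.integral_prod_right (f := fun t s => ξ (F (t, s) : Q))
      (ξ.continuous.measurable.comp (measurable_coeQ.comp hF)).stronglyMeasurable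
  have h2 : IntegrableOn (fun t : ℝ => ∫ s, ξ (F (t, s) : Q) ∂labels) (Ioo 0 T) := by
    refine Integrable.of_bound h1.aestronglyMeasurable ‖ξ‖ (Eventually.of_forall fun t => ?_)
    refine (norm_integral_le_of_norm_le_const
      (Eventually.of_forall fun s => ξ.norm_coe_le_norm _)).trans ?_
    simp [Measure.real]
  refine h2.congr ?_
  filter_upwards [ae_restrict_mem measurableSet_Ioo] with t ht
  rw [integral_flowLaw hg]
  simp_rw [hFg t (ht.2.le.trans hTτ)]

/-- An evolution is carried, at positive times, by a monotone flow with the same energy. -/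
theorem IsEvolution.exists_flow {lam T : ℝ} (hlam : 0 < lam) (hT : 0 < T)
    {η : Measure (ℝ × Q × ℝ)} {ν : ℝ → Measure Q} {σ : Measure Q} (h : IsEvolution T η ν σ)
    {π : Measure (Q × Q)} (hπ1 : π.map Prod.fst = σ) (hπ2 : π.map Prod.snd = volume)
    {K : ℝ≥0∞} (hK : K ≠ ⊤)
    (hKle : ∫⁻ z in {z | 0 < z.1}, ‖z.2.2‖ₑ ^ 2 ∂η +
      ENNReal.ofReal lam * ∫⁻ q, ‖q.1 - q.2‖ₑ ^ 2 ∂π = K) :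
    ∃ g, IsFlow (extendedTime lam T) K g ∧
      ∀ᵐ t ∂volume.restrict (Ioo 0 T), flowLaw (extendedTime lam T) g t = ν t := by
  have hη := h.isFiniteMeasure
  have hTτ : T ≤ extendedTime lam T := by
    have := inv_pos.2 hlam
    unfold extendedTime; linarith
  have htr := (h.isHalfTransport hT).isTransport hlam hπ1 hπ2
    (ne_top_of_le_ne_top h.energy_ne_top (setLIntegral_le_lintegral _ _))
  rw [hKle] at htr
  obtain ⟨g, hg, hlaw⟩ := htr.exists_flow (hT.le.trans hTτ) hK
  refine ⟨g, hg, ?_⟩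
  have hsub : Ioo 0 T ⊆ Ioo (-T) T := Ioo_subset_Ioo_left (by linarith)
  have hfin : IsFiniteMeasure (η.map fun z => (z.1, z.2.1)) := inferInstance
  refine ae_eq_of_forall_integral_mul_eq (Eventually.of_forall fun t => inferInstance) ?_
    (fun ξ => integrableOn_integral_flowLaw hTτ hg.measurable ξ)
    (fun ξ => (h.integrableOn_integral ξ).mono_set hsub) fun α hα hα0 ξ => ?_
  · exact (ae_restrict_of_ae_restrict_of_subset hsub h.hasSlices.ae_lt_top).mono fun t ht => ⟨ht⟩
  · obtain ⟨A, hA⟩ := hα.bounded_above_of_compact_support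
      (HasCompactSupport.of_support_subset_isCompact (isCompact_Icc (a := 0) (b := T)) fun t ht =>
        Ioo_subset_Icc_self (by by_contra hc; exact ht (hα0 t hc)))
    have hα0' : ∀ t ∉ Ioo 0 (extendedTime lam T), α t = 0 := fun t ht =>
      hα0 t fun hc => ht (Ioo_subset_Ioo_right hTτ hc)
    have h1 := hlaw α hα hα0' ξ
    have hπfin : IsFiniteMeasure π := ⟨by
      have h1 : π.map Prod.snd univ = volume (univ : Set Q) := by rw [hπ2]
      rw [Measure.map_apply measurable_snd MeasurableSet.univ, preimage_univ] at h1
      rw [h1]; simp⟩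
    have hint : ∀ ρ : Measure (ℝ × Q × ℝ), IsFiniteMeasure ρ →
        Integrable (fun z => α z.1 * ξ z.2.1) ρ := fun ρ _ =>
      Integrable.of_bound (by fun_prop) (A * ‖ξ‖) (Eventually.of_forall fun z => by
        rw [norm_mul]
        exact mul_le_mul (hA _) (ξ.norm_coe_le_norm _) (norm_nonneg _)
          ((norm_nonneg _).trans (hA 0)))
    -- The extension by geodesics lives after time T and is invisible to test functions on (0, T).
    have h2 : ∫ z, α z.1 * ξ z.2.1 ∂geodesicTransport lam T π = 0 := by
      refine integral_eq_zero_of_ae ?_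
      filter_upwards [ae_geodesicTransport hlam T π] with z hz
      simp [hα0 z.1 fun hc => (hz.1.1.trans hc.2).false]
    have h3 : ∫ z in {z : ℝ × Q × ℝ | 0 < z.1}, α z.1 * ξ z.2.1 ∂η = ∫ z, α z.1 * ξ z.2.1 ∂η :=
      setIntegral_eq_integral_of_forall_compl_eq_zero fun z hz => by
        rw [hα0 z.1 fun hc => hz hc.1, zero_mul]
    have h4 : ∀ (S : Set ℝ), Ioo 0 T ⊆ S → ∀ f : ℝ → ℝ, ∫ t in S, α t * f t = ∫ t, α t * f t :=
      fun S hS f => setIntegral_eq_integral_of_forall_compl_eq_zero fun t ht => by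
        rw [hα0 t fun hc => ht (hS hc), zero_mul]
    rw [integral_add_measure (hint _ inferInstance) (hint _ inferInstance), h2, add_zero, h3,
      h.integral_mul hα hA, h4 _ (Ioo_subset_Ioo_right hTτ), h4 _ hsub] at h1
    rw [h4 _ subset_rfl, h4 _ subset_rfl, h1]

namespace IsAdmissiblePair

variable {T : ℝ} {μ : Measure (ℝ × Q)} {m : SignedMeasure (ℝ × Q)}

lemma integral_product (h : IsAdmissiblePair T μ m) {α : ℝ → ℝ} {β β' : Q → ℝ}
    (hα : ContDiff ℝ ∞ α) (hαs : HasCompactSupport α) (hαsupp : tsupport α ⊆ Ioo (-T) T)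
    (hβ : ContDiff ℝ ∞ (fun u : ℝ => β u))
    (hβ' : ∀ u : ℝ, HasDerivAt (fun u : ℝ => β u) (β' u) u) :
    ∫ z, (deriv α z.1 * β z.2 + m.rnDeriv μ z * (α z.1 * β' z.2)) ∂μ = 0 := by
  have hsub : tsupport (fun z : ℝ × Q => α z.1 * β z.2) ⊆ tsupport α ×ˢ univ :=
    closure_minimal (fun z hz => ⟨subset_tsupport _ (left_ne_zero_of_mul hz), mem_univ _⟩)
      ((isClosed_tsupport α).prod isClosed_univ)
  have htest : IsTestFunction T fun z => α z.1 * β z.2 :=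
    ⟨(hα.comp contDiff_fst).mul (hβ.comp contDiff_snd),
      HasCompactSupport.of_support_subset_isCompact (hαs.isCompact.prod isCompact_univ)
        ((subset_tsupport _).trans hsub),
      hsub.trans (prod_mono hαsupp le_rfl)⟩
  rw [← h.continuityEq _ htest]
  refine integral_congr_ae (Eventually.of_forall fun z => ?_)
  have h1 : dt (fun z => α z.1 * β z.2) z = deriv α z.1 * β z.2 :=
    ((hα.differentiable (by simp) z.1).hasDerivAt.mul_const (β z.2)).deriv
  have h2 : dx (fun z => α z.1 * β z.2) z = α z.1 * β' z.2 := by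
    obtain ⟨x, hx⟩ : ∃ x : ℝ, (x : Q) = z.2 := QuotientAddGroup.mk_surjective z.2
    have h3 : HasDerivAt (fun h : ℝ => β ((x + h : ℝ) : Q)) (β' x) 0 := by
      have h4 := hβ' (x + 0)
      rw [add_zero] at h4
      have h5 : HasDerivAt (fun u : ℝ => β u) (β' x) (x + 0) := by rwa [add_zero]
      exact h5.comp_const_add x 0
    have h6 := (h3.const_mul (α z.1)).deriv
    rw [← hx]
    simp only [AddCircle.coe_add] at h6
    rw [← h6]
    simp only [dx, ← hx]
  simp only [h1, h2]

lemma hasSlices (h : IsAdmissiblePair T μ m) : HasSlices T μ (slice T μ) :=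
  h.slices.choose_spec.1.slice

lemma ae_isAtomic (h : IsAdmissiblePair T μ m) :
    ∀ᵐ t ∂volume.restrict (Ioo (-T) T), IsAtomic (slice T μ t) := by
  have := h.isFiniteMeasure
  obtain ⟨ν, hν, hat⟩ := h.slices
  filter_upwards [hν.ae_eq_slice, hat] with t h1 h2
  rwa [h1]

/-- The measure is lifted to the graph of its velocity, on which the continuity equation becomes
linear in one measure on time × position × velocity. -/
lemma isEvolution (h : IsAdmissiblePair T μ m) (hE : ∫⁻ z, ‖m.rnDeriv μ z‖ₑ ^ 2 ∂μ ≠ ⊤)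
    {σ : Measure Q} (hσ : IsTopTrace T μ σ) :
    IsEvolution T (μ.map fun z => (z.1, z.2, m.rnDeriv μ z)) (slice T μ) σ := by
  have := h.isFiniteMeasure
  have hm : Measurable fun z : ℝ × Q => (z.1, z.2, m.rnDeriv μ z) :=
    measurable_fst.prodMk (measurable_snd.prodMk (SignedMeasure.measurable_rnDeriv m μ))
  refine ⟨inferInstance, ?_, ?_, fun α β β' hα hαs hαsupp hβ hβ'c hβ' => ?_, hσ.tendsto⟩
  · rwa [lintegral_map (by fun_prop) hm]
  · rw [Measure.map_map (by fun_prop) hm]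
    have : ((fun z : ℝ × Q × ℝ => (z.1, z.2.1)) ∘ fun z : ℝ × Q => (z.1, z.2, m.rnDeriv μ z)) =
      id := rfl
    rw [this, Measure.map_id]
    exact h.hasSlices
  · have hβc := continuous_of_contDiff_coe hβ
    have hα'c : Continuous (deriv α) := hα.continuous_deriv (by simp)
    have hαc := hα.continuous
    rw [integral_map hm.aemeasurable (Continuous.aestronglyMeasurable (by fun_prop))]
    exact h.integral_product hα hαs hαsupp hβ hβ'

/-- Time reversal changes the sign of the velocity and exchanges the two traces. -/
lemma isEvolution_reflect (h : IsAdmissiblePair T μ m)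
    (hE : ∫⁻ z, ‖m.rnDeriv μ z‖ₑ ^ 2 ∂μ ≠ ⊤) {σ : Measure Q} (hσ : IsBottomTrace T μ σ) :
    IsEvolution T (μ.map fun z => (-z.1, z.2, -m.rnDeriv μ z)) (fun t => slice T μ (-t)) σ := by
  have := h.isFiniteMeasure
  have hm : Measurable fun z : ℝ × Q => (-z.1, z.2, -m.rnDeriv μ z) :=
    measurable_fst.neg.prodMk (measurable_snd.prodMk (SignedMeasure.measurable_rnDeriv m μ).neg)
  have hneg : MeasurePreserving (fun t : ℝ => -t) (volume.restrict (Ioo (-T) T))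
      (volume.restrict (Ioo (-T) T)) := by
    have h1 := (Measure.measurePreserving_neg (volume : Measure ℝ)).restrict_preimage
      (s := Ioo (-T) T) measurableSet_Ioo
    simpa using h1
  refine ⟨inferInstance, ?_, ⟨?_, fun A hA => ?_⟩,
    fun α β β' hα hαs hαsupp hβ hβ'c hβ' => ?_, fun ξ => ?_⟩
  · rw [lintegral_map (by fun_prop) hm]
    simpa only [enorm_neg] using hE
  · exact h.hasSlices.aemeasurable.comp_quasiMeasurePreserving hneg.quasiMeasurePreserving
  · have hm2 : Measurable fun z : ℝ × Q => (-z.1, z.2) := by fun_prop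
    rw [Measure.map_map (by fun_prop) hm]
    change (μ.map fun z => (-z.1, z.2)) A = _
    rw [Measure.map_apply hm2 hA, h.hasSlices.apply_eq _ (hm2 hA),
      ← hneg.lintegral_comp_emb (MeasurableEquiv.neg ℝ).measurableEmbedding]
    simp only [← preimage_comp, Function.comp_def, neg_neg]
  · have hβc := continuous_of_contDiff_coe hβ
    have hα'c : Continuous (deriv α) := hα.continuous_deriv (by simp)
    have hαc := hα.continuous
    rw [integral_map hm.aemeasurable (Continuous.aestronglyMeasurable (by fun_prop))]
    have hd : ∀ t, deriv (fun t => -α (-t)) t = deriv α (-t) := by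
      intro t
      rw [deriv.fun_neg, deriv_comp_neg, neg_neg]
    have hsub : tsupport (fun t => -α (-t)) ⊆ -tsupport α :=
      closure_minimal (fun t ht => subset_tsupport _ (neg_ne_zero.1 ht))
        ((isClosed_tsupport α).neg)
    have h1 := h.integral_product (α := fun t => -α (-t)) (hα.comp contDiff_neg).neg
      (HasCompactSupport.of_support_subset_isCompact hαs.isCompact.neg
        ((subset_tsupport _).trans hsub))
      (fun t ht => by
        have := hαsupp (hsub ht)
        exact ⟨by linarith [this.2], by linarith [this.1]⟩) hβ hβ'
    rw [← h1]
    refine integral_congr_ae (Eventually.of_forall fun z => ?_)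
    simp only [hd]
    ring
  · refine (hσ.tendsto ξ).comp ?_
    refine Tendsto.inf ?_ (Measure.measurePreserving_neg
      (volume : Measure ℝ)).quasiMeasurePreserving.tendsto_ae
    exact tendsto_neg_nhdsLT

end IsAdmissiblePair

/-! ### Comparison of the two energies -/

/-- All ingredients of the energy are infima, so a strict inequality selects flux, traces and plans
at once, and optimal plans are not needed. Positivity of lam lets the infima, possibly over empty
sets, pass through the product. -/
lemma exists_data_of_energy_lt {T lam : ℝ} (hlam : 0 < lam) {μ : Measure (ℝ × Q)} {C : ℝ≥0∞}
    (hC : energy lam T μ < C) :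
    ∃ (m : SignedMeasure (ℝ × Q)) (σ σ' : Measure Q) (π π' : Measure (Q × Q)),
      IsAdmissiblePair T μ m ∧ IsTopTrace T μ σ ∧ IsBottomTrace T μ σ' ∧
      (π.map Prod.fst = σ ∧ π.map Prod.snd = volume) ∧
      (π'.map Prod.fst = σ' ∧ π'.map Prod.snd = volume) ∧
      pairEnergy T μ m + ENNReal.ofReal lam *
        (∫⁻ q, ‖q.1 - q.2‖ₑ ^ 2 ∂π + ∫⁻ q, ‖q.1 - q.2‖ₑ ^ 2 ∂π') < C := by
  have h0 : ENNReal.ofReal lam ≠ 0 := by simpa using hlam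
  simp only [energy, internalEnergy, boundaryEnergy, wassersteinSq, ENNReal.iInf_add,
    ENNReal.add_iInf, ENNReal.mul_iInf_of_ne h0 ENNReal.ofReal_ne_top, iInf_lt_iff] at hC
  obtain ⟨σ', hσ', π', hπ', σ, hσ, π, hπ, m, hm, hlt⟩ := hC
  exact ⟨m, σ, σ', π, π', hm, hσ, hσ', hπ, hπ', hlt⟩

/-- The law inherits atomicity from the slices, and for atomic measures `atomSum` counts the atoms.
-/
lemma flowPerimeter_eq {T τ : ℝ} {g : ℝ × ℝ → ℝ} {ν : ℝ → Measure Q}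
    (h : ∀ᵐ t ∂volume.restrict (Ioo 0 T), flowLaw τ g t = ν t)
    (hν : ∀ᵐ t ∂volume.restrict (Ioo 0 T), IsAtomic (ν t)) :
    flowPerimeter T τ g = ∫⁻ t in Ioo 0 T, numAtoms (ν t) := by
  refine lintegral_congr_ae ?_
  filter_upwards [h, hν] with t h1 h2
  rw [← h1] at h2 ⊢
  exact atomSum_eq_numAtoms h2.atoms_compl_null

lemma measurePreserving_neg_Ioo (a b : ℝ) :
    MeasurePreserving (fun t : ℝ => -t) (volume.restrict (Ioo (-b) (-a)))
      (volume.restrict (Ioo a b)) := by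
  have h1 := (Measure.measurePreserving_neg (volume : Measure ℝ)).restrict_preimage
    (s := Ioo a b) measurableSet_Ioo
  simpa using h1

lemma lintegral_pos_add_neg_le {T : ℝ} (f : ℝ → ℝ≥0∞) :
    (∫⁻ t in Ioo 0 T, f t) + ∫⁻ t in Ioo 0 T, f (-t) ≤ ∫⁻ t in Ioo (-T) T, f t := by
  have h1 : ∫⁻ t in Ioo 0 T, f (-t) = ∫⁻ t in Ioo (-T) 0, f t := by
    have := (measurePreserving_neg_Ioo (-T) 0).lintegral_comp_emb
      (MeasurableEquiv.neg ℝ).measurableEmbedding f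
    simpa using this
  rw [h1, add_comm, ← lintegral_union measurableSet_Ioo (by
    rw [Set.disjoint_left]; intro t h1 h2; linarith [h1.2, h2.1])]
  refine lintegral_mono_set (union_subset (fun t ht => ?_) (fun t ht => ?_))
  · exact ⟨ht.1, by linarith [ht.1, ht.2]⟩
  · exact ⟨by linarith [ht.1, ht.2], ht.2⟩

/-- An admissible measure carries a flow of at most half the energy. -/
theorem exists_flow_of_energy_lt {T lam : ℝ} (hT : 0 < T) (hlam : 0 < lam) {μ : Measure (ℝ × Q)}
    {C : ℝ≥0∞} (hC : energy lam T μ < C) :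
    ∃ g K, K ≠ ⊤ ∧ IsFlow (extendedTime lam T) K g ∧
      2 * (flowPerimeter T (extendedTime lam T) g + K) ≤ C ∧
      (IsSymmetric T μ → ∀ᵐ t ∂volume.restrict (Ioo 0 T),
        flowLaw (extendedTime lam T) g t = slice T μ t) := by
  obtain ⟨m, σ, σ', π, π', hm, hσ, hσ', ⟨hπ1, hπ2⟩, ⟨hπ1', hπ2'⟩, hlt⟩ :=
    exists_data_of_energy_lt hlam hC
  have hμ := hm.isFiniteMeasure
  set u := m.rnDeriv μ with hu
  have hum : Measurable u := SignedMeasure.measurable_rnDeriv m μ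
  have hsub : Ioo 0 T ⊆ Ioo (-T) T := Ioo_subset_Ioo_left (by linarith)
  have hsub' : Ioo (-T) 0 ⊆ Ioo (-T) T := Ioo_subset_Ioo_right hT.le
  have hE : ∫⁻ z, ‖u z‖ₑ ^ 2 ∂μ ≠ ⊤ := by
    refine (lt_of_le_of_lt ?_ (hlt.trans_le le_top)).ne
    exact le_add_right (le_add_left le_rfl)
  have hcost : ENNReal.ofReal lam *
      (∫⁻ q, ‖q.1 - q.2‖ₑ ^ 2 ∂π + ∫⁻ q, ‖q.1 - q.2‖ₑ ^ 2 ∂π') ≠ ⊤ :=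
    (lt_of_le_of_lt le_add_self (hlt.trans_le le_top)).ne
  rw [mul_add] at hcost
  have hat := hm.ae_isAtomic
  have hat1 := ae_restrict_of_ae_restrict_of_subset hsub hat
  have hneg := (measurePreserving_neg_Ioo (-T) 0)
  simp only [neg_neg, neg_zero] at hneg
  have hat2 : ∀ᵐ t ∂volume.restrict (Ioo 0 T), IsAtomic (slice T μ (-t)) :=
    hneg.quasiMeasurePreserving.ae (ae_restrict_of_ae_restrict_of_subset hsub' hat)
  have hpos : MeasurableSet {z : ℝ × Q × ℝ | 0 < z.1} :=
    measurableSet_lt measurable_const measurable_fst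
  -- the kinetic energies of the two halves
  have hk1 : ∫⁻ z in {z | 0 < z.1}, ‖z.2.2‖ₑ ^ 2 ∂(μ.map fun z => (z.1, z.2, u z)) =
      ∫⁻ z in {z : ℝ × Q | 0 < z.1}, ‖u z‖ₑ ^ 2 ∂μ := by
    rw [setLIntegral_map hpos (by fun_prop)
      (measurable_fst.prodMk (measurable_snd.prodMk hum))]
    rfl
  have hk2 : ∫⁻ z in {z | 0 < z.1}, ‖z.2.2‖ₑ ^ 2 ∂(μ.map fun z => (-z.1, z.2, -u z)) =
      ∫⁻ z in {z : ℝ × Q | z.1 < 0}, ‖u z‖ₑ ^ 2 ∂μ := by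
    have hmm : Measurable fun z : ℝ × Q => (-z.1, z.2, -u z) :=
      measurable_fst.neg.prodMk (measurable_snd.prodMk hum.neg)
    rw [setLIntegral_map hpos (by fun_prop) hmm]
    simp
  have hk : ∫⁻ z in {z : ℝ × Q | 0 < z.1}, ‖u z‖ₑ ^ 2 ∂μ +
      ∫⁻ z in {z : ℝ × Q | z.1 < 0}, ‖u z‖ₑ ^ 2 ∂μ ≤ ∫⁻ z, ‖u z‖ₑ ^ 2 ∂μ := by
    rw [← lintegral_union (measurableSet_lt measurable_fst measurable_const) (by
      rw [Set.disjoint_left]; intro z h1 h2; exact lt_asymm (show 0 < z.1 from h1) h2)]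
    exact setLIntegral_le_lintegral _ _
  have hper := lintegral_pos_add_neg_le (T := T) fun t => numAtoms (slice T μ t)
  obtain ⟨g1, hg1, hlaw1⟩ := (hm.isEvolution hE hσ).exists_flow hlam hT hπ1 hπ2 (by
    rw [hk1]
    exact ENNReal.add_ne_top.2 ⟨ne_top_of_le_ne_top hE (setLIntegral_le_lintegral _ _),
      ne_top_of_le_ne_top hcost (self_le_add_right _ _)⟩) rfl
  obtain ⟨g2, hg2, hlaw2⟩ := (hm.isEvolution_reflect hE hσ').exists_flow hlam hT hπ1' hπ2' (by
    rw [hk2]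
    exact ENNReal.add_ne_top.2 ⟨ne_top_of_le_ne_top hE (setLIntegral_le_lintegral _ _),
      ne_top_of_le_ne_top hcost (self_le_add_left _ _)⟩) rfl
  rw [hk1] at hg1
  rw [hk2] at hg2
  have hp1 := flowPerimeter_eq hlaw1 hat1
  have hp2 := flowPerimeter_eq hlaw2 hat2
  set A := ∫⁻ z in {z : ℝ × Q | 0 < z.1}, ‖u z‖ₑ ^ 2 ∂μ
  set A' := ∫⁻ z in {z : ℝ × Q | z.1 < 0}, ‖u z‖ₑ ^ 2 ∂μ
  set B := ENNReal.ofReal lam * ∫⁻ q, ‖q.1 - q.2‖ₑ ^ 2 ∂π with hB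
  set B' := ENNReal.ofReal lam * ∫⁻ q, ‖q.1 - q.2‖ₑ ^ 2 ∂π' with hB'
  set P := ∫⁻ t in Ioo 0 T, numAtoms (slice T μ t)
  set P' := ∫⁻ t in Ioo 0 T, numAtoms (slice T μ (-t))
  have htot : (P + (A + B)) + (P' + (A' + B')) ≤ C := by
    refine le_trans ?_ hlt.le
    rw [mul_add, ← hB, ← hB', pairEnergy]
    calc (P + (A + B)) + (P' + (A' + B')) = (P + P') + (A + A') + (B + B') := by ring
      _ ≤ _ := by gcongr
  have hAB : A + B ≠ ⊤ := ENNReal.add_ne_top.2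
    ⟨ne_top_of_le_ne_top hE (setLIntegral_le_lintegral _ _),
      ne_top_of_le_ne_top hcost (self_le_add_right _ _)⟩
  have hAB' : A' + B' ≠ ⊤ := ENNReal.add_ne_top.2
    ⟨ne_top_of_le_ne_top hE (setLIntegral_le_lintegral _ _),
      ne_top_of_le_ne_top hcost (self_le_add_left _ _)⟩
  -- The cheaper half costs at most C/2. For a symmetric measure either half has the prescribed
  -- slices, so the choice does not matter.
  rcases le_total (P + (A + B)) (P' + (A' + B')) with hle | hle
  · refine ⟨g1, A + B, hAB, hg1, ?_, fun _ => hlaw1⟩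
    rw [hp1, two_mul]
    exact (add_le_add le_rfl hle).trans htot
  · refine ⟨g2, A' + B', hAB', hg2, ?_, fun hsymm => ?_⟩
    · rw [hp2, two_mul]
      exact (add_le_add hle le_rfl).trans htot
    · filter_upwards [hlaw2, ae_restrict_of_ae_restrict_of_subset hsub hsymm] with t h1 h2
      rw [h1, h2]

/-! ### A competitor of finite energy -/

/-- A unit mass at rest. -/
lemma isEvolution_rest {T : ℝ} (hT : 0 < T) :
    IsEvolution T ((volume.restrict (Ioo (-T) T)).map fun t => (t, (0 : Q), (0 : ℝ)))
      (fun _ => Measure.dirac 0) (Measure.dirac 0) := by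
  have hm : Measurable fun t : ℝ => (t, (0 : Q), (0 : ℝ)) := by fun_prop
  refine ⟨inferInstance, ?_, ⟨aemeasurable_const, fun A hA => ?_⟩,
    fun α β β' hα hαs hαsupp hβ hβ'c hβ' => ?_, fun ξ => tendsto_const_nhds⟩
  · rw [lintegral_map (by fun_prop) hm]
    simp
  · rw [Measure.map_map (by fun_prop) hm]
    have hm2 : Measurable fun t : ℝ => (t, (0 : Q)) := by fun_prop
    change ((volume.restrict (Ioo (-T) T)).map fun t => (t, (0 : Q))) A = _
    rw [Measure.map_apply hm2 hA, ← lintegral_indicator_one (hm2 hA)]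
    refine lintegral_congr fun t => ?_
    rw [Measure.dirac_apply' _ (measurable_prodMk_left hA)]
    rfl
  · have hβc := continuous_of_contDiff_coe hβ
    have hα'c : Continuous (deriv α) := hα.continuous_deriv (by simp)
    have hαc := hα.continuous
    rw [integral_map hm.aemeasurable (Continuous.aestronglyMeasurable (by fun_prop))]
    simp only [zero_mul, add_zero]
    have h0 : ∀ t ∉ Ioo (-T) T, α t = 0 := fun t ht =>
      image_eq_zero_of_notMem_tsupport fun hc => ht (hαsupp hc)
    rw [integral_mul_const, ← integral_Ioc_eq_integral_Ioo,
      ← intervalIntegral.integral_of_le (by linarith),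
      intervalIntegral.integral_deriv_eq_sub (fun t _ => hα.differentiable (by simp) t)
        (hα'c.intervalIntegrable _ _), h0 T (by simp), h0 (-T) (by simp)]
    simp

lemma isAtomic_dirac (x : Q) : IsAtomic (Measure.dirac x) :=
  ⟨fun i => if i = 0 then 1 else 0, fun _ => x, by
    ext A hA
    rw [Measure.sum_apply _ hA, tsum_eq_single 0 (fun i hi => by simp [hi])]
    simp⟩

lemma numAtoms_dirac_le (x : Q) : numAtoms (Measure.dirac x) ≤ 1 := by
  have h : {y : Q | Measure.dirac x {y} ≠ 0} ⊆ {x} := by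
    intro y hy
    by_contra hne
    refine hy ?_
    rw [Measure.dirac_apply' _ (measurableSet_singleton y)]
    simp only [indicator_apply_eq_zero]
    exact fun hx => absurd hx.symm hne
  have h1 := (encard_le_encard h).trans_eq (encard_singleton x)
  unfold numAtoms
  exact_mod_cast h1

/-- All mass rests at the origin during (-T, T): one atom at each time, no motion, and a bounded
cost for spreading to the uniform measure. -/
lemma exists_lagrangian_lt_top {T lam : ℝ} (hT : 0 < T) (hlam : 0 < lam) :
    ∃ X ∈ curveFamilies (extendedTime lam T), lagrangian lam T X < ⊤ := by
  have hm : Measurable fun x : Q => ((0 : Q), x) := by fun_prop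
  have hcost : ENNReal.ofReal lam *
      ∫⁻ q : Q × Q, ‖q.1 - q.2‖ₑ ^ 2 ∂((volume : Measure Q).map fun x => (0, x)) ≠ ⊤ := by
    refine ENNReal.mul_ne_top ENNReal.ofReal_ne_top ?_
    rw [lintegral_map (by fun_prop) hm]
    refine ((lintegral_mono (g := fun _ => 1) fun x => ?_).trans_lt (by simp)).ne
    have h1 : ‖(0 : Q) - x‖ ≤ 1 := by
      rw [norm_eq_abs_circleRep]
      linarith [abs_circleRep_le ((0 : Q) - x)]
    have h2 : ‖(0 : Q) - x‖ₑ ≤ 1 := by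
      rw [← ofReal_norm]
      simpa using ENNReal.ofReal_le_ofReal h1
    exact pow_le_one₀ zero_le h2
  have hm0 : Measurable fun t : ℝ => (t, (0 : Q), (0 : ℝ)) := by fun_prop
  have hkin : ∫⁻ z in {z : ℝ × Q × ℝ | 0 < z.1}, ‖z.2.2‖ₑ ^ 2
      ∂((volume.restrict (Ioo (-T) T)).map fun t => (t, (0 : Q), (0 : ℝ))) = 0 := by
    refine le_antisymm ((setLIntegral_le_lintegral _ _).trans ?_) zero_le
    rw [lintegral_map (by fun_prop) hm0]
    simp
  obtain ⟨g, hg, hlaw⟩ := (isEvolution_rest hT).exists_flow hlam hT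
    (π := (volume : Measure Q).map fun x => (0, x))
    (by
      rw [Measure.map_map measurable_fst hm]
      change (volume : Measure Q).map (fun _ => (0 : Q)) = _
      rw [Measure.map_const]; simp)
    (by
      rw [Measure.map_map measurable_snd hm]
      exact Measure.map_id)
    hcost (by rw [hkin, zero_add])
  have hTτ : 0 < extendedTime lam T := by
    have := inv_pos.2 hlam
    unfold extendedTime; linarith
  refine ⟨flowFamily (extendedTime lam T) g, hg.isCurveFamily hTτ hcost, ?_⟩
  refine (hg.lagrangian_le hT hlam hcost).trans_lt ?_
  refine ENNReal.mul_lt_top (by simp) (ENNReal.add_lt_top.2 ⟨?_, hcost.lt_top⟩)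
  rw [flowPerimeter_eq hlaw (Eventually.of_forall fun _ => isAtomic_dirac 0)]
  refine (setLIntegral_mono' measurableSet_Ioo fun t _ => numAtoms_dirac_le 0).trans_lt ?_
  simp

/-! ### Existence of minimizers -/

section

variable {T lam : ℝ}

/-- The minimal value of the Lagrangian functional. -/
def minimalValue (lam T : ℝ) : ℝ≥0∞ :=
  ⨅ X ∈ curveFamilies (extendedTime lam T), lagrangian lam T X

lemma extendedTime_pos (hT : 0 < T) (hlam : 0 < lam) : 0 < extendedTime lam T := by
  have := inv_pos.2 hlam
  unfold extendedTime; linarith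

lemma le_extendedTime (hlam : 0 < lam) : T ≤ extendedTime lam T := by
  have := inv_pos.2 hlam
  unfold extendedTime; linarith

lemma minimalValue_lt_top (hT : 0 < T) (hlam : 0 < lam) : minimalValue lam T < ⊤ := by
  obtain ⟨X, hX, hL⟩ := exists_lagrangian_lt_top hT hlam
  exact (iInf₂_le X hX).trans_lt hL

/-- A measure with smaller energy would carry a flow whose reflection is a curve family below the
infimum. -/
lemma minimalValue_le_energy (hT : 0 < T) (hlam : 0 < lam) (μ : Measure (ℝ × Q)) :
    minimalValue lam T ≤ energy lam T μ := by
  by_contra hlt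
  obtain ⟨C, hC1, hC2⟩ := exists_between (not_le.1 hlt)
  obtain ⟨g, K, hK, hg, hle, -⟩ := exists_flow_of_energy_lt hT hlam hC1
  have h1 := hg.isCurveFamily (extendedTime_pos hT hlam) hK
  exact absurd ((iInf₂_le _ h1).trans ((hg.lagrangian_le hT hlam hK).trans hle)) (not_le.2 hC2)

lemma tendsto_minimalValue_add :
    Tendsto (fun n : ℕ => minimalValue lam T + ((n : ℝ≥0∞) + 1)⁻¹) atTop
      (𝓝 (minimalValue lam T)) := by
  have h : Tendsto (fun n : ℕ => ((n : ℝ≥0∞) + 1)⁻¹) atTop (𝓝 0) := by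
    have := (tendsto_add_atTop_iff_nat 1).2 ENNReal.tendsto_inv_nat_nhds_zero
    simpa using this
  simpa using tendsto_const_nhds.add h

lemma minimalValue_lt_add (hT : 0 < T) (hlam : 0 < lam) (n : ℕ) :
    minimalValue lam T < minimalValue lam T + ((n : ℝ≥0∞) + 1)⁻¹ :=
  ENNReal.lt_add_right (minimalValue_lt_top hT hlam).ne
    (ENNReal.inv_ne_zero.2 (by finiteness))

/-- A minimizing sequence of flows has a subsequence that converges to a minimizer. -/
lemma exists_minimizing_limit (hT : 0 < T) (hlam : 0 < lam) {K : ℕ → ℝ≥0∞} {g : ℕ → ℝ × ℝ → ℝ}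
    (h : ∀ n, IsFlow (extendedTime lam T) (K n) (g n))
    (hC : ∀ n, 2 * (flowPerimeter T (extendedTime lam T) (g n) + K n) ≤
      minimalValue lam T + ((n : ℝ≥0∞) + 1)⁻¹) :
    ∃ φ : ℕ → ℕ, StrictMono φ ∧ ∃ g',
      flowFamily (extendedTime lam T) g' ∈ curveFamilies (extendedTime lam T) ∧ Measurable g' ∧
      lagrangian lam T (flowFamily (extendedTime lam T) g') ≤ minimalValue lam T ∧
      ∀ t ∈ Icc 0 (extendedTime lam T),
        WeakTendsto atTop (fun n => flowLaw (extendedTime lam T) (g (φ n)) t)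
          (flowLaw (extendedTime lam T) g' t) := by
  have htop := (minimalValue_lt_top hT hlam).ne
  obtain ⟨φ, hφ, K', g', hK', hg', hle, hweak⟩ := exists_flow_limit (le_extendedTime hlam) h
    (C := fun n => (minimalValue lam T + ((n : ℝ≥0∞) + 1)⁻¹) / 2) (C' := minimalValue lam T / 2)
    (fun n => by
      rw [ENNReal.le_div_iff_mul_le (by simp) (by simp), mul_comm]
      exact hC n)
    (ENNReal.Tendsto.div_const tendsto_minimalValue_add (by simp))
    (ENNReal.div_ne_top htop (by simp))
  refine ⟨φ, hφ, g', hg'.isCurveFamily (extendedTime_pos hT hlam) hK', hg'.measurable, ?_, hweak⟩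
  refine (hg'.lagrangian_le hT hlam hK').trans ?_
  rw [ENNReal.le_div_iff_mul_le (by simp) (by simp), mul_comm] at hle
  exact hle

lemma exists_lagrangian_minimizer (hT : 0 < T) (hlam : 0 < lam) :
    ∃ X ∈ curveFamilies (extendedTime lam T), lagrangian lam T X = minimalValue lam T := by
  have h : ∀ n : ℕ, ∃ g K, IsFlow (extendedTime lam T) K g ∧
      2 * (flowPerimeter T (extendedTime lam T) g + K) ≤
        minimalValue lam T + ((n : ℝ≥0∞) + 1)⁻¹ := by
    intro n
    have h0 : (⨅ X ∈ curveFamilies (extendedTime lam T), lagrangian lam T X) <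
        minimalValue lam T + ((n : ℝ≥0∞) + 1)⁻¹ := minimalValue_lt_add hT hlam n
    simp only [iInf_lt_iff] at h0
    obtain ⟨X, hX, hlt⟩ := h0
    -- Arbitrary curve families have no compactness. Passing to the induced measure and back
    -- replaces them by monotone flows without losing more than the prescribed error.
    obtain ⟨μ, -, hμ, -⟩ := IsCurveFamily.exists_admissible hT hlam hX (hlt.trans_le le_top)
    obtain ⟨g, K, -, hg, hle, -⟩ := exists_flow_of_energy_lt hT hlam (hμ.trans_lt hlt)
    exact ⟨g, K, hg, hle⟩
  choose g K hg hle using h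
  obtain ⟨-, -, g', hX, -, hL, -⟩ := exists_minimizing_limit hT hlam hg hle
  exact ⟨_, hX, hL.antisymm (iInf₂_le _ hX)⟩

/-- A symmetric measure of minimal energy is induced by a minimizer. -/
lemma exists_inducing_minimizer (hT : 0 < T) (hlam : 0 < lam) {μ : Measure (ℝ × Q)}
    (hμ : μ ∈ admissible T) (hE : energy lam T μ = minimalValue lam T) (hsymm : IsSymmetric T μ) :
    ∃ X ∈ curveFamilies (extendedTime lam T), lagrangian lam T X = minimalValue lam T ∧
      IsInducedBy T μ X := by
  set τ := extendedTime lam T with hτ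
  obtain ⟨m, hm⟩ := hμ
  have h : ∀ n : ℕ, ∃ g K, IsFlow τ K g ∧
      2 * (flowPerimeter T τ g + K) ≤ minimalValue lam T + ((n : ℝ≥0∞) + 1)⁻¹ ∧
      ∀ᵐ t ∂volume.restrict (Ioo 0 T), flowLaw τ g t = slice T μ t := by
    intro n
    obtain ⟨g, K, -, hg, hle, hlaw⟩ := exists_flow_of_energy_lt hT hlam
      (hE.trans_lt (minimalValue_lt_add hT hlam n))
    exact ⟨g, K, hg, hle, hlaw hsymm⟩
  choose g K hg hle hlaw using h
  obtain ⟨φ, -, g', hX, hg'm, hL, hweak⟩ := exists_minimizing_limit hT hlam hg hle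
  -- All flows of the sequence have the same law at almost every time, so their weak limit has it as
  -- well.
  have hlaw' : ∀ᵐ t ∂volume.restrict (Ioo 0 T), flowLaw τ g' t = slice T μ t := by
    filter_upwards [ae_all_iff.2 hlaw, ae_restrict_mem measurableSet_Ioo] with t ht htm
    have h1 := hweak t ⟨htm.1.le, htm.2.le.trans (le_extendedTime hlam)⟩
    rw [← ht (φ 0)]
    refine ext_of_forall_integral_eq_of_IsFiniteMeasure fun f => ?_
    refine tendsto_nhds_unique (h1 f.toContinuousMap) ?_
    have h2 : ∀ n, flowLaw τ (g (φ n)) t = flowLaw τ (g (φ 0)) t := fun n => by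
      rw [ht (φ n), ht (φ 0)]
    refine tendsto_const_nhds.congr fun n => ?_
    rw [← h2 n]
    rfl
  have hae : ∀ᵐ t ∂volume.restrict (Ioo (-T) T),
      (volume : Measure Q).map (flowFamily τ g' t) = slice T μ t := by
    rw [IsSymmetric, ae_restrict_iff' measurableSet_Ioo] at hsymm
    rw [ae_restrict_iff' measurableSet_Ioo] at hlaw' ⊢
    have hneg := (Measure.measurePreserving_neg
      (volume : Measure ℝ)).quasiMeasurePreserving.ae hlaw'
    have hne : ∀ᵐ t : ℝ, t ≠ 0 := by simp [ae_iff]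
    filter_upwards [hlaw', hneg, hne, hsymm] with t h1 h2 h3 h4 ht
    rw [map_flowFamily hg'm]
    rcases lt_or_gt_of_ne h3 with h5 | h5
    · rw [abs_of_neg h5, h2 ⟨by linarith, by linarith [ht.1]⟩, h4 ht]
    · rw [abs_of_pos h5, h1 ⟨h5, ht.2⟩]
  -- The measure induced by the limiting family has the slices of μ, hence equals it; in this way μ
  -- also receives its traces.
  obtain ⟨μ', hμ', -, hind⟩ := IsCurveFamily.exists_admissible hT hlam hX
    (hL.trans_lt (minimalValue_lt_top hT hlam))
  have heq : μ' = μ := hind.hasSlices.measure_eq hm.hasSlices hae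
  exact ⟨_, hX, hL.antisymm (iInf₂_le _ hX), heq ▸ hind⟩

end

end BranchedTransport

end

theorem theorem4p2 (T lam : ℝ) (hT : 0 < T) (hlam : 0 < lam) :
    (∃ c : ℝ≥0∞, c < ⊤ ∧
      IsLeast (energy lam T '' admissible T) c ∧
      IsLeast (lagrangian lam T '' curveFamilies (extendedTime lam T)) c) ∧
    (∀ X ∈ curveFamilies (extendedTime lam T),
      IsMinOn (lagrangian lam T) (curveFamilies (extendedTime lam T)) X →
        ∃ μ ∈ admissible T, IsMinOn (energy lam T) (admissible T) μ ∧ IsInducedBy T μ X) ∧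
    (∀ μ ∈ admissible T, IsMinOn (energy lam T) (admissible T) μ → IsSymmetric T μ →
        ∃ X ∈ curveFamilies (extendedTime lam T),
          IsMinOn (lagrangian lam T) (curveFamilies (extendedTime lam T)) X ∧
            IsInducedBy T μ X) := by
  obtain ⟨X₀, hX₀, hL₀⟩ := exists_lagrangian_minimizer hT hlam
  have htop := minimalValue_lt_top hT hlam
  have hlow : ∀ X ∈ curveFamilies (extendedTime lam T), minimalValue lam T ≤ lagrangian lam T X :=
    fun X hX => iInf₂_le X hX
  obtain ⟨μ₀, hμ₀, hE₀, -⟩ := IsCurveFamily.exists_admissible hT hlam hX₀ (hL₀.trans_lt htop)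
  have hE₀' : energy lam T μ₀ = minimalValue lam T :=
    (hE₀.trans_eq hL₀).antisymm (minimalValue_le_energy hT hlam μ₀)
  refine ⟨⟨minimalValue lam T, htop, ⟨⟨μ₀, hμ₀, hE₀'⟩, ?_⟩, ⟨⟨X₀, hX₀, hL₀⟩, ?_⟩⟩, ?_, ?_⟩
  · rintro _ ⟨μ, -, rfl⟩
    exact minimalValue_le_energy hT hlam μ
  · rintro _ ⟨X, hX, rfl⟩
    exact hlow X hX
  · intro X hX hmin
    have hL : lagrangian lam T X ≤ minimalValue lam T := (hmin hX₀).trans_eq hL₀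
    obtain ⟨μ, hμ, hE, hind⟩ := IsCurveFamily.exists_admissible hT hlam hX (hL.trans_lt htop)
    exact ⟨μ, hμ, fun μ' _ => (hE.trans hL).trans (minimalValue_le_energy hT hlam μ'), hind⟩
  · intro μ hμ hmin hsymm
    have hE : energy lam T μ = minimalValue lam T :=
      ((hmin hμ₀).trans_eq hE₀').antisymm (minimalValue_le_energy hT hlam μ)
    obtain ⟨X, hX, hL, hind⟩ := exists_inducing_minimizer hT hlam hμ hE hsymm
    exact ⟨X, hX, fun X' hX' => hL.trans_le (hlow X' hX'), hind⟩
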